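/- Let $0<\alpha<1$ and $k\in\mathbb R$. Let $b\in C^\infty(\mathbb R)$ with $0\le b\le 1$, $b=0$ on $(-\infty,\tfrac12]$, $b=1$ on $[1,\infty)$, $|b'|\le 10$, $|b''|\le 100$, and put $$\psi_\alpha(r,\theta)=|r\theta|\,b\!\left(\frac{|\theta|}{|r|^{1/\alpha}}\right)b\!\left(\frac{|r|}{|\theta|^{1/\alpha}}\right)\ (r\theta\ne0),\qquad \psi_\alpha(r,\theta)=0\ (r\theta=0).$$ Let $\chi\in C_c^\infty(\mathbb R^2)$ with $0\le\chi\le1$, $\chi=1$ on $[-1,1]^2$, $\chi=0$ outside $[-2,2]^2$, let $$\rho_*=\min\left\{\frac14,\ \frac1{4(1+|k|)},\ \frac1{4(1+|k|)\left(15+\frac{10}{\alpha}\right)\sqrt{1+\sec^2(1/2)}}\right\},$$ and let $\varphi_{\alpha,k}(r,\theta)=1+k\,\chi(r/\rho_*,\theta/\rho_*)\,\psi_\alpha(r,\theta)$. On $S^2$ use the latitude $r\in(-\frac\pi2,\frac\pi2)$ and longitude $\theta\in(-\pi,\pi]$ centred at a point $p$, so that $g_{S^2}=dr^2+\cos^2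 r\,d\theta^2$, extend $\varphi_{\alpha,k}$ by $1$ to all of $S^2$, and let $$g_{\alpha,k}=\varphi_{\alpha,k}^{-2}\,g_{S^2}+\varphi_{\alpha,k}^2\,d\xi^2\quad\text{on } M=S^2\times S^1,$$ where $S^1=\mathbb R/2\pi\mathbb Z\ni\xi$. Let $\Gamma=\{p\}\times S^1$ and let $q$ be the point $(r,\theta,\xi)=(0,0,0)$. Let $$0<\rho_0\le\min\left\{\tfrac12\rho_*,\ \sqrt{1+\alpha^2}\,\alpha^{\frac{\alpha}{1-\alpha}}\right\},$$ and let $\Omega=\Omega_+\cup\Omega_-\subset T_qM$, where, writing $(x,y,z)$ for $x\partial_r+y\partial_\theta+z\partial_\xi$, $$\Omega_\pm=\left\{(x,y,z):\ \sqrt{x^2+y^2}\le\rho_0,\ \pm xy>0,\ \alpha|x|\le|y|\le\tfrac1\alpha|x|,\ |z|<\tfrac{\sqrt3}2\rho_0\right\}.$$ For all sufficiently small $t>0$ and every $v\in t\Omega$ there is exactly one geodesic $\gamma:[0,1]\to M$ of $g_{\alpha,k}$ in the coordinate region $|r|<\frac\pi2$ with $\gamma(0)=q$, $\gamma'(0)=v$,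 so that $\exp_q(v)=\gamma(1)$ is well defined on $t\Omega$, and, as $t\to0^+$, $$\mathrm{Vol}_{g_{\alpha,k}}\bigl(\exp_q(t\Omega)\bigr)-t^3\,\mathrm{Vol}_E(\Omega)=\frac{\sqrt3\,\rho_0^5}{6}\left[k\,\frac{1-\alpha^2}{1+\alpha^2}-\left(\arctan\frac1\alpha-\arctan\alpha\right)\right]t^5+O(t^6).$$ Consequently the coefficient of $t^5$ is positive if and only if $k>K_*(\alpha)$, where $$K_*(\alpha)=\frac{1+\alpha^2}{1-\alpha^2}\left(\arctan\frac1\alpha-\arctan\alpha\right).$$ On the other hand, $g_{\alpha,k}$ is smooth on $M\setminus\Gamma$, and if moreover $|\nabla\chi|\le2$ on $\mathbb R^2$, then its scalar curvature satisfies $\mathrm{Scalar}_{g_{\alpha,k}}\ge\frac58>0$ on $M\setminus\Gamma$. -/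

import Mathlib

open Set Filter Topology
open scoped ContDiff

noncomputable section

/-! ### Coordinate Riemannian geometry in dimension three

A metric in coordinates is a matrix-valued function `G` of `x : Fin 3 → ℝ`. -/

/-- Partial derivative `∂ᵢ f (x)`. -/
def partialDeriv (i : Fin 3) (f : (Fin 3 → ℝ) → ℝ) (x : Fin 3 → ℝ) : ℝ :=
  fderiv ℝ f x (Pi.single i 1)

/-- Christoffel symbol `Γᵏᵢⱼ = ½ gᵏˡ (∂ᵢ gⱼₗ + ∂ⱼ gᵢₗ - ∂ₗ gᵢⱼ)`. -/
def christoffel (G : (Fin 3 → ℝ) → Matrix (Fin 3) (Fin 3) ℝ) (k i j : Fin 3)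
    (x : Fin 3 → ℝ) : ℝ :=
  (1 / 2) * ∑ l, (G x)⁻¹ k l *
    (partialDeriv i (fun y => G y j l) x + partialDeriv j (fun y => G y i l) x
      - partialDeriv l (fun y => G y i j) x)

/-- `Ricᵢⱼ = ∂ₖ Γᵏᵢⱼ - ∂ⱼ Γᵏᵢₖ + Γᵏₖₗ Γˡᵢⱼ - Γᵏⱼₗ Γˡᵢₖ`. -/
def ricciCoord (G : (Fin 3 → ℝ) → Matrix (Fin 3) (Fin 3) ℝ) (i j : Fin 3)
    (x : Fin 3 → ℝ) : ℝ :=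
  ∑ k, (partialDeriv k (christoffel G k i j) x - partialDeriv j (christoffel G k i k) x
    + ∑ l, (christoffel G k k l x * christoffel G l i j x
      - christoffel G k j l x * christoffel G l i k x))

/-- Scalar curvature `gⁱʲ Ricᵢⱼ`. -/
def scalarCoord (G : (Fin 3 → ℝ) → Matrix (Fin 3) (Fin 3) ℝ) (x : Fin 3 → ℝ) : ℝ :=
  ∑ i, ∑ j, (G x)⁻¹ i j * ricciCoord G i j x

/-! ### The manifold `S² × S¹` inside `ℝ³ × ℂ` -/

/-- The ambient space `ℝ³ × ℂ`. -/
abbrev Amb : Type := EuclideanSpace ℝ (Fin 3) × ℂ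

/-- `S² × S¹`, the product of the unit sphere of `ℝ³` and the unit circle of `ℂ`. -/
def sphereCircle : Set Amb := {p | ‖p.1‖ = 1 ∧ ‖p.2‖ = 1}

/-- The base point `p` of `S²`. -/
def basePt : EuclideanSpace ℝ (Fin 3) := !₂[1, 0, 0]

/-- The circle `Γ = {p} × S¹`. -/
def singularCircle : Set Amb := {p | p.1 = basePt ∧ ‖p.2‖ = 1}

/-- The coordinates `(r, θ, ξ) = (x 0, x 1, x 2)`: `r` is the latitude and `θ` the longitude on `S²`
(so that `g_{S²} = dr² + cos² r dθ²`), and `ξ` is the angle on `S¹`. The pair `(r, θ) = (0, 0)`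
corresponds to `basePt`. -/
def polarParam (x : Fin 3 → ℝ) : Amb :=
  (!₂[Real.cos (x 0) * Real.cos (x 1), Real.cos (x 0) * Real.sin (x 1), Real.sin (x 0)],
    Complex.exp (x 2 * Complex.I))

/-- The coordinates obtained from `polarParam` by permuting the axes of `ℝ³` cyclically; they cover
the two poles that `polarParam` misses. -/
def polarParamAlt (x : Fin 3 → ℝ) : Amb :=
  (!₂[Real.sin (x 0), Real.cos (x 0) * Real.cos (x 1), Real.cos (x 0) * Real.sin (x 1)],
    Complex.exp (x 2 * Complex.I))

open Classical in
/-- A local parametrization of `S² × S¹` around `p`: `polarParam`, unless the sphere component of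
`p` is one of the poles `(0, 0, ±1)`. -/
def localParam (p : Amb) : (Fin 3 → ℝ) → Amb :=
  if p.1 0 = 0 ∧ p.1 1 = 0 then polarParamAlt else polarParam

open Classical in
/-- The coordinates of `p` in the parametrization `localParam p`. -/
def localCoords (p : Amb) : Fin 3 → ℝ :=
  if p.1 0 = 0 ∧ p.1 1 = 0 then
    ![Real.arcsin (p.1 0), Complex.arg ⟨p.1 1, p.1 2⟩, Complex.arg p.2]
  else
    ![Real.arcsin (p.1 2), Complex.arg ⟨p.1 0, p.1 1⟩, Complex.arg p.2]

/-! ### The warping function and the metric -/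

/-- The hypotheses on the one-variable cutoff `b`. -/
structure IsTransition (b : ℝ → ℝ) : Prop where
  smooth : ContDiff ℝ ∞ b
  eq_zero : ∀ x, x ≤ 1 / 2 → b x = 0
  eq_one : ∀ x, 1 ≤ x → b x = 1
  nonneg : ∀ x, 0 ≤ b x
  le_one : ∀ x, b x ≤ 1
  deriv_le : ∀ x, |deriv b x| ≤ 10
  deriv_two_le : ∀ x, |deriv (deriv b) x| ≤ 100

/-- The hypotheses on the plane cutoff `χ`: smooth with values in `[0, 1]`, equal to `1` on
`[-1, 1]²` and to `0` outside `[-2, 2]²`. -/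
structure IsPlaneCutoff (χ : ℝ × ℝ → ℝ) : Prop where
  smooth : ContDiff ℝ ∞ χ
  nonneg : ∀ x, 0 ≤ χ x
  le_one : ∀ x, χ x ≤ 1
  eq_one : ∀ x, |x.1| ≤ 1 → |x.2| ≤ 1 → χ x = 1
  eq_zero : ∀ x, ¬ (|x.1| ≤ 2 ∧ |x.2| ≤ 2) → χ x = 0

/-- The profile `ψ_α(r, θ) = |rθ| b(|θ| / |r|^{1/α}) b(|r| / |θ|^{1/α})`; the first factor makes it
`0` when `rθ = 0`. -/
def psi (α : ℝ) (b : ℝ → ℝ) (r θ : ℝ) : ℝ :=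
  |r * θ| * b (|θ| / |r| ^ (1 / α)) * b (|r| / |θ| ^ (1 / α))

/-- `ρ_*`, where `sec (1/2) = 1 / cos (1/2)`. -/
def rhoStar (α k : ℝ) : ℝ :=
  min (1 / 4) (min (1 / (4 * (1 + |k|)))
    (1 / (4 * (1 + |k|) * (15 + 10 / α) * √(1 + (1 / Real.cos (1 / 2)) ^ 2))))

/-- The warping function `1 + k χ(r/ρ_*, θ/ρ_*) ψ_α(r, θ)` in the coordinates `(r, θ)`. -/
def warpCoord (α k : ℝ) (b : ℝ → ℝ) (χ : ℝ × ℝ → ℝ) (r θ : ℝ) : ℝ :=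
  1 + k * χ (r / rhoStar α k, θ / rhoStar α k) * psi α b r θ

/-- The warping function `φ_{α,k}` on `S²`: latitude `r = arcsin p₂`, longitude
`θ = arg (p₀ + i p₁) ∈ (-π, π]`. It equals `1` away from a neighbourhood of `basePt`. -/
def warp (α k : ℝ) (b : ℝ → ℝ) (χ : ℝ × ℝ → ℝ) (p : EuclideanSpace ℝ (Fin 3)) : ℝ :=
  warpCoord α k b χ (Real.arcsin (p 2)) (Complex.arg ⟨p 0, p 1⟩)

/-- The metric `φ⁻² g_{S²} + φ² dξ²` at `p ∈ S² × S¹`, on vectors `v, w` tangent to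
`S² × S¹ ⊂ ℝ³ × ℂ`. -/
def warpedMetric (α k : ℝ) (b : ℝ → ℝ) (χ : ℝ × ℝ → ℝ) (p v w : Amb) : ℝ :=
  (warp α k b χ p.1 ^ 2)⁻¹ * inner ℝ v.1 w.1 + warp α k b χ p.1 ^ 2 * inner ℝ v.2 w.2

/-- The matrix `gᵢⱼ(x) = g(∂ᵢF, ∂ⱼF)` of the metric in a parametrization `F` of `S² × S¹`. -/
def metricMatrix (α k : ℝ) (b : ℝ → ℝ) (χ : ℝ × ℝ → ℝ) (F : (Fin 3 → ℝ) → Amb)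
    (x : Fin 3 → ℝ) : Matrix (Fin 3) (Fin 3) ℝ :=
  Matrix.of fun i j => warpedMetric α k b χ (F x)
    (fderiv ℝ F x (Pi.single i 1)) (fderiv ℝ F x (Pi.single j 1))

/-- Scalar curvature at a point `p ∈ S² × S¹` (meaningful where the metric is smooth). -/
def scalarCurvature (α k : ℝ) (b : ℝ → ℝ) (χ : ℝ × ℝ → ℝ) (p : Amb) : ℝ :=
  scalarCoord (metricMatrix α k b χ (localParam p)) (localCoords p)

/-- The metric is smooth near `p ∈ S² × S¹`. -/
def SmoothMetricAt (α k : ℝ) (b : ℝ → ℝ) (χ : ℝ × ℝ → ℝ) (p : Amb) : Prop :=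
  ∀ i j, ContDiffAt ℝ ∞ (fun x => metricMatrix α k b χ (localParam p) x i j) (localCoords p)

/-- A box that `polarParam` maps bijectively onto `S² × S¹` minus the two circles over the poles,
which have measure zero. -/
def polarBox : Set (Fin 3 → ℝ) :=
  {x | x 0 ∈ Ioo (-(Real.pi / 2)) (Real.pi / 2) ∧ x 1 ∈ Ioc (-Real.pi) Real.pi ∧
    x 2 ∈ Ioc (-Real.pi) Real.pi}

/-- The Riemannian volume `∫ √det g dr dθ dξ` of a set of points of `S² × S¹`. -/
def riemVol (α k : ℝ) (b : ℝ → ℝ) (χ : ℝ × ℝ → ℝ) (A : Set Amb) : ENNReal :=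
  ∫⁻ x in polarBox ∩ polarParam ⁻¹' A,
    ENNReal.ofReal (√ (metricMatrix α k b χ polarParam x).det)

/-- `c : [0, 1] → ℝ³` is the coordinate expression of a geodesic `polarParam ∘ c` of the metric that
starts at `q = (0, 0, 0)` with initial velocity `v = v₀ ∂_r + v₁ ∂_θ + v₂ ∂_ξ`; `w` is the velocity
of `c`. The coordinate domain is `|r| < π/2`, where `polarParam` is a local diffeomorphism (a
covering of `S² × S¹` minus the two circles over the poles). -/
structure IsGeodesicFrom (α k : ℝ) (b : ℝ → ℝ) (χ : ℝ × ℝ → ℝ) (v : Fin 3 → ℝ)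
    (c w : ℝ → Fin 3 → ℝ) : Prop where
  start_pos : c 0 = 0
  start_vel : w 0 = v
  mem_domain : ∀ s ∈ Icc (0 : ℝ) 1, |c s 0| < Real.pi / 2
  hasDeriv_pos : ∀ s ∈ Icc (0 : ℝ) 1, HasDerivWithinAt c (w s) (Icc 0 1) s
  hasDeriv_vel : ∀ s ∈ Icc (0 : ℝ) 1, HasDerivWithinAt w
    (fun m => - ∑ i, ∑ j, christoffel (metricMatrix α k b χ polarParam) m i j (c s)
      * w s i * w s j) (Icc 0 1) s

open Classical in
/-- The local exponential map at `q`: `exp_q v = γ(1)` for the geodesic `γ` on `[0, 1]` with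
`γ(0) = q`, `γ'(0) = v` (the value `q` is used when there is no such geodesic). -/
def expAt (α k : ℝ) (b : ℝ → ℝ) (χ : ℝ × ℝ → ℝ) (v : Fin 3 → ℝ) : Amb :=
  if h : ∃ c : ℝ → Fin 3 → ℝ, ∃ w, IsGeodesicFrom α k b χ v c w then polarParam (h.choose 1)
  else polarParam 0

/-! ### The wedge -/

/-- `Ω_+` (for `σ = 1`) and `Ω_-` (for `σ = -1`) in `T_q M`, in the orthonormal basis
`∂_r, ∂_θ, ∂_ξ`. -/
def wedgePart (σ α ρ₀ : ℝ) : Set (Fin 3 → ℝ) :=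
  {v | √(v 0 ^ 2 + v 1 ^ 2) ≤ ρ₀ ∧ 0 < σ * (v 0 * v 1) ∧
    α * |v 0| ≤ |v 1| ∧ |v 1| ≤ 1 / α * |v 0| ∧
    v 2 ∈ Ioo (-(√3 / 2 * ρ₀)) (√3 / 2 * ρ₀)}

/-- `Ω = Ω_+ ∪ Ω_-`. -/
def wedge (α ρ₀ : ℝ) : Set (Fin 3 → ℝ) := wedgePart 1 α ρ₀ ∪ wedgePart (-1) α ρ₀

/-- The dilated set `t Ω`. -/
def dilate (t : ℝ) (Ω : Set (Fin 3 → ℝ)) : Set (Fin 3 → ℝ) := (fun v => t • v) '' Ω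

/-- The coefficient of `t⁵`. -/
def fifthCoeff (α k ρ₀ : ℝ) : ℝ :=
  √3 * ρ₀ ^ 5 / 6 *
    (k * ((1 - α ^ 2) / (1 + α ^ 2)) - (Real.arctan (1 / α) - Real.arctan α))

/-- The threshold `K_*(α)`. -/
def kStar (α : ℝ) : ℝ :=
  (1 + α ^ 2) / (1 - α ^ 2) * (Real.arctan (1 / α) - Real.arctan α)

/-! ### Consistency of the coordinates -/

theorem localParam_localCoords {p : Amb} (hp : p ∈ sphereCircle) :
    localParam p (localCoords p) = p := by
  obtain ⟨⟨p1⟩, z⟩ := p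
  obtain ⟨h1, h2⟩ := hp
  have hs : p1 0 ^ 2 + p1 1 ^ 2 + p1 2 ^ 2 = 1 := by
    have := EuclideanSpace.norm_sq_eq (WithLp.toLp 2 p1)
    simp only [Fin.sum_univ_three, Real.norm_eq_abs, sq_abs] at this
    simp only at h1
    rw [h1] at this
    linarith
  have hz : Complex.exp (z.arg * Complex.I) = z := by
    have := Complex.norm_mul_exp_arg_mul_I z
    simp only at h2
    rwa [h2, Complex.ofReal_one, one_mul] at this
  -- latitude and longitude recover a unit vector `(a, b, c)`
  have key : ∀ a b c : ℝ, a ^ 2 + b ^ 2 + c ^ 2 = 1 →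
      Real.cos (Real.arcsin c) * Real.cos (Complex.arg ⟨a, b⟩) = a ∧
      Real.cos (Real.arcsin c) * Real.sin (Complex.arg ⟨a, b⟩) = b ∧
      Real.sin (Real.arcsin c) = c := by
    intro a b c h
    have hn : Real.cos (Real.arcsin c) = ‖(⟨a, b⟩ : ℂ)‖ := by
      rw [Real.cos_arcsin, Complex.norm_def, Complex.normSq_mk]
      congr 1
      linarith
    refine ⟨?_, ?_, Real.sin_arcsin ?_ ?_⟩
    · rw [hn]; exact Complex.norm_mul_cos_arg ⟨a, b⟩
    · rw [hn]; exact Complex.norm_mul_sin_arg ⟨a, b⟩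
    · nlinarith [sq_nonneg a, sq_nonneg b]
    · nlinarith [sq_nonneg a, sq_nonneg b]
  by_cases hpole : p1 0 = 0 ∧ p1 1 = 0
  · obtain ⟨k1, k2, k3⟩ := key (p1 1) (p1 2) (p1 0) (by linarith)
    ext i
    · fin_cases i <;> simp_all [localParam, localCoords, polarParamAlt]
    · simp [localParam, localCoords, polarParamAlt, hpole, hz]
  · obtain ⟨k1, k2, k3⟩ := key (p1 0) (p1 1) (p1 2) hs
    ext i
    · fin_cases i <;> simp [localParam, localCoords, polarParam, hpole, k1, k2, k3]
    · simp [localParam, localCoords, polarParam, hpole, hz]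

/-- In the coordinates `(r, θ, ξ)` the warping function is `warpCoord`. -/
theorem warp_polarParam (α k : ℝ) (b : ℝ → ℝ) (χ : ℝ × ℝ → ℝ) (x : Fin 3 → ℝ)
    (h0 : |x 0| < Real.pi / 2) (h1 : |x 1| < Real.pi) :
    warp α k b χ (polarParam x).1 = warpCoord α k b χ (x 0) (x 1) := by
  rw [abs_lt] at h0 h1
  have hc : 0 < Real.cos (x 0) := Real.cos_pos_of_mem_Ioo ⟨by linarith, by linarith⟩
  have hz : (⟨Real.cos (x 0) * Real.cos (x 1), Real.cos (x 0) * Real.sin (x 1)⟩ : ℂ)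
      = (Real.cos (x 0) : ℝ) * (Complex.cos (x 1 : ℝ) + Complex.sin (x 1 : ℝ) * Complex.I) := by
    rw [← Complex.ofReal_cos (x 1), ← Complex.ofReal_sin (x 1)]
    apply Complex.ext <;> simp [-Complex.ofReal_cos, -Complex.ofReal_sin]
  simp only [warp, polarParam]
  congr 1
  · simp [Real.arcsin_sin h0.1.le h0.2.le]
  · simp only [Matrix.cons_val_zero, Matrix.cons_val_one]
    rw [hz, Complex.arg_mul_cos_add_sin_mul_I hc ⟨h1.1, h1.2.le⟩]

/-- In the coordinates `(r, θ, ξ)` the metric is `φ⁻² (dr² + cos² r dθ²) + φ² dξ²`. -/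
theorem metricMatrix_polarParam (α k : ℝ) (b : ℝ → ℝ) (χ : ℝ × ℝ → ℝ) (x : Fin 3 → ℝ) :
    metricMatrix α k b χ polarParam x = Matrix.diagonal
      ![(warp α k b χ (polarParam x).1 ^ 2)⁻¹,
        (warp α k b χ (polarParam x).1 ^ 2)⁻¹ * Real.cos (x 0) ^ 2,
        warp α k b χ (polarParam x).1 ^ 2] := by
  set f : Fin 3 → ((Fin 3 → ℝ) →L[ℝ] ℝ) := fun i => ContinuousLinearMap.proj i with hf
  have hx : ∀ i, HasFDerivAt (fun y : Fin 3 → ℝ => y i) (f i) x := fun i =>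
    (ContinuousLinearMap.proj (R := ℝ) (φ := fun _ : Fin 3 => ℝ) i).hasFDerivAt
  have e1 : HasFDerivAt (fun y : Fin 3 → ℝ => Real.cos (y 0) * Real.cos (y 1)) _ x :=
    (hx 0).cos.mul (hx 1).cos
  have e2 : HasFDerivAt (fun y : Fin 3 → ℝ => Real.cos (y 0) * Real.sin (y 1)) _ x :=
    (hx 0).cos.mul (hx 1).sin
  have e3 : HasFDerivAt (fun y : Fin 3 → ℝ => Real.sin (y 0)) _ x := (hx 0).sin
  have e4 : HasFDerivAt (fun y : Fin 3 → ℝ => Complex.exp ((y 2 : ℝ) * Complex.I)) _ x :=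
    ((Complex.ofRealCLM.hasFDerivAt.comp x (hx 2)).mul_const Complex.I).cexp
  have hdiff : DifferentiableAt ℝ polarParam x := by
    refine DifferentiableAt.prodMk ?_ e4.differentiableAt
    rw [differentiableAt_euclidean]
    intro i
    fin_cases i
    · exact e1.differentiableAt
    · exact e2.differentiableAt
    · exact e3.differentiableAt
  have hL := hdiff.hasFDerivAt
  set L := fderiv ℝ polarParam x with hLdef
  have c (i : Fin 3) : HasFDerivAt (fun y : Fin 3 → ℝ => (polarParam y).1 i)
      (((EuclideanSpace.proj (𝕜 := ℝ) i).comp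
        (ContinuousLinearMap.fst ℝ (EuclideanSpace ℝ (Fin 3)) ℂ)).comp L) x :=
    ((EuclideanSpace.proj (𝕜 := ℝ) i).comp
      (ContinuousLinearMap.fst ℝ (EuclideanSpace ℝ (Fin 3)) ℂ)).hasFDerivAt.comp x hL
  have c4 : HasFDerivAt (fun y : Fin 3 → ℝ => (polarParam y).2)
      ((ContinuousLinearMap.snd ℝ (EuclideanSpace ℝ (Fin 3)) ℂ).comp L) x :=
    (ContinuousLinearMap.snd ℝ (EuclideanSpace ℝ (Fin 3)) ℂ).hasFDerivAt.comp x hL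
  have u1 (v : Fin 3 → ℝ) : (L v).1 0 = Real.cos (x 0) * (-Real.sin (x 1) * v 1)
      + Real.cos (x 1) * (-Real.sin (x 0) * v 0) := DFunLike.congr_fun ((c 0).unique e1) v
  have u2 (v : Fin 3 → ℝ) : (L v).1 1 = Real.cos (x 0) * (Real.cos (x 1) * v 1)
      + Real.sin (x 1) * (-Real.sin (x 0) * v 0) := DFunLike.congr_fun ((c 1).unique e2) v
  have u3 (v : Fin 3 → ℝ) : (L v).1 2 = Real.cos (x 0) * v 0 :=
    DFunLike.congr_fun ((c 2).unique e3) v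
  have u4 (v : Fin 3 → ℝ) : (L v).2 = Complex.exp ((x 2 : ℝ) * Complex.I)
      * (Complex.I * (v 2 : ℝ)) := DFunLike.congr_fun (c4.unique e4) v
  have hs0 := Real.sin_sq_add_cos_sq (x 0)
  have hs1 := Real.sin_sq_add_cos_sq (x 1)
  ext i j
  simp only [metricMatrix, Matrix.of_apply, warpedMetric, PiLp.inner_apply, Fin.sum_univ_three,
    u1, u2, u3, u4, ← hLdef]
  generalize warp α k b χ (polarParam x).1 = φ
  fin_cases i <;> fin_cases j <;>
    simp [mul_pow]
  · have : Real.cos (x 1) ^ 2 * Real.sin (x 0) ^ 2 + Real.sin (x 1) ^ 2 * Real.sin (x 0) ^ 2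
        + Real.cos (x 0) ^ 2 = 1 := by linear_combination Real.sin (x 0) ^ 2 * hs1 + hs0
    rw [this, mul_one]
  · right; ring
  · right; ring
  · left; linear_combination Real.cos (x 0) ^ 2 * hs1

end

/-!
On the cones carrying `Ω`, all cutoffs equal `1` near `p`, so there the warping function is
`1 + κ r θ` with `κ = ± k` on `Ω_±`. The geodesics of this model metric from `q` depend smoothly on
their initial velocity and stay in a slightly wider cone, hence they are geodesics of `g_{α,k}`, and
local uniqueness identifies them with all geodesics of `g_{α,k}` having the same initial velocity.

Volumes in the model metric become Euclidean after multiplying the third coordinate by the volume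
density `cos r / (1 + κ r θ)`, which does not depend on `ξ`. The exponential map followed by this
map is the identity plus cubic terms plus `O(|v|⁴)`; by homogeneity the cubic terms contribute `t⁵`
times the integral over `Ω_±` of their divergence, which is evaluated in cylindrical coordinates.
All error terms are controlled in the Lipschitz sense, so that the volume of an image can be
compared with that of the image under the Taylor polynomial.

For a warping function `f` the second derivatives of `f` cancel in the scalar curvature of
`f⁻² (dr² + cos² r dθ²) + f² dξ²`, which equals `2 f² - 2 |∇f|²` with the gradient taken on `S²`.
It therefore suffices that `f` is close to `1` and `|∇f|` is small, which the size of the cutoff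
radius `ρ_*` ensures.
-/

/-! ### Scalar curvature of a circle metric warped over the sphere -/

section PartialDeriv

variable {f g : (Fin 3 → ℝ) → ℝ} {x : Fin 3 → ℝ}

theorem hasFDerivAt_coord (i : Fin 3) (x : Fin 3 → ℝ) :
    HasFDerivAt (fun y : Fin 3 → ℝ => y i)
      (ContinuousLinearMap.proj (R := ℝ) (φ := fun _ : Fin 3 => ℝ) i) x :=
  (ContinuousLinearMap.proj (R := ℝ) (φ := fun _ : Fin 3 => ℝ) i).hasFDerivAt

theorem partialDeriv_eq_of_hasFDerivAt {f' : (Fin 3 → ℝ) →L[ℝ] ℝ} (h : HasFDerivAt f f' x)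
    (i : Fin 3) : partialDeriv i f x = f' (Pi.single i 1) := by
  rw [partialDeriv, h.fderiv]

theorem partialDeriv_congr (h : f =ᶠ[𝓝 x] g) (i : Fin 3) :
    partialDeriv i f x = partialDeriv i g x := by
  rw [partialDeriv, partialDeriv, h.fderiv_eq]

theorem partialDeriv_const (i : Fin 3) (a : ℝ) (x : Fin 3 → ℝ) :
    partialDeriv i (fun _ => a) x = 0 := by
  simp [partialDeriv]

theorem partialDeriv_neg (i : Fin 3) (f : (Fin 3 → ℝ) → ℝ) (x : Fin 3 → ℝ) :
    partialDeriv i (fun y => -f y) x = -partialDeriv i f x := by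
  simp [partialDeriv]

theorem partialDeriv_add (hf : DifferentiableAt ℝ f x) (hg : DifferentiableAt ℝ g x)
    (i : Fin 3) :
    partialDeriv i (fun y => f y + g y) x = partialDeriv i f x + partialDeriv i g x := by
  simp [partialDeriv, fderiv_fun_add hf hg]

theorem partialDeriv_sub (hf : DifferentiableAt ℝ f x) (hg : DifferentiableAt ℝ g x)
    (i : Fin 3) :
    partialDeriv i (fun y => f y - g y) x = partialDeriv i f x - partialDeriv i g x := by
  simp [partialDeriv, fderiv_fun_sub hf hg]

theorem partialDeriv_mul (hf : DifferentiableAt ℝ f x) (hg : DifferentiableAt ℝ g x)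
    (i : Fin 3) :
    partialDeriv i (fun y => f y * g y) x
      = f x * partialDeriv i g x + g x * partialDeriv i f x := by
  simp [partialDeriv, fderiv_fun_mul hf hg]

theorem partialDeriv_pow (hf : DifferentiableAt ℝ f x) (n : ℕ) (i : Fin 3) :
    partialDeriv i (fun y => f y ^ n) x = n * f x ^ (n - 1) * partialDeriv i f x := by
  rw [partialDeriv_eq_of_hasFDerivAt (hf.hasFDerivAt.pow n)]
  simp [partialDeriv]

theorem partialDeriv_inv (hf : DifferentiableAt ℝ f x) (h : f x ≠ 0) (i : Fin 3) :
    partialDeriv i (fun y => (f y)⁻¹) x = -partialDeriv i f x / f x ^ 2 := by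
  have h' : HasFDerivAt (fun y => (f y)⁻¹) _ x :=
    (hasDerivAt_inv h).comp_hasFDerivAt x hf.hasFDerivAt
  rw [partialDeriv_eq_of_hasFDerivAt h']
  simp only [partialDeriv, smul_apply, smul_eq_mul]
  ring

theorem partialDeriv_div (hf : DifferentiableAt ℝ f x) (hg : DifferentiableAt ℝ g x)
    (h : g x ≠ 0) (i : Fin 3) :
    partialDeriv i (fun y => f y / g y) x
      = (partialDeriv i f x * g x - f x * partialDeriv i g x) / g x ^ 2 := by
  simp only [div_eq_mul_inv (G := ℝ) (f _)]
  rw [partialDeriv_mul hf (hg.fun_inv h), partialDeriv_inv hg h]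
  field_simp
  ring

theorem partialDeriv_cos_coord (i j : Fin 3) (x : Fin 3 → ℝ) :
    partialDeriv i (fun y => Real.cos (y j)) x
      = -Real.sin (x j) * (Pi.single i 1 : Fin 3 → ℝ) j := by
  simp [partialDeriv_eq_of_hasFDerivAt (hasFDerivAt_coord j x).cos]

theorem partialDeriv_sin_coord (i j : Fin 3) (x : Fin 3 → ℝ) :
    partialDeriv i (fun y => Real.sin (y j)) x
      = Real.cos (x j) * (Pi.single i 1 : Fin 3 → ℝ) j := by
  simp [partialDeriv_eq_of_hasFDerivAt (hasFDerivAt_coord j x).sin]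

end PartialDeriv

section CoordinateLocality

variable {G H : (Fin 3 → ℝ) → Matrix (Fin 3) (Fin 3) ℝ} {x : Fin 3 → ℝ}

theorem christoffel_congr (h : G =ᶠ[𝓝 x] H) (k i j : Fin 3) :
    christoffel G k i j x = christoffel H k i j x := by
  have entry_eq (a b : Fin 3) : (fun y => G y a b) =ᶠ[𝓝 x] fun y => H y a b :=
    h.mono fun y hy => by simp only [hy]
  simp only [christoffel, h.self_of_nhds, partialDeriv_congr (entry_eq _ _)]

theorem christoffel_eventuallyEq (h : G =ᶠ[𝓝 x] H) (k i j : Fin 3) :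
    christoffel G k i j =ᶠ[𝓝 x] christoffel H k i j :=
  h.eventuallyEq_nhds.mono fun _ hy => christoffel_congr hy k i j

theorem scalarCoord_congr (h : G =ᶠ[𝓝 x] H) : scalarCoord G x = scalarCoord H x := by
  simp only [scalarCoord, ricciCoord, christoffel_congr h, h.self_of_nhds,
    partialDeriv_congr (christoffel_eventuallyEq h _ _ _)]

end CoordinateLocality

/-- The matrix of the metric `f⁻² (dr² + cos² r dθ²) + f² dξ²` in the coordinates
`(r, θ, ξ) = (x 0, x 1, x 2)`. -/
noncomputable def warpDiag (f : (Fin 3 → ℝ) → ℝ) (x : Fin 3 → ℝ) : Matrix (Fin 3) (Fin 3) ℝ :=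
  Matrix.diagonal ![(f x ^ 2)⁻¹, (f x ^ 2)⁻¹ * Real.cos (x 0) ^ 2, f x ^ 2]

/-- The Christoffel symbol `Γᵏᵢⱼ` of `warpDiag f` at latitude `r`, as a function of the value `f`
and of the logarithmic derivatives `p = ∂_r f / f` and `q = ∂_θ f / f`. -/
noncomputable def warpChristoffel (k i j : Fin 3) (f p q r : ℝ) : ℝ :=
  (![!![-p, -q, 0; -q, p * Real.cos r ^ 2 + Real.cos r * Real.sin r, 0; 0, 0, -(f ^ 4 * p)],
    !![q / Real.cos r ^ 2, -p - Real.sin r / Real.cos r, 0;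
      -p - Real.sin r / Real.cos r, -q, 0; 0, 0, -(f ^ 4 * q / Real.cos r ^ 2)],
    !![0, 0, p; 0, 0, q; p, q, 0]] : Fin 3 → Matrix (Fin 3) (Fin 3) ℝ) k i j

section WarpDiag

variable {f : (Fin 3 → ℝ) → ℝ} {x : Fin 3 → ℝ}

theorem inv_warpDiag (hf : f x ≠ 0) (hc : Real.cos (x 0) ≠ 0) :
    (warpDiag f x)⁻¹ = Matrix.diagonal ![f x ^ 2, f x ^ 2 / Real.cos (x 0) ^ 2, (f x ^ 2)⁻¹] := by
  apply Matrix.inv_eq_right_inv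
  rw [warpDiag, Matrix.diagonal_mul_diagonal, ← Matrix.diagonal_one]
  congr 1
  ext i
  fin_cases i <;> simp <;> field_simp

theorem partialDeriv_warpDiag (hd : DifferentiableAt ℝ f x) (hf : f x ≠ 0) (i a b : Fin 3) :
    partialDeriv i (fun y => warpDiag f y a b) x = Matrix.diagonal
      ![-2 * partialDeriv i f x / f x ^ 3,
        -2 * partialDeriv i f x / f x ^ 3 * Real.cos (x 0) ^ 2
          - (f x ^ 2)⁻¹ * (2 * Real.cos (x 0) * Real.sin (x 0)) * (Pi.single i 1 : Fin 3 → ℝ) 0,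
        2 * f x * partialDeriv i f x] a b := by
  have hf2 : f x ^ 2 ≠ 0 := pow_ne_zero 2 hf
  have hcos : DifferentiableAt ℝ (fun y : Fin 3 → ℝ => Real.cos (y 0)) x := by fun_prop
  have inv_sq : partialDeriv i (fun y => (f y ^ 2)⁻¹) x = -2 * partialDeriv i f x / f x ^ 3 := by
    rw [partialDeriv_inv (hd.fun_pow 2) hf2, partialDeriv_pow hd]
    push_cast
    field_simp
  by_cases hab : a = b
  · subst hab
    fin_cases a
    · simpa [warpDiag] using inv_sq
    · simp only [warpDiag, Fin.mk_one, Matrix.diagonal_apply_eq, Matrix.cons_val_one,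
        Matrix.cons_val_zero]
      rw [partialDeriv_mul ((hd.fun_pow 2).fun_inv hf2) (hcos.fun_pow 2), inv_sq,
        partialDeriv_pow hcos, partialDeriv_cos_coord]
      push_cast
      ring
    · simpa [warpDiag, mul_assoc] using partialDeriv_pow hd 2 i
  · simp [warpDiag, Matrix.diagonal_apply_ne _ hab, partialDeriv_const]

theorem christoffel_warpDiag (hd : DifferentiableAt ℝ f x) (hf : f x ≠ 0)
    (hc : Real.cos (x 0) ≠ 0) (h2 : partialDeriv 2 f x = 0) (k i j : Fin 3) :
    christoffel (warpDiag f) k i j x = warpChristoffel k i j (f x) (partialDeriv 0 f x / f x)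
      (partialDeriv 1 f x / f x) (x 0) := by
  unfold christoffel
  simp only [partialDeriv_warpDiag hd hf, inv_warpDiag hf hc, Fin.sum_univ_three]
  fin_cases k <;> fin_cases i <;> fin_cases j
  all_goals simp [warpChristoffel, h2] <;> field_simp <;> ring

theorem christoffel_warpDiag_eventuallyEq (hd : ContDiffAt ℝ 1 f x) (hf : f x ≠ 0)
    (hc : Real.cos (x 0) ≠ 0) (h2 : partialDeriv 2 f =ᶠ[𝓝 x] 0) (k i j : Fin 3) :
    christoffel (warpDiag f) k i j =ᶠ[𝓝 x] fun y => warpChristoffel k i j (f y)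
      (partialDeriv 0 f y / f y) (partialDeriv 1 f y / f y) (y 0) := by
  have hcos : ContinuousAt (fun y : Fin 3 → ℝ => Real.cos (y 0)) x :=
    (Real.continuous_cos.comp (continuous_apply 0)).continuousAt
  filter_upwards [hd.eventually (by simp), hd.continuousAt.eventually_ne hf,
    hcos.eventually_ne hc, h2] with y hdy hfy hcy h2y
  exact christoffel_warpDiag (hdy.differentiableAt (by simp)) hfy hcy h2y k i j

theorem differentiableAt_partialDeriv (hd : ContDiffAt ℝ 2 f x) (i : Fin 3) :
    DifferentiableAt ℝ (partialDeriv i f) x :=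
  ((hd.fderiv_right (m := 1) (by norm_num)).differentiableAt (by simp)).clm_apply
    (differentiableAt_const _)

/-- The second derivatives of `f` cancel: the curvature bound below needs only `|∇f|`. -/
theorem scalarCoord_warpDiag (hd : ContDiffAt ℝ 2 f x) (hf : f x ≠ 0)
    (hc : Real.cos (x 0) ≠ 0) (h2 : partialDeriv 2 f =ᶠ[𝓝 x] 0) :
    scalarCoord (warpDiag f) x = 2 * f x ^ 2 -
      2 * (partialDeriv 0 f x ^ 2 + partialDeriv 1 f x ^ 2 / Real.cos (x 0) ^ 2) := by
  have hΓ := christoffel_warpDiag_eventuallyEq (hd.of_le (by norm_num)) hf hc h2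
  have hdf : DifferentiableAt ℝ f x := hd.differentiableAt (by simp)
  have hlog (k : Fin 3) : DifferentiableAt ℝ (fun y => partialDeriv k f y / f y) x := by
    simpa only [div_eq_mul_inv] using (differentiableAt_partialDeriv hd k).fun_mul (hdf.fun_inv hf)
  simp only [scalarCoord, ricciCoord, hΓ _ _ _ |>.eq_of_nhds, partialDeriv_congr (hΓ _ _ _),
    inv_warpDiag hf hc, Fin.sum_univ_three, warpChristoffel]
  obtain ⟨p, hp⟩ : ∃ p, p = fun y => partialDeriv 0 f y / f y := ⟨_, rfl⟩
  obtain ⟨q, hq⟩ : ∃ q, q = fun y => partialDeriv 1 f y / f y := ⟨_, rfl⟩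
  have hpf : partialDeriv 0 f x = p x * f x := by rw [hp, div_mul_cancel₀ _ hf]
  have hqf : partialDeriv 1 f x = q x * f x := by rw [hq, div_mul_cancel₀ _ hf]
  have hdp : DifferentiableAt ℝ p x := hp ▸ hlog 0
  have hdq : DifferentiableAt ℝ q x := hq ▸ hlog 1
  have hdcos : DifferentiableAt ℝ (fun y : Fin 3 → ℝ => Real.cos (y 0)) x := by fun_prop
  have hdsin : DifferentiableAt ℝ (fun y : Fin 3 → ℝ => Real.sin (y 0)) x := by fun_prop
  have hcos2 : Real.cos (x 0) ^ 2 ≠ 0 := pow_ne_zero 2 hc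
  simp only [← congrFun hp, ← congrFun hq]
  have eta (i : Fin 3) (g : (Fin 3 → ℝ) → ℝ) : partialDeriv i (fun y => g y) = partialDeriv i g :=
    rfl
  simp (disch := first | assumption | fun_prop (disch := assumption))
    [partialDeriv_const, partialDeriv_neg, partialDeriv_add, partialDeriv_sub, partialDeriv_mul,
      partialDeriv_pow, partialDeriv_div, partialDeriv_cos_coord, partialDeriv_sin_coord, eta,
      Matrix.diagonal_apply, hpf, hqf]
  field_simp
  ring

end WarpDiag

/-! ### The warping function away from the singular circle -/

section RhoStar

variable {α k : ℝ}

theorem rhoStar_pos (hα : 0 < α) : 0 < rhoStar α k := by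
  have : 0 < √(1 + (1 / Real.cos (1 / 2)) ^ 2) := Real.sqrt_pos.mpr (by positivity)
  unfold rhoStar
  positivity

theorem rhoStar_le_quarter (α k : ℝ) : rhoStar α k ≤ 1 / 4 := min_le_left _ _

theorem abs_mul_rhoStar_le (α k : ℝ) : |k| * rhoStar α k ≤ 1 / 4 := by
  have hρ : rhoStar α k ≤ 1 / (4 * (1 + |k|)) := (min_le_right _ _).trans (min_le_left _ _)
  calc |k| * rhoStar α k ≤ |k| * (1 / (4 * (1 + |k|))) := by gcongr
    _ ≤ 1 / 4 := by
      rw [mul_one_div, div_le_div_iff₀ (by positivity) (by norm_num)]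
      linarith

theorem rhoStar_gradient_le (hα : 0 < α) :
    |k| * (15 + 10 / α) * (2 * rhoStar α k) * √(1 + (1 / Real.cos (1 / 2)) ^ 2) ≤ 1 / 2 := by
  have hρ : rhoStar α k ≤ 1 / (4 * (1 + |k|) * (15 + 10 / α) *
      √(1 + (1 / Real.cos (1 / 2)) ^ 2)) := (min_le_right _ _).trans (min_le_right _ _)
  have sqrt_pos : 0 < √(1 + (1 / Real.cos (1 / 2)) ^ 2) := Real.sqrt_pos.mpr (by positivity)
  generalize √(1 + (1 / Real.cos (1 / 2)) ^ 2) = s at *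
  calc |k| * (15 + 10 / α) * (2 * rhoStar α k) * s
      ≤ |k| * (15 + 10 / α) * (2 * (1 / (4 * (1 + |k|) * (15 + 10 / α) * s))) * s := by gcongr
    _ = |k| / (1 + |k|) / 2 := by
      field_simp
      norm_num
    _ ≤ 1 / 2 := by
      gcongr
      exact div_le_one_of_le₀ (by linarith) (by positivity)

end RhoStar

section Profile

variable {b : ℝ → ℝ}

theorem psi_comm (α : ℝ) (b : ℝ → ℝ) (r θ : ℝ) : psi α b r θ = psi α b θ r := by
  unfold psi
  rw [mul_comm r θ]
  ring

theorem psi_nonneg (hb : IsTransition b) (α r θ : ℝ) : 0 ≤ psi α b r θ :=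
  mul_nonneg (mul_nonneg (abs_nonneg _) (hb.nonneg _)) (hb.nonneg _)

theorem psi_le (hb : IsTransition b) (α r θ : ℝ) : psi α b r θ ≤ |r * θ| := by
  unfold psi
  rw [mul_assoc]
  exact mul_le_of_le_one_right (abs_nonneg _)
    (mul_le_one₀ (hb.le_one _) (hb.nonneg _) (hb.le_one _))

theorem psi_eventuallyEq_zero (hb : IsTransition b) (α : ℝ) {θ : ℝ} (hθ : θ ≠ 0) :
    (fun p : ℝ × ℝ => psi α b p.1 p.2) =ᶠ[𝓝 (0, θ)] fun _ => 0 := by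
  have hθ' : |θ| ^ (1 / α) ≠ 0 := (Real.rpow_pos_of_pos (abs_pos.mpr hθ) _).ne'
  have continuousAt_ratio :
      ContinuousAt (fun p : ℝ × ℝ => |p.1| / |p.2| ^ (1 / α)) (0, θ) := by
    refine ContinuousAt.div (by fun_prop) ?_ hθ'
    exact ContinuousAt.rpow_const (by fun_prop) (Or.inl (abs_ne_zero.mpr hθ))
  have ratio_lt : ∀ᶠ p : ℝ × ℝ in 𝓝 (0, θ), |p.1| / |p.2| ^ (1 / α) < 1 / 2 :=
    continuousAt_ratio.eventually_lt continuousAt_const (by simp)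
  filter_upwards [ratio_lt] with p hp
  rw [psi, hb.eq_zero _ hp.le, mul_zero]

theorem contDiffAt_psi (hb : IsTransition b) (α : ℝ) {p : ℝ × ℝ} (hp : p ≠ 0) :
    ContDiffAt ℝ ∞ (fun p : ℝ × ℝ => psi α b p.1 p.2) p := by
  obtain ⟨r, θ⟩ := p
  by_cases hr : r = 0
  · subst hr
    have hθ : θ ≠ 0 := fun h => hp (by simp [h])
    exact contDiffAt_const.congr_of_eventuallyEq (psi_eventuallyEq_zero hb α hθ)
  by_cases hθ : θ = 0
  · subst hθ
    have tendsto_swap : Tendsto Prod.swap (𝓝 ((r, 0) : ℝ × ℝ)) (𝓝 (0, r)) :=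
      continuous_swap.tendsto ((r, 0) : ℝ × ℝ)
    refine contDiffAt_const.congr_of_eventuallyEq (f := fun _ => (0 : ℝ)) ?_
    filter_upwards [tendsto_swap.eventually (psi_eventuallyEq_zero hb α hr)] with p hp
    rw [psi_comm]
    exact hp
  have habs_fst : ContDiffAt ℝ ∞ (fun p : ℝ × ℝ => |p.1|) (r, θ) :=
    (contDiffAt_abs hr).comp (r, θ) contDiffAt_fst
  have habs_snd : ContDiffAt ℝ ∞ (fun p : ℝ × ℝ => |p.2|) (r, θ) :=
    (contDiffAt_abs hθ).comp (r, θ) contDiffAt_snd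
  have hr' := abs_pos.mpr hr
  have hθ' := abs_pos.mpr hθ
  have hA := habs_snd.div (habs_fst.rpow_const_of_ne (p := 1 / α) hr'.ne')
    (Real.rpow_pos_of_pos hr' _).ne'
  have hC := habs_fst.div (habs_snd.rpow_const_of_ne (p := 1 / α) hθ'.ne')
    (Real.rpow_pos_of_pos hθ' _).ne'
  refine (((habs_fst.mul habs_snd).mul (hb.smooth.contDiffAt.comp (r, θ) hA)).mul
    (hb.smooth.contDiffAt.comp (r, θ) hC)).congr_of_eventuallyEq (Eventually.of_forall fun p => ?_)
  simp [psi, abs_mul]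

theorem IsTransition.hasDerivAt (hb : IsTransition b) (x : ℝ) : HasDerivAt b (deriv b x) x :=
  (hb.smooth.differentiable (by simp) x).hasDerivAt

theorem IsTransition.abs_deriv_mul_le (hb : IsTransition b) {x : ℝ} (hx : 0 ≤ x) :
    |deriv b x| * x ≤ 10 := by
  rcases le_or_gt x 1 with h | h
  · calc |deriv b x| * x ≤ 10 * 1 := mul_le_mul (hb.deriv_le x) h hx (by norm_num)
      _ = 10 := by norm_num
  · have eventually_one : b =ᶠ[𝓝 x] fun _ => 1 := by
      filter_upwards [lt_mem_nhds h] with y hy using hb.eq_one y hy.le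
    simp [eventually_one.deriv_eq]

/-- The `r`-derivative of `psi` off the axes, divided by `sign r * |θ|`, as a function of
`A = |θ| / |r|^{1/α}` and `C = |r| / |θ|^{1/α}`. -/
noncomputable def psiDerivFactor (α : ℝ) (b : ℝ → ℝ) (A C : ℝ) : ℝ :=
  b A * b C - 1 / α * (deriv b A * A) * b C + b A * (deriv b C * C)

theorem hasDerivAt_psi (hb : IsTransition b) (α : ℝ) {r θ : ℝ} (hr : r ≠ 0) (hθ : θ ≠ 0) :
    HasDerivAt (fun r => psi α b r θ) (SignType.sign r * |θ| *
      psiDerivFactor α b (|θ| / |r| ^ (1 / α)) (|r| / |θ| ^ (1 / α))) r := by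
  have hr' := abs_pos.mpr hr
  have := abs_pos.mpr hθ
  have habs : HasDerivAt (fun r : ℝ => |r|) (SignType.sign r : ℝ) r := hasDerivAt_abs hr
  have hA : HasDerivAt (fun r : ℝ => |θ| / |r| ^ (1 / α))
      (-(SignType.sign r * (1 / α) * (|θ| / |r| ^ (1 / α)) / |r|)) r := by
    have hpow := (Real.rpow_pos_of_pos hr' (1 / α)).ne'
    refine ((hasDerivAt_const r |θ|).div (habs.rpow_const (Or.inl hr'.ne')) hpow).congr_deriv ?_
    rw [Real.rpow_sub_one hr'.ne']
    field_simp
    ring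
  have hC : HasDerivAt (fun r : ℝ => |r| / |θ| ^ (1 / α))
      (SignType.sign r / |θ| ^ (1 / α)) r := habs.div_const _
  have hprod := ((habs.mul_const |θ|).mul ((hb.hasDerivAt _).comp r hA)).mul
    ((hb.hasDerivAt _).comp r hC)
  refine (hprod.congr_of_eventuallyEq (Eventually.of_forall fun p => ?_)).congr_deriv ?_
  · simp [psi, abs_mul]
  · simp only [Function.comp_apply, Pi.mul_apply, psiDerivFactor]
    field_simp
    ring

theorem abs_psiDerivFactor_le (hb : IsTransition b) {α A C : ℝ} (hα : 0 < α) (hA : 0 ≤ A)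
    (hC : 0 ≤ C) : |psiDerivFactor α b A C| ≤ 11 + 10 / α := by
  have hbA := abs_of_nonneg (hb.nonneg A)
  have hbC := abs_of_nonneg (hb.nonneg C)
  have prod_le : |b A * b C| ≤ 1 := by
    rw [abs_mul, hbA, hbC]
    exact mul_le_one₀ (hb.le_one _) (hb.nonneg _) (hb.le_one _)
  have derivA_le : |1 / α * (deriv b A * A) * b C| ≤ 10 / α := by
    rw [abs_mul, abs_mul, abs_mul, hbC, abs_of_nonneg hA, abs_of_pos (by positivity : 0 < 1 / α)]
    calc 1 / α * (|deriv b A| * A) * b C ≤ 1 / α * 10 * 1 := by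
          gcongr
          · exact hb.nonneg _
          · exact hb.abs_deriv_mul_le hA
          · exact hb.le_one _
      _ = 10 / α := by ring
  have derivC_le : |b A * (deriv b C * C)| ≤ 10 := by
    rw [abs_mul, abs_mul, hbA, abs_of_nonneg hC, ← one_mul (10 : ℝ)]
    gcongr
    · exact hb.le_one _
    · exact hb.abs_deriv_mul_le hC
  calc |psiDerivFactor α b A C|
      ≤ |b A * b C| + |1 / α * (deriv b A * A) * b C| + |b A * (deriv b C * C)| :=
        (abs_add_le _ _).trans (by gcongr; exact abs_sub _ _)
    _ ≤ 11 + 10 / α := by linarith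

theorem exists_hasDerivAt_psi (hb : IsTransition b) {α : ℝ} (hα : 0 < α) (r θ : ℝ) :
    ∃ d, HasDerivAt (fun r => psi α b r θ) d r ∧ |d| ≤ (11 + 10 / α) * |θ| := by
  by_cases hθ : θ = 0
  · subst hθ
    exact ⟨0, by simpa [psi] using hasDerivAt_const r (0 : ℝ), by simp⟩
  by_cases hr : r = 0
  · subst hr
    refine ⟨0, ?_, by rw [abs_zero]; positivity⟩
    have tendsto_mk : Tendsto (fun r : ℝ => (r, θ)) (𝓝 0) (𝓝 (0, θ)) :=
      (Continuous.prodMk_left θ).tendsto 0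
    exact (hasDerivAt_const (0 : ℝ) (0 : ℝ)).congr_of_eventuallyEq
      (tendsto_mk.eventually (psi_eventuallyEq_zero hb α hθ))
  refine ⟨_, hasDerivAt_psi hb α hr hθ, ?_⟩
  have abs_sign : |(SignType.sign r : ℝ)| = 1 := by
    rcases lt_or_gt_of_ne hr with h | h <;> simp [h]
  rw [abs_mul, abs_mul, abs_sign, one_mul, abs_abs, mul_comm]
  gcongr
  exact abs_psiDerivFactor_le hb hα (by positivity) (by positivity)

end Profile

section WarpCoord

variable {α : ℝ} {b : ℝ → ℝ} {χ : ℝ × ℝ → ℝ}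

theorem IsPlaneCutoff.scaled_eq_zero (hχ : IsPlaneCutoff χ) {ρ r θ : ℝ} (hρ : 0 < ρ)
    (h : 2 * ρ < |r| ∨ 2 * ρ < |θ|) : χ (r / ρ, θ / ρ) = 0 := by
  refine hχ.eq_zero _ fun hle => ?_
  simp only [abs_div, abs_of_pos hρ, div_le_iff₀ hρ] at hle
  rcases h with h | h <;> linarith

theorem IsPlaneCutoff.swap (hχ : IsPlaneCutoff χ) : IsPlaneCutoff (χ ∘ Prod.swap) where
  smooth := hχ.smooth.comp (contDiff_snd.prodMk contDiff_fst)
  nonneg _ := hχ.nonneg _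
  le_one _ := hχ.le_one _
  eq_one _ h1 h2 := hχ.eq_one _ h2 h1
  eq_zero _ h := hχ.eq_zero _ fun h' => h h'.symm

theorem IsPlaneCutoff.fderiv_swap (hχ : IsPlaneCutoff χ) (x : ℝ × ℝ) :
    fderiv ℝ (χ ∘ Prod.swap) x (1, 0) = fderiv ℝ χ x.swap (0, 1) := by
  have h : HasFDerivAt (χ ∘ Prod.swap) _ x :=
    (hχ.smooth.differentiable (by simp) x.swap).hasFDerivAt.comp x
      (hasFDerivAt_snd.prodMk hasFDerivAt_fst)
  simp [h.fderiv]

theorem IsPlaneCutoff.hasDerivAt_scaled (hχ : IsPlaneCutoff χ) (ρ r θ : ℝ) :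
    HasDerivAt (fun r => χ (r / ρ, θ / ρ)) (1 / ρ * fderiv ℝ χ (r / ρ, θ / ρ) (1, 0)) r := by
  have h : HasDerivAt (fun r => χ (r / ρ, θ / ρ)) (fderiv ℝ χ (r / ρ, θ / ρ) (1 / ρ, 0)) r :=
    (hχ.smooth.differentiable (by simp) _).hasFDerivAt.comp_hasDerivAt r
      (((hasDerivAt_id r).div_const ρ).prodMk (hasDerivAt_const r (θ / ρ)))
  refine h.congr_deriv ?_
  rw [← smul_eq_mul, ← map_smul]
  simp

theorem warpCoord_eq_one (hχ : IsPlaneCutoff χ) (hα : 0 < α) (k : ℝ) (b : ℝ → ℝ) {r θ : ℝ}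
    (h : 2 * rhoStar α k < |r| ∨ 2 * rhoStar α k < |θ|) : warpCoord α k b χ r θ = 1 := by
  simp [warpCoord, hχ.scaled_eq_zero (rhoStar_pos hα) h]

theorem warpCoord_ge (hχ : IsPlaneCutoff χ) (hb : IsTransition b) (hα : 0 < α) (k r θ : ℝ) :
    3 / 4 ≤ warpCoord α k b χ r θ := by
  by_cases h : 2 * rhoStar α k < |r| ∨ 2 * rhoStar α k < |θ|
  · rw [warpCoord_eq_one hχ hα k b h]
    norm_num
  push Not at h
  have hρ := rhoStar_pos (k := k) hα
  have hψ := psi_nonneg hb α r θ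
  have hψρ : psi α b r θ ≤ rhoStar α k := by
    calc psi α b r θ ≤ |r| * |θ| := by rw [← abs_mul]; exact psi_le hb α r θ
      _ ≤ (2 * rhoStar α k) * (2 * rhoStar α k) :=
        mul_le_mul h.1 h.2 (abs_nonneg _) (by positivity)
      _ ≤ rhoStar α k := by nlinarith [rhoStar_le_quarter α k]
  have abs_le_quarter : |k * χ (r / rhoStar α k, θ / rhoStar α k) * psi α b r θ| ≤ 1 / 4 := by
    rw [abs_mul, abs_mul, abs_of_nonneg (hχ.nonneg _), abs_of_nonneg hψ]
    calc _ ≤ |k| * 1 * rhoStar α k := by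
          gcongr
          exact hχ.le_one _
      _ ≤ 1 / 4 := by rw [mul_one]; exact abs_mul_rhoStar_le α k
  rw [warpCoord]
  linarith [(abs_le.mp abs_le_quarter).1]

theorem warpCoord_comm (α k : ℝ) (b : ℝ → ℝ) (χ : ℝ × ℝ → ℝ) (r θ : ℝ) :
    warpCoord α k b χ r θ = warpCoord α k b (χ ∘ Prod.swap) θ r := by
  simp [warpCoord, psi_comm α b r θ]

theorem contDiffAt_warpCoord (hχ : IsPlaneCutoff χ) (hb : IsTransition b) (α k : ℝ) {p : ℝ × ℝ}
    (hp : p ≠ 0) : ContDiffAt ℝ ∞ (fun p : ℝ × ℝ => warpCoord α k b χ p.1 p.2) p := by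
  have hχp : ContDiffAt ℝ ∞ (fun p : ℝ × ℝ => χ (p.1 / rhoStar α k, p.2 / rhoStar α k)) p :=
    hχ.smooth.contDiffAt.comp p
      ((contDiffAt_fst.div_const _).prodMk (contDiffAt_snd.div_const _))
  exact contDiffAt_const.add ((contDiffAt_const.mul hχp).mul (contDiffAt_psi hb α hp))

theorem abs_warpCoord_deriv_le (hχ : IsPlaneCutoff χ) (hb : IsTransition b) (hα : 0 < α)
    {k r θ d G : ℝ} (hr : |r| ≤ 2 * rhoStar α k) (hθ : |θ| ≤ 2 * rhoStar α k) (hG : |G| ≤ 2)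
    (hd : |d| ≤ (11 + 10 / α) * |θ|) :
    |k * (1 / rhoStar α k * G) * psi α b r θ
        + k * χ (r / rhoStar α k, θ / rhoStar α k) * d|
      ≤ |k| * (15 + 10 / α) * (2 * rhoStar α k) := by
  have hρ := rhoStar_pos (k := k) hα
  have hψ := psi_nonneg hb α r θ
  generalize rhoStar α k = ρ at *
  have hψρ : psi α b r θ ≤ 2 * ρ * |θ| := by
    refine (psi_le hb α r θ).trans ?_
    rw [abs_mul]
    gcongr
  have cutoff_term : |k * (1 / ρ * G) * psi α b r θ| ≤ |k| * (4 * |θ|) := by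
    rw [abs_mul, abs_mul, abs_mul, abs_of_pos (by positivity : 0 < 1 / ρ), abs_of_nonneg hψ]
    calc |k| * (1 / ρ * |G|) * psi α b r θ ≤ |k| * (1 / ρ * 2) * (2 * ρ * |θ|) := by gcongr
      _ = |k| * (4 * |θ|) := by field_simp; ring
  have profile_term : |k * χ (r / ρ, θ / ρ) * d| ≤ |k| * ((11 + 10 / α) * |θ|) := by
    rw [abs_mul, abs_mul, abs_of_nonneg (hχ.nonneg _), mul_assoc]
    exact mul_le_mul_of_nonneg_left
      ((mul_le_of_le_one_left (abs_nonneg d) (hχ.le_one _)).trans hd) (abs_nonneg k)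
  calc _ ≤ |k| * (4 * |θ|) + |k| * ((11 + 10 / α) * |θ|) := (abs_add_le _ _).trans (by gcongr)
    _ = |k| * (15 + 10 / α) * |θ| := by ring
    _ ≤ _ := by gcongr

theorem abs_deriv_warpCoord_le (hχ : IsPlaneCutoff χ) (hb : IsTransition b) (hα : 0 < α) (k : ℝ)
    (hgrad : ∀ x, |fderiv ℝ χ x (1, 0)| ≤ 2) (r θ : ℝ) :
    |deriv (fun r => warpCoord α k b χ r θ) r| ≤ |k| * (15 + 10 / α) * (2 * rhoStar α k) := by
  have hρ := rhoStar_pos (k := k) hα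
  by_cases h : 2 * rhoStar α k < |r| ∨ 2 * rhoStar α k < |θ|
  · have eventually_one : (fun r => warpCoord α k b χ r θ) =ᶠ[𝓝 r] fun _ => 1 := by
      rcases h with h | h
      · filter_upwards [continuous_abs.continuousAt.eventually (lt_mem_nhds h)] with s hs
        exact warpCoord_eq_one hχ hα k b (Or.inl hs)
      · exact Eventually.of_forall fun s => warpCoord_eq_one hχ hα k b (Or.inr h)
    rw [eventually_one.deriv_eq, deriv_const, abs_zero]
    positivity
  push Not at h
  obtain ⟨d, hd, hd_le⟩ := exists_hasDerivAt_psi hb hα r θ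
  have hwarp := (((hχ.hasDerivAt_scaled (rhoStar α k) r θ).const_mul k).mul hd).const_add 1
  have hderiv : deriv (fun r => warpCoord α k b χ r θ) r = _ := hwarp.deriv
  rw [hderiv]
  exact abs_warpCoord_deriv_le hχ hb hα h.1 h.2 (hgrad _) hd_le

end WarpCoord

section PartialDerivPlane

variable {g : ℝ × ℝ → ℝ} {x : Fin 3 → ℝ}

theorem hasFDerivAt_comp_plane (hg : DifferentiableAt ℝ g (x 0, x 1)) :
    HasFDerivAt (fun y : Fin 3 → ℝ => g (y 0, y 1))
      ((fderiv ℝ g (x 0, x 1)).comp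
        ((ContinuousLinearMap.proj (R := ℝ) (φ := fun _ : Fin 3 => ℝ) 0).prod
          (ContinuousLinearMap.proj (R := ℝ) (φ := fun _ : Fin 3 => ℝ) 1))) x :=
  hg.hasFDerivAt.comp x ((hasFDerivAt_coord 0 x).prodMk (hasFDerivAt_coord 1 x))

theorem partialDeriv_zero_comp_plane (hg : DifferentiableAt ℝ g (x 0, x 1)) :
    partialDeriv 0 (fun y => g (y 0, y 1)) x = deriv (fun r => g (r, x 1)) (x 0) := by
  have h : HasDerivAt (fun r => g (r, x 1)) (fderiv ℝ g (x 0, x 1) (1, 0)) (x 0) :=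
    HasFDerivAt.comp_hasDerivAt (l := g) (f := fun r => (r, x 1)) (x 0) hg.hasFDerivAt
      ((hasDerivAt_id (x 0)).prodMk (hasDerivAt_const (x 0) (x 1)))
  simp [partialDeriv_eq_of_hasFDerivAt (hasFDerivAt_comp_plane hg), h.deriv]

theorem partialDeriv_one_comp_plane (hg : DifferentiableAt ℝ g (x 0, x 1)) :
    partialDeriv 1 (fun y => g (y 0, y 1)) x = deriv (fun θ => g (x 0, θ)) (x 1) := by
  have h : HasDerivAt (fun θ => g (x 0, θ)) (fderiv ℝ g (x 0, x 1) (0, 1)) (x 1) :=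
    HasFDerivAt.comp_hasDerivAt (l := g) (f := fun θ => (x 0, θ)) (x 1) hg.hasFDerivAt
      ((hasDerivAt_const (x 1) (x 0)).prodMk (hasDerivAt_id (x 1)))
  simp [partialDeriv_eq_of_hasFDerivAt (hasFDerivAt_comp_plane hg), h.deriv]

theorem partialDeriv_two_comp_plane (hg : DifferentiableAt ℝ g (x 0, x 1)) :
    partialDeriv 2 (fun y => g (y 0, y 1)) x = 0 := by
  simp [partialDeriv_eq_of_hasFDerivAt (hasFDerivAt_comp_plane hg), ← Prod.zero_eq_mk]

end PartialDerivPlane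

section GradientBound

variable {α : ℝ} {b : ℝ → ℝ} {χ : ℝ × ℝ → ℝ}

theorem warpCoord_comp_eventuallyEq_one (hχ : IsPlaneCutoff χ) (hα : 0 < α) (k : ℝ) (b : ℝ → ℝ)
    {x : Fin 3 → ℝ} (hx : 1 / 2 < |x 0|) :
    (fun y : Fin 3 → ℝ => warpCoord α k b χ (y 0) (y 1)) =ᶠ[𝓝 x] fun _ => 1 := by
  have habs : Continuous fun y : Fin 3 → ℝ => |y 0| := by fun_prop
  filter_upwards [habs.continuousAt.eventually (lt_mem_nhds hx)] with y hy
  exact warpCoord_eq_one hχ hα k b (Or.inl (by linarith [rhoStar_le_quarter α k]))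

theorem gradient_warpCoord_le (hχ : IsPlaneCutoff χ) (hb : IsTransition b) (hα : 0 < α) (k : ℝ)
    (hgrad : ∀ x, fderiv ℝ χ x (1, 0) ^ 2 + fderiv ℝ χ x (0, 1) ^ 2 ≤ 4) {x : Fin 3 → ℝ}
    (hx : (x 0, x 1) ≠ (0 : ℝ × ℝ)) :
    partialDeriv 0 (fun y => warpCoord α k b χ (y 0) (y 1)) x ^ 2
      + partialDeriv 1 (fun y => warpCoord α k b χ (y 0) (y 1)) x ^ 2 / Real.cos (x 0) ^ 2
      ≤ 1 / 4 := by
  rcases lt_or_ge (1 / 2) |x 0| with hfar | hnear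
  · have h := warpCoord_comp_eventuallyEq_one hχ hα k b hfar
    simp [partialDeriv_congr h, partialDeriv_const]
  have hdiff := (contDiffAt_warpCoord hχ hb α k hx).differentiableAt (by simp)
  have gradR (y : ℝ × ℝ) : |fderiv ℝ χ y (1, 0)| ≤ 2 :=
    abs_le_of_sq_le_sq (by nlinarith [hgrad y, sq_nonneg (fderiv ℝ χ y (0, 1))]) (by norm_num)
  have gradθ (y : ℝ × ℝ) : |fderiv ℝ (χ ∘ Prod.swap) y (1, 0)| ≤ 2 := by
    rw [hχ.fderiv_swap]
    exact abs_le_of_sq_le_sq (by nlinarith [hgrad y.swap, sq_nonneg (fderiv ℝ χ y.swap (1, 0))])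
      (by norm_num)
  have boundR := abs_deriv_warpCoord_le hχ hb hα k gradR (x 0) (x 1)
  have boundθ := abs_deriv_warpCoord_le hχ.swap hb hα k gradθ (x 1) (x 0)
  simp only [← warpCoord_comm] at boundθ
  rw [partialDeriv_zero_comp_plane hdiff, partialDeriv_one_comp_plane hdiff]
  have hB := rhoStar_gradient_le (k := k) hα
  have hB0 : 0 ≤ |k| * (15 + 10 / α) * (2 * rhoStar α k) := (abs_nonneg _).trans boundR
  generalize |k| * (15 + 10 / α) * (2 * rhoStar α k) = B at *
  have hcos : Real.cos (1 / 2) ≤ Real.cos (x 0) := by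
    rw [← Real.cos_abs (x 0)]
    exact Real.cos_le_cos_of_nonneg_of_le_pi (abs_nonneg _) (by linarith [Real.pi_gt_three]) hnear
  have hcos_half : 0 < Real.cos (1 / 2) :=
    Real.cos_pos_of_mem_Ioo ⟨by linarith [Real.pi_gt_three], by linarith [Real.pi_gt_three]⟩
  calc _ ≤ B ^ 2 + B ^ 2 / Real.cos (1 / 2) ^ 2 := by
        have sqR := sq_le_sq.mpr (boundR.trans (le_abs_self B))
        have sqθ := sq_le_sq.mpr (boundθ.trans (le_abs_self B))
        gcongr
    _ = (B * √(1 + (1 / Real.cos (1 / 2)) ^ 2)) ^ 2 := by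
        rw [mul_pow, Real.sq_sqrt (by positivity)]
        ring
    _ ≤ (1 / 2) ^ 2 := by gcongr
    _ = 1 / 4 := by norm_num

end GradientBound

section LocalForm

variable {α : ℝ} {b : ℝ → ℝ} {χ : ℝ × ℝ → ℝ}

theorem contDiffAt_warpDiag {f : (Fin 3 → ℝ) → ℝ} {x : Fin 3 → ℝ} {n : WithTop ℕ∞}
    (hf : ContDiffAt ℝ n f x) (hfx : f x ≠ 0) (i j : Fin 3) :
    ContDiffAt ℝ n (fun y => warpDiag f y i j) x := by
  have hcos : ContDiffAt ℝ n (fun y : Fin 3 → ℝ => Real.cos (y 0)) x :=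
    (Real.contDiff_cos.comp (contDiff_apply ℝ ℝ 0)).contDiffAt
  have hinv : ContDiffAt ℝ n (fun y => (f y ^ 2)⁻¹) x := (hf.pow 2).inv (pow_ne_zero 2 hfx)
  by_cases hij : i = j
  · subst hij
    fin_cases i
    · simpa [warpDiag] using hinv
    · simpa [warpDiag] using hinv.mul (hcos.pow 2)
    · simpa [warpDiag] using hf.pow 2
  · simpa [warpDiag, Matrix.diagonal_apply_ne _ hij] using contDiffAt_const

theorem scalarCoord_warpDiag_ge {f : (Fin 3 → ℝ) → ℝ} {x : Fin 3 → ℝ}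
    (hd : ContDiffAt ℝ 2 f x) (hf : 3 / 4 ≤ f x) (hc : Real.cos (x 0) ≠ 0)
    (h2 : partialDeriv 2 f =ᶠ[𝓝 x] 0)
    (hgrad : partialDeriv 0 f x ^ 2 + partialDeriv 1 f x ^ 2 / Real.cos (x 0) ^ 2 ≤ 1 / 4) :
    5 / 8 ≤ scalarCoord (warpDiag f) x := by
  rw [scalarCoord_warpDiag hd (by linarith) hc h2]
  nlinarith

theorem differentiable_polarParam : Differentiable ℝ polarParam := by
  refine Differentiable.prodMk (differentiable_euclidean.mpr fun i => ?_) (by fun_prop)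
  fin_cases i <;>
    simp only [Fin.mk_one, Fin.zero_eta, Fin.reduceFinMk, Matrix.cons_val] <;> fun_prop

theorem metricMatrix_polarParam_eq (α k : ℝ) (b : ℝ → ℝ) (χ : ℝ × ℝ → ℝ) :
    metricMatrix α k b χ polarParam = warpDiag fun x => warp α k b χ (polarParam x).1 :=
  funext fun x => metricMatrix_polarParam α k b χ x

theorem metricMatrix_comp_isometry {k k' : ℝ}
    (A : EuclideanSpace ℝ (Fin 3) ≃ₗᵢ[ℝ] EuclideanSpace ℝ (Fin 3)) {F : (Fin 3 → ℝ) → Amb}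
    {x : Fin 3 → ℝ} (hF : DifferentiableAt ℝ F x)
    (hwarp : warp α k b χ (A (F x).1) = warp α k' b χ (F x).1) :
    metricMatrix α k b χ (fun y => (A (F y).1, (F y).2)) x = metricMatrix α k' b χ F x := by
  have h : HasFDerivAt (fun y => (A (F y).1, (F y).2)) _ x :=
    (A.toContinuousLinearEquiv.hasFDerivAt.comp x hF.hasFDerivAt.fst).prodMk hF.hasFDerivAt.snd
  ext i j
  simp [metricMatrix, warpedMetric, h.fderiv, hwarp]

theorem polarParamAlt_eq_cyclic (x : Fin 3 → ℝ) :
    polarParamAlt x = (LinearIsometryEquiv.piLpCongrLeft 2 ℝ ℝ (finRotate 3) (polarParam x).1,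
      (polarParam x).2) := by
  refine Prod.ext ?_ rfl
  ext i
  fin_cases i <;> simp [polarParamAlt, polarParam, LinearIsometryEquiv.piLpCongrLeft_apply]

theorem continuous_polarParamAlt : Continuous polarParamAlt := by
  simp only [funext polarParamAlt_eq_cyclic]
  have := differentiable_polarParam.continuous
  fun_prop

theorem metricMatrix_polarParamAlt {k : ℝ} {x : Fin 3 → ℝ}
    (hwarp : warp α k b χ (polarParamAlt x).1 = 1) :
    metricMatrix α k b χ polarParamAlt x = warpDiag (fun _ => 1) x := by
  have warp_zero (p : EuclideanSpace ℝ (Fin 3)) : warp α 0 b χ p = 1 := by simp [warp, warpCoord]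
  rw [polarParamAlt_eq_cyclic] at hwarp
  rw [funext polarParamAlt_eq_cyclic, metricMatrix_comp_isometry _
    (differentiable_polarParam x) (hwarp.trans (warp_zero _).symm), metricMatrix_polarParam_eq]
  simp only [warpDiag, warp_zero]

theorem warp_polarParam_eventuallyEq (hχ : IsPlaneCutoff χ) (hα : 0 < α) (k : ℝ) (b : ℝ → ℝ)
    {x : Fin 3 → ℝ} (h0 : |x 0| < Real.pi / 2) (h1 : x 1 ∈ Ioc (-Real.pi) Real.pi) :
    (fun y => warp α k b χ (polarParam y).1) =ᶠ[𝓝 x]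
      fun y => warpCoord α k b χ (y 0) (y 1) := by
  have hρ := rhoStar_le_quarter α k
  have near0 : ∀ᶠ y : Fin 3 → ℝ in 𝓝 x, |y 0| < Real.pi / 2 :=
    (continuous_abs.comp (continuous_apply 0)).continuousAt.eventually (gt_mem_nhds h0)
  rcases h1.2.lt_or_eq with h | h
  · have near1 : ∀ᶠ y : Fin 3 → ℝ in 𝓝 x, |y 1| < Real.pi :=
      (continuous_abs.comp (continuous_apply 1)).continuousAt.eventually
        (gt_mem_nhds (abs_lt.mpr ⟨h1.1, h⟩))
    filter_upwards [near0, near1] with y y0 y1 using warp_polarParam α k b χ y y0 y1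
  · have hpi := Real.pi_gt_three
    have near1 : ∀ᶠ y : Fin 3 → ℝ in 𝓝 x, Real.pi / 2 < y 1 ∧ y 1 < Real.pi + Real.pi / 2 :=
      (continuous_apply 1).continuousAt.eventually
        (Ioo_mem_nhds (by simp only [h]; linarith) (by simp only [h]; linarith))
    filter_upwards [near0, near1] with y y0 y1
    rw [warpCoord_eq_one hχ hα k b (Or.inr (by rw [abs_of_pos] <;> linarith [y1.1]))]
    refine warpCoord_eq_one hχ hα k b (Or.inr ?_)
    have arg_large : ¬ |Complex.arg ⟨(polarParam y).1 0, (polarParam y).1 1⟩| ≤ Real.pi / 2 := by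
      rw [Complex.abs_arg_le_pi_div_two_iff, not_le]
      exact mul_neg_of_pos_of_neg (Real.cos_pos_of_mem_Ioo (abs_lt.mp y0))
        (Real.cos_neg_of_pi_div_two_lt_of_lt y1.1 (by linarith))
    linarith [not_le.mp arg_large]

theorem metricMatrix_polarParam_eventuallyEq (hχ : IsPlaneCutoff χ) (hα : 0 < α) (k : ℝ)
    (b : ℝ → ℝ) {x : Fin 3 → ℝ} (h0 : |x 0| < Real.pi / 2)
    (h1 : x 1 ∈ Ioc (-Real.pi) Real.pi) :
    metricMatrix α k b χ polarParam =ᶠ[𝓝 x]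
      warpDiag fun y => warpCoord α k b χ (y 0) (y 1) := by
  rw [metricMatrix_polarParam_eq]
  filter_upwards [warp_polarParam_eventuallyEq hχ hα k b h0 h1] with y hy
  simp only [warpDiag, hy]

variable {p : Amb}

theorem localCoords_zero_of_pole (hpole : p.1 0 = 0 ∧ p.1 1 = 0) : localCoords p 0 = 0 := by
  simp [localCoords, hpole]

theorem metricMatrix_eventuallyEq_of_pole (hχ : IsPlaneCutoff χ) (hα : 0 < α) (k : ℝ)
    (b : ℝ → ℝ) (hp : p ∈ sphereCircle) (hpole : p.1 0 = 0 ∧ p.1 1 = 0) :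
    metricMatrix α k b χ (localParam p) =ᶠ[𝓝 (localCoords p)] warpDiag fun _ => 1 := by
  have hpar := localParam_localCoords hp
  have hF : localParam p = polarParamAlt := by simp [localParam, hpole]
  rw [hF] at hpar ⊢
  have latitude_gt : 1 / 2 < |Real.arcsin (p.1 2)| := by
    have sq_eq_one : p.1 2 ^ 2 = 1 := by
      have norm_sq := EuclideanSpace.norm_sq_eq p.1
      simpa [hp.1, Fin.sum_univ_three, hpole] using norm_sq.symm
    rw [sq, mul_self_eq_one_iff] at sq_eq_one
    have habs : |Real.arcsin (p.1 2)| = Real.pi / 2 := by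
      rcases sq_eq_one with h | h <;> simp [h, abs_of_pos Real.pi_div_two_pos]
    linarith [Real.pi_gt_three]
  have hcont : Continuous fun y => |Real.arcsin ((polarParamAlt y).1 2)| :=
    (Real.continuous_arcsin.comp ((EuclideanSpace.proj (𝕜 := ℝ) (2 : Fin 3)).continuous.comp
      continuous_polarParamAlt.fst)).abs
  have latitude_gt_near : ∀ᶠ y in 𝓝 (localCoords p),
      1 / 2 < |Real.arcsin ((polarParamAlt y).1 2)| :=
    hcont.continuousAt.eventually (lt_mem_nhds (by simpa only [hpar] using latitude_gt))
  filter_upwards [latitude_gt_near] with y hy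
  exact metricMatrix_polarParamAlt
    (warpCoord_eq_one hχ hα k b (Or.inl (by linarith [rhoStar_le_quarter α k])))

theorem polarParam_localCoords (hp : p ∈ sphereCircle) (hpole : ¬(p.1 0 = 0 ∧ p.1 1 = 0)) :
    polarParam (localCoords p) = p := by
  simpa only [localParam, if_neg hpole] using localParam_localCoords hp

theorem localCoords_mem_of_not_pole (hp : p ∈ sphereCircle) (hpole : ¬(p.1 0 = 0 ∧ p.1 1 = 0)) :
    |localCoords p 0| < Real.pi / 2 ∧ localCoords p 1 ∈ Ioc (-Real.pi) Real.pi := by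
  have hpar := polarParam_localCoords hp hpole
  have hx : localCoords p = ![Real.arcsin (p.1 2), Complex.arg ⟨p.1 0, p.1 1⟩, Complex.arg p.2] :=
    if_neg hpole
  refine ⟨lt_of_le_of_ne ?_ fun h => hpole ?_, ?_⟩
  · rw [hx, abs_le]
    exact ⟨Real.neg_pi_div_two_le_arcsin _, Real.arcsin_le_pi_div_two _⟩
  · have hcos : Real.cos (localCoords p 0) = 0 := by
      rw [← Real.cos_abs, h, Real.cos_pi_div_two]
    rw [← hpar]
    simp [polarParam, hcos]
  · rw [hx]
    exact Complex.arg_mem_Ioc _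

theorem localCoords_ne_zero (hp : p ∈ sphereCircle \ singularCircle)
    (hpole : ¬(p.1 0 = 0 ∧ p.1 1 = 0)) : (localCoords p 0, localCoords p 1) ≠ (0 : ℝ × ℝ) := by
  intro h
  rw [Prod.mk_eq_zero] at h
  refine hp.2 ⟨?_, hp.1.2⟩
  rw [← polarParam_localCoords hp.1 hpole]
  simp [polarParam, h, basePt]

theorem contDiffAt_warpCoord_comp (hχ : IsPlaneCutoff χ) (hb : IsTransition b) (α k : ℝ)
    {x : Fin 3 → ℝ} (hx : (x 0, x 1) ≠ (0 : ℝ × ℝ)) :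
    ContDiffAt ℝ ∞ (fun y : Fin 3 → ℝ => warpCoord α k b χ (y 0) (y 1)) x :=
  ContDiffAt.comp (f := fun y : Fin 3 → ℝ => (y 0, y 1)) x (contDiffAt_warpCoord hχ hb α k hx)
    ((contDiff_apply ℝ ℝ (0 : Fin 3)).prodMk (contDiff_apply ℝ ℝ (1 : Fin 3))).contDiffAt

theorem partialDeriv_two_warpCoord_comp (hχ : IsPlaneCutoff χ) (hb : IsTransition b) (α k : ℝ)
    {x : Fin 3 → ℝ} (hx : (x 0, x 1) ≠ (0 : ℝ × ℝ)) :
    partialDeriv 2 (fun y => warpCoord α k b χ (y 0) (y 1)) =ᶠ[𝓝 x] 0 := by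
  have hcont : Continuous fun y : Fin 3 → ℝ => (y 0, y 1) := by fun_prop
  filter_upwards [hcont.continuousAt.eventually_ne hx] with y hy
  exact partialDeriv_two_comp_plane ((contDiffAt_warpCoord hχ hb α k hy).differentiableAt (by simp))

theorem smoothMetricAt (hχ : IsPlaneCutoff χ) (hb : IsTransition b) (hα : 0 < α) (k : ℝ)
    (hp : p ∈ sphereCircle \ singularCircle) : SmoothMetricAt α k b χ p := by
  intro i j
  by_cases hpole : p.1 0 = 0 ∧ p.1 1 = 0
  · refine (contDiffAt_warpDiag contDiffAt_const one_ne_zero i j).congr_of_eventuallyEq ?_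
    filter_upwards [metricMatrix_eventuallyEq_of_pole hχ hα k b hp.1 hpole] with y hy
    rw [hy]
  · obtain ⟨h0, h1⟩ := localCoords_mem_of_not_pole hp.1 hpole
    refine (contDiffAt_warpDiag (contDiffAt_warpCoord_comp hχ hb α k
      (localCoords_ne_zero hp hpole)) ?_ i j).congr_of_eventuallyEq ?_
    · linarith [warpCoord_ge hχ hb hα k (localCoords p 0) (localCoords p 1)]
    · filter_upwards [metricMatrix_polarParam_eventuallyEq hχ hα k b h0 h1] with y hy
      rw [localParam, if_neg hpole, hy]

theorem scalarCurvature_ge (hχ : IsPlaneCutoff χ) (hb : IsTransition b) (hα : 0 < α) (k : ℝ)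
    (hgrad : ∀ x, fderiv ℝ χ x (1, 0) ^ 2 + fderiv ℝ χ x (0, 1) ^ 2 ≤ 4)
    (hp : p ∈ sphereCircle \ singularCircle) : 5 / 8 ≤ scalarCurvature α k b χ p := by
  rw [scalarCurvature]
  by_cases hpole : p.1 0 = 0 ∧ p.1 1 = 0
  · have hconst (i : Fin 3) : partialDeriv i (fun _ => 1) = 0 :=
      funext fun x => partialDeriv_const i 1 x
    rw [scalarCoord_congr (metricMatrix_eventuallyEq_of_pole hχ hα k b hp.1 hpole)]
    exact scalarCoord_warpDiag_ge contDiffAt_const (by norm_num)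
      (by simp [localCoords_zero_of_pole hpole]) (by rw [hconst]) (by simp [hconst])
  · obtain ⟨h0, h1⟩ := localCoords_mem_of_not_pole hp.1 hpole
    have hne := localCoords_ne_zero hp hpole
    rw [localParam, if_neg hpole,
      scalarCoord_congr (metricMatrix_polarParam_eventuallyEq hχ hα k b h0 h1)]
    exact scalarCoord_warpDiag_ge
      ((contDiffAt_warpCoord_comp hχ hb α k hne).of_le (by norm_cast))
      (warpCoord_ge hχ hb hα k _ _) (Real.cos_pos_of_mem_Ioo (abs_lt.mp h0)).ne'
      (partialDeriv_two_warpCoord_comp hχ hb α k hne) (gradient_warpCoord_le hχ hb hα k hgrad hne)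

end LocalForm

/-! ### Functions vanishing to a given order, in the Lipschitz sense -/

section

open Asymptotics

/-- Pairs of small vectors together with a time in `[0, 1]`. -/
def pairFilter (E : Type*) [NormedAddCommGroup E] : Filter ((E × E) × ℝ) := 𝓝 0 ×ˢ 𝓟 (Icc 0 1)

/-- `f v s` vanishes at `v = 0` to order `m + 1` in the Lipschitz sense:
`|f v s - f v' s| ≤ C (‖v‖ + ‖v'‖)^m ‖v - v'‖` for small `v, v'`, uniformly in `s ∈ [0, 1]`. -/
structure VanishOrd {E : Type*} [NormedAddCommGroup E] (m : ℕ) (f : E → ℝ → ℝ) : Prop where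
  zero : ∀ s ∈ Icc (0 : ℝ) 1, f 0 s = 0
  isBigO : (fun q : (E × E) × ℝ => f q.1.1 q.2 - f q.1.2 q.2)
    =O[pairFilter E] fun q => (‖q.1.1‖ + ‖q.1.2‖) ^ m * ‖q.1.1 - q.1.2‖

variable {E : Type*} [NormedAddCommGroup E]

theorem eventually_pairFilter_mem : ∀ᶠ q in pairFilter E, q.2 ∈ Icc (0 : ℝ) 1 :=
  tendsto_snd.eventually (eventually_mem_set.mpr (mem_principal_self _))

theorem tendsto_pairFilter_left : Tendsto (fun q : (E × E) × ℝ => q.1.1) (pairFilter E) (𝓝 0) :=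
  (continuous_fst.tendsto (0 : E × E)).comp tendsto_fst

theorem tendsto_pairFilter_right : Tendsto (fun q : (E × E) × ℝ => q.1.2) (pairFilter E) (𝓝 0) :=
  (continuous_snd.tendsto (0 : E × E)).comp tendsto_fst

theorem tendsto_pairFilter_norm_add :
    Tendsto (fun q : (E × E) × ℝ => ‖q.1.1‖ + ‖q.1.2‖) (pairFilter E) (𝓝 0) := by
  simpa using (tendsto_pairFilter_left (E := E)).norm.add tendsto_pairFilter_right.norm

namespace VanishOrd

variable {m n : ℕ} {f g : E → ℝ → ℝ}

theorem mono (hf : VanishOrd n f) (h : m ≤ n) : VanishOrd m f where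
  zero := hf.zero
  isBigO := by
    refine hf.isBigO.trans (IsBigO.mul (IsBigO.of_bound 1 ?_) (isBigO_refl _ _))
    filter_upwards [tendsto_pairFilter_norm_add.eventually (gt_mem_nhds one_pos)] with q hq
    rw [Real.norm_of_nonneg (by positivity), Real.norm_of_nonneg (by positivity), one_mul]
    exact pow_le_pow_of_le_one (by positivity) hq.le h

theorem congr (hf : VanishOrd m f) (h : ∀ v s, f v s = g v s) : VanishOrd m g :=
  (funext₂ h : f = g) ▸ hf

theorem add (hf : VanishOrd m f) (hg : VanishOrd m g) : VanishOrd m fun v s => f v s + g v s where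
  zero s hs := by rw [hf.zero s hs, hg.zero s hs, add_zero]
  isBigO := (hf.isBigO.add hg.isBigO).congr_left fun q => by ring

theorem const_mul (a : ℝ) (hf : VanishOrd m f) : VanishOrd m fun v s => a * f v s where
  zero s hs := by rw [hf.zero s hs, mul_zero]
  isBigO := (hf.isBigO.const_mul_left a).congr_left fun q => by ring

theorem neg (hf : VanishOrd m f) : VanishOrd m fun v s => - f v s :=
  (hf.const_mul (-1)).congr fun v s => by ring

theorem sub (hf : VanishOrd m f) (hg : VanishOrd m g) : VanishOrd m fun v s => f v s - g v s :=
  (hf.add hg.neg).congr fun v s => by ring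

theorem isBigO_left (hf : VanishOrd m f) :
    (fun q : (E × E) × ℝ => f q.1.1 q.2)
      =O[pairFilter E] fun q => (‖q.1.1‖ + ‖q.1.2‖) ^ (m + 1) := by
  have tendsto_left_zero : Tendsto (fun q : (E × E) × ℝ => (((q.1.1, 0), q.2) : (E × E) × ℝ))
      (pairFilter E) (pairFilter E) :=
    (tendsto_pairFilter_left.prodMk_nhds tendsto_const_nhds).prodMk tendsto_snd
  refine ((hf.isBigO.comp_tendsto tendsto_left_zero).congr' ?_ (EventuallyEq.refl _ _)).trans ?_
  · filter_upwards [eventually_pairFilter_mem] with q hq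
    simp [hf.zero _ hq]
  · refine IsBigO.of_bound 1 (Eventually.of_forall fun q => ?_)
    simp only [Function.comp_apply, norm_zero, add_zero, sub_zero]
    rw [← pow_succ, Real.norm_of_nonneg (by positivity), Real.norm_of_nonneg (by positivity),
      one_mul]
    gcongr
    exact le_add_of_nonneg_right (norm_nonneg _)

theorem isBigO_right (hf : VanishOrd m f) :
    (fun q : (E × E) × ℝ => f q.1.2 q.2)
      =O[pairFilter E] fun q => (‖q.1.1‖ + ‖q.1.2‖) ^ (m + 1) := by
  have tendsto_swap : Tendsto (fun q : (E × E) × ℝ => (((q.1.2, q.1.1), q.2) : (E × E) × ℝ))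
      (pairFilter E) (pairFilter E) :=
    (tendsto_pairFilter_right.prodMk_nhds tendsto_pairFilter_left).prodMk tendsto_snd
  exact (hf.isBigO_left.comp_tendsto tendsto_swap).congr_right fun q => by
    simp only [Function.comp_apply, add_comm]

theorem tendsto (hf : VanishOrd m f) :
    Tendsto (fun q : (E × E) × ℝ => (f q.1.1 q.2, f q.1.2 q.2)) (pairFilter E) (𝓝 0) := by
  have hpow := (tendsto_pairFilter_norm_add (E := E)).pow (m + 1)
  rw [zero_pow m.succ_ne_zero] at hpow
  exact (hf.isBigO_left.trans_tendsto hpow).prodMk_nhds (hf.isBigO_right.trans_tendsto hpow)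

theorem eventually_abs_lt (hf : VanishOrd m f) {ε : ℝ} (hε : 0 < ε) :
    ∀ᶠ v in 𝓝 0, ∀ s ∈ Icc (0 : ℝ) 1, |f v s| < ε := by
  have habs : ∀ᶠ q in pairFilter E, |f q.1.1 q.2| < ε :=
    ((continuous_fst.abs.tendsto (0 : ℝ × ℝ)).comp hf.tendsto).eventually
      (gt_mem_nhds (by simpa using hε))
  have hdiag : Tendsto (fun v : E => (v, v)) (𝓝 0) (𝓝 0) :=
    (continuous_id.prodMk continuous_id).tendsto' _ _ rfl
  exact hdiag.eventually (eventually_prod_principal_iff.mp habs)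

theorem mul (hf : VanishOrd m f) (hg : VanishOrd n g) :
    VanishOrd (m + n + 1) fun v s => f v s * g v s where
  zero s hs := by rw [hf.zero s hs, zero_mul]
  isBigO := by
    have hleft := (hf.isBigO_left.mul hg.isBigO).congr_right
      (g₂ := fun q : (E × E) × ℝ => (‖q.1.1‖ + ‖q.1.2‖) ^ (m + n + 1) * ‖q.1.1 - q.1.2‖)
      fun q => by ring
    have hright := (hf.isBigO.mul hg.isBigO_right).congr_right
      (g₂ := fun q : (E × E) × ℝ => (‖q.1.1‖ + ‖q.1.2‖) ^ (m + n + 1) * ‖q.1.1 - q.1.2‖)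
      fun q => by ring
    exact (hleft.add hright).congr_left fun q => by ring

theorem mul_le {l : ℕ} (hf : VanishOrd m f) (hg : VanishOrd n g) (h : l ≤ m + n + 1) :
    VanishOrd l fun v s => f v s * g v s :=
  (hf.mul hg).mono h

theorem coord {ι : Type*} [Fintype ι] (i : ι) : VanishOrd 0 fun (v : ι → ℝ) _ => v i where
  zero _ _ := rfl
  isBigO := by
    refine IsBigO.of_bound 1 (Eventually.of_forall fun q => ?_)
    rw [pow_zero, one_mul, one_mul, norm_norm, ← Pi.sub_apply]
    exact norm_le_pi_norm _ i

theorem time_mul (hf : VanishOrd m f) : VanishOrd m fun v s => s * f v s where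
  zero s hs := by rw [hf.zero s hs, mul_zero]
  isBigO := by
    refine IsBigO.trans (IsBigO.of_bound 1 ?_) hf.isBigO
    filter_upwards [eventually_pairFilter_mem] with q hq
    rw [← mul_sub, norm_mul, Real.norm_of_nonneg hq.1]
    gcongr
    exact hq.2

theorem eval_one (hf : VanishOrd m f) : VanishOrd m fun v _ => f v 1 where
  zero _ _ := hf.zero 1 (right_mem_Icc.mpr zero_le_one)
  isBigO := by
    have tendsto_at_one : Tendsto (fun q : (E × E) × ℝ => ((q.1, 1) : (E × E) × ℝ))
        (pairFilter E) (pairFilter E) :=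
      tendsto_fst.prodMk (tendsto_principal.mpr
        (Eventually.of_forall fun _ => right_mem_Icc.mpr zero_le_one))
    exact hf.isBigO.comp_tendsto tendsto_at_one

theorem comp {h : ℝ → ℝ} {j : ℕ} (h0 : h 0 = 0)
    (hh : (fun p : ℝ × ℝ => h p.1 - h p.2) =O[𝓝 0] fun p => (|p.1| + |p.2|) ^ j * |p.1 - p.2|)
    (hf : VanishOrd m f) : VanishOrd ((m + 1) * j + m) fun v s => h (f v s) where
  zero s hs := by rw [hf.zero s hs, h0]
  isBigO := by
    have hpow := (hf.isBigO_left.norm_left.add hf.isBigO_right.norm_left).pow j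
    refine (hh.comp_tendsto hf.tendsto).trans ?_
    exact (hpow.mul hf.isBigO.norm_left).congr_right fun q => by
      rw [← pow_mul, pow_add, mul_assoc]

theorem of_hasDerivWithinAt (hg : VanishOrd m g) (h0 : ∀ᶠ v in 𝓝 0, f v 0 = 0)
    (hz : ∀ s ∈ Icc (0 : ℝ) 1, f 0 s = 0)
    (hd : ∀ᶠ v in 𝓝 0, ∀ s ∈ Icc (0 : ℝ) 1, HasDerivWithinAt (f v) (g v s) (Icc 0 1) s) :
    VanishOrd m f where
  zero := hz
  isBigO := by
    obtain ⟨C, hC⟩ := hg.isBigO.bound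
    refine IsBigO.of_bound C (eventually_prod_principal_iff.mpr ?_)
    filter_upwards [eventually_prod_principal_iff.mp hC,
      (continuous_fst.tendsto (0 : E × E)).eventually (hd.and h0),
      (continuous_snd.tendsto (0 : E × E)).eventually (hd.and h0)]
      with q hbound hfst hsnd s hs
    set B := C * ‖(‖q.1‖ + ‖q.2‖) ^ m * ‖q.1 - q.2‖‖
    have hderiv : ∀ s ∈ Icc (0 : ℝ) 1, HasDerivWithinAt (fun s => f q.1 s - f q.2 s)
        (g q.1 s - g q.2 s) (Icc 0 1) s := fun s hs => (hfst.1 s hs).fun_sub (hsnd.1 s hs)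
    have hB : 0 ≤ B := (norm_nonneg _).trans (hbound 0 (left_mem_Icc.mpr zero_le_one))
    have hmvt := (convex_Icc (0 : ℝ) 1).norm_image_sub_le_of_norm_hasDerivWithin_le hderiv
      hbound (left_mem_Icc.mpr zero_le_one) hs
    rw [hfst.2, hsnd.2, sub_zero, sub_zero, sub_zero, Real.norm_of_nonneg hs.1] at hmvt
    exact hmvt.trans (mul_le_of_le_one_right hB hs.2)

theorem mul_mul_sub_mul_mul {f₁ f₂ f₃ g₁ g₂ g₃ : E → ℝ → ℝ} (hf₂ : VanishOrd 0 f₂)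
    (hf₃ : VanishOrd 0 f₃) (hg₁ : VanishOrd 0 g₁) (hg₂ : VanishOrd 0 g₂)
    (h₁ : VanishOrd m fun v s => f₁ v s - g₁ v s) (h₂ : VanishOrd m fun v s => f₂ v s - g₂ v s)
    (h₃ : VanishOrd m fun v s => f₃ v s - g₃ v s) :
    VanishOrd (m + 2) fun v s => f₁ v s * f₂ v s * f₃ v s - g₁ v s * g₂ v s * g₃ v s :=
  ((((h₁.mul hf₂).mul hf₃).add ((h₂.mul hg₁).mul hf₃)).add ((h₃.mul hg₁).mul hg₂)).congr
    fun v s => by ring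

end VanishOrd

theorem isBigO_sub_of_deriv {h h' : ℝ → ℝ} {j : ℕ} (hd : ∀ᶠ x in 𝓝 0, HasDerivAt h (h' x) x)
    (hO : h' =O[𝓝 0] fun x => |x| ^ j) :
    (fun p : ℝ × ℝ => h p.1 - h p.2) =O[𝓝 0] fun p => (|p.1| + |p.2|) ^ j * |p.1 - p.2| := by
  obtain ⟨C, hC, hbound⟩ := hO.exists_nonneg
  obtain ⟨ε, hε, hball⟩ := Metric.eventually_nhds_iff.mp (hd.and hbound.bound)
  simp only [dist_zero_right, Real.norm_eq_abs] at hball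
  refine IsBigO.of_bound C ?_
  filter_upwards [(continuous_fst.abs.tendsto (0 : ℝ × ℝ)).eventually
    (gt_mem_nhds (by simpa using hε)), (continuous_snd.abs.tendsto (0 : ℝ × ℝ)).eventually
    (gt_mem_nhds (by simpa using hε))] with p hfst hsnd
  have abs_le_max : ∀ x ∈ uIcc p.2 p.1, |x| ≤ max |p.1| |p.2| := fun x hx => by
    rcases mem_uIcc.mp hx with hx | hx
    · rw [max_comm]; exact abs_le_max_abs_abs hx.1 hx.2
    · exact abs_le_max_abs_abs hx.1 hx.2
  rw [Real.norm_of_nonneg (by positivity : 0 ≤ (|p.1| + |p.2|) ^ j * |p.1 - p.2|), ← mul_assoc]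
  refine (convex_uIcc p.2 p.1).norm_image_sub_le_of_norm_hasDerivWithin_le (fun x hx =>
    (hball ((abs_le_max x hx).trans_lt (max_lt hfst hsnd))).1.hasDerivWithinAt) (fun x hx => ?_)
    left_mem_uIcc right_mem_uIcc
  refine (hball ((abs_le_max x hx).trans_lt (max_lt hfst hsnd))).2.trans ?_
  rw [abs_of_nonneg (by positivity)]
  gcongr
  exact (abs_le_max x hx).trans (max_le_add_of_nonneg (abs_nonneg _) (abs_nonneg _))

theorem isBigO_sub_of_contDiffAt {h : ℝ → ℝ} (hc : ContDiffAt ℝ 1 h 0) :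
    (fun p : ℝ × ℝ => h p.1 - h p.2) =O[𝓝 0] fun p => (|p.1| + |p.2|) ^ 0 * |p.1 - p.2| := by
  refine isBigO_sub_of_deriv (h' := deriv h) ?_ ?_
  · filter_upwards [hc.eventually (by simp)] with x hx using
      (hx.differentiableAt one_ne_zero).hasDerivAt
  · have hcont : ContinuousAt (deriv h) 0 :=
      (hc.fderiv_right (m := 0) (by norm_num)).continuousAt.clm_apply continuousAt_const
    simpa using hcont.isBigO_one ℝ

theorem isBigO_sub_of_deriv_eq_zero {h : ℝ → ℝ} (hc : ContDiffAt ℝ 2 h 0) (h0 : deriv h 0 = 0) :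
    (fun p : ℝ × ℝ => h p.1 - h p.2) =O[𝓝 0] fun p => (|p.1| + |p.2|) ^ 1 * |p.1 - p.2| := by
  refine isBigO_sub_of_deriv (h' := deriv h) ?_ ?_
  · filter_upwards [hc.eventually (by simp)] with x hx using
      (hx.differentiableAt two_ne_zero).hasDerivAt
  · have hdiff : DifferentiableAt ℝ (deriv h) 0 :=
      ((hc.fderiv_right (m := 1) (by norm_num)).differentiableAt one_ne_zero).clm_apply
        (differentiableAt_const _)
    simpa [h0] using hdiff.isBigO_sub.norm_right

end

/-! ### Geodesics of the model metric with warping function `1 + κ r θ` -/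

/-- The acceleration of a geodesic of the metric with warping function `f`, in terms of the
logarithmic derivatives `p, q` of `f`. -/
noncomputable def warpAccel (f p q : ℝ) (r : ℝ) (w : Fin 3 → ℝ) : Fin 3 → ℝ :=
  ![p * w 0 ^ 2 + 2 * q * w 0 * w 1 - (p * Real.cos r ^ 2 + Real.cos r * Real.sin r) * w 1 ^ 2
      + f ^ 4 * p * w 2 ^ 2,
    -(q / Real.cos r ^ 2) * w 0 ^ 2 + 2 * (p + Real.sin r / Real.cos r) * w 0 * w 1 + q * w 1 ^ 2
      + f ^ 4 * q / Real.cos r ^ 2 * w 2 ^ 2,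
    -2 * (p * w 0 + q * w 1) * w 2]

theorem neg_sum_warpChristoffel (f p q r : ℝ) (w : Fin 3 → ℝ) :
    (fun m => - ∑ i, ∑ j, warpChristoffel m i j f p q r * w i * w j) = warpAccel f p q r w := by
  funext m
  fin_cases m <;> simp [warpChristoffel, warpAccel, Fin.sum_univ_three] <;> ring

/-- The acceleration of a geodesic for the warping function `1 + κ r θ`. -/
noncomputable def modelAccel (κ : ℝ) (c w : Fin 3 → ℝ) : Fin 3 → ℝ :=
  warpAccel (1 + κ * (c 0 * c 1)) (κ * c 1 / (1 + κ * (c 0 * c 1)))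
    (κ * c 0 / (1 + κ * (c 0 * c 1))) (c 0) w

/-- The geodesic field of the model metric on the tangent bundle `ℝ³ × ℝ³`. -/
noncomputable def modelField (κ : ℝ) (y : (Fin 3 → ℝ) × (Fin 3 → ℝ)) :
    (Fin 3 → ℝ) × (Fin 3 → ℝ) :=
  (y.2, modelAccel κ y.1 y.2)

theorem contDiffAt_modelField {κ : ℝ} {y : (Fin 3 → ℝ) × (Fin 3 → ℝ)}
    (hf : 1 + κ * (y.1 0 * y.1 1) ≠ 0) (hc : Real.cos (y.1 0) ≠ 0) :
    ContDiffAt ℝ 1 (modelField κ) y := by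
  have hc2 : Real.cos (y.1 0) ^ 2 ≠ 0 := pow_ne_zero 2 hc
  refine contDiffAt_snd.prodMk (contDiffAt_pi.mpr fun i => ?_)
  fin_cases i <;>
    simp only [modelAccel, warpAccel, Matrix.cons_val, Fin.zero_eta, Fin.mk_one,
      Fin.reduceFinMk] <;>
    fun_prop (disch := assumption)

theorem modelAccel_smul (κ a : ℝ) (c w : Fin 3 → ℝ) :
    modelAccel κ c (a • w) = a ^ 2 • modelAccel κ c w := by
  ext i
  fin_cases i <;> simp [modelAccel, warpAccel] <;> ring

theorem modelAccel_eq_zero {κ : ℝ} {c w : Fin 3 → ℝ} (hc : c 0 = 0) (hc' : c 1 = 0) (hw : w 0 = 0)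
    (hw' : w 1 = 0) : modelAccel κ c w = 0 := by
  ext i
  fin_cases i <;> simp [modelAccel, warpAccel, hc, hc', hw, hw']

section

variable {E : Type*} [NormedAddCommGroup E] [NormedSpace ℝ E] {F : E → E} {β γ : ℝ → E}

theorem eventuallyEq_nhdsGE_of_solution {s : ℝ} (hF : ContDiffAt ℝ 1 F (β s)) (h : β s = γ s)
    (hβ : ∀ᶠ u in 𝓝[≥] s, HasDerivWithinAt β (F (β u)) (Ici s) u)
    (hγ : ∀ᶠ u in 𝓝[≥] s, HasDerivWithinAt γ (F (γ u)) (Ici s) u) : β =ᶠ[𝓝[≥] s] γ := by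
  obtain ⟨K, U, hU, hLip⟩ := hF.exists_lipschitzOnWith
  have hβU : ∀ᶠ u in 𝓝[≥] s, β u ∈ U :=
    (hβ.self_of_nhdsWithin self_mem_Ici).continuousWithinAt hU
  have hγU : ∀ᶠ u in 𝓝[≥] s, γ u ∈ U :=
    (hγ.self_of_nhdsWithin self_mem_Ici).continuousWithinAt (h ▸ hU)
  obtain ⟨d, hd, hsub⟩ := mem_nhdsGE_iff_exists_Icc_subset.mp
    ((hβ.and hβU).and (hγ.and hγU))
  refine mem_of_superset (Icc_mem_nhdsGE hd) ?_
  exact ODE_solution_unique_of_mem_Icc_right (v := fun _ => F) (s := fun _ => U)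
    (fun _ _ => hLip)
    (fun u hu => (hsub hu).1.1.continuousWithinAt.mono Icc_subset_Ici_self)
    (fun u hu => (hsub (Ico_subset_Icc_self hu)).1.1.mono (Ici_subset_Ici.mpr hu.1))
    (fun u hu => (hsub (Ico_subset_Icc_self hu)).1.2)
    (fun u hu => (hsub hu).2.1.continuousWithinAt.mono Icc_subset_Ici_self)
    (fun u hu => (hsub (Ico_subset_Icc_self hu)).2.1.mono (Ici_subset_Ici.mpr hu.1))
    (fun u hu => (hsub (Ico_subset_Icc_self hu)).2.2) h

theorem eqOn_of_locally_solution {a b : ℝ}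
    (hβ : ∀ s ∈ Icc a b, HasDerivWithinAt β (F (β s)) (Icc a b) s)
    (hF : ∀ s ∈ Icc a b, ContDiffAt ℝ 1 F (β s)) (ha : β a = γ a)
    (hγc : ContinuousOn γ (Icc a b))
    (hγ : ∀ s ∈ Ico a b, β s = γ s →
      ∀ᶠ u in 𝓝[≥] s, HasDerivWithinAt γ (F (γ u)) (Icc a b) u) :
    EqOn β γ (Icc a b) := by
  have hβc : ContinuousOn β (Icc a b) := fun s hs => (hβ s hs).continuousWithinAt
  have hclosed : IsClosed ({s | β s = γ s} ∩ Icc a b) := by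
    rw [inter_comm]
    exact (hβc.prodMk hγc).preimage_isClosed_of_isClosed isClosed_Icc isClosed_diagonal
  refine hclosed.Icc_subset_of_forall_mem_nhdsWithin ha fun s ⟨hs, hsab⟩ => ?_
  have hlt : ∀ᶠ u in 𝓝[≥] s, u ∈ Ico s b := Ico_mem_nhdsGE hsab.2
  have hIcc : ∀ u ∈ Ico s b, Icc a b ∈ 𝓝[Ici s] u := fun u hu => by
    filter_upwards [self_mem_nhdsWithin, nhdsWithin_le_nhds (Iio_mem_nhds hu.2)] with x hsx hxb
    exact ⟨hsab.1.trans hsx, hxb.le⟩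
  have heq : β =ᶠ[𝓝[≥] s] γ := by
    refine eventuallyEq_nhdsGE_of_solution (hF s (Ico_subset_Icc_self hsab)) hs ?_ ?_
    · filter_upwards [hlt] with u hu
      exact (hβ u ⟨hsab.1.trans hu.1, hu.2.le⟩).mono_of_mem_nhdsWithin (hIcc u hu)
    · filter_upwards [hlt, hγ s hsab hs] with u hu hγu
      exact hγu.mono_of_mem_nhdsWithin (hIcc u hu)
  exact nhdsWithin_mono s Ioi_subset_Ici_self heq

theorem eqOn_line_of_accel_eq_zero {A : E → E → E} {v : E} {c w : ℝ → E}
    (hsmooth : ∀ s ∈ Icc (0 : ℝ) 1, ContDiffAt ℝ 1 (fun y : E × E => (y.2, A y.1 y.2)) (s • v, v))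
    (hA : ∀ s ∈ Icc (0 : ℝ) 1, A (s • v) v = 0) (hc : c 0 = 0) (hw : w 0 = v)
    (hderiv : ∀ s ∈ Icc (0 : ℝ) 1, HasDerivWithinAt c (w s) (Icc 0 1) s ∧
      HasDerivWithinAt w (A (c s) (w s)) (Icc 0 1) s) :
    ∀ s ∈ Icc (0 : ℝ) 1, c s = s • v ∧ w s = v := by
  have heq : EqOn (fun s => (s • v, v)) (fun s => (c s, w s)) (Icc 0 1) := by
    refine eqOn_of_locally_solution (F := fun y : E × E => (y.2, A y.1 y.2)) (fun s hs => ?_)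
      hsmooth (by simp [hc, hw]) (fun s hs => ?_) (fun s hs _ => ?_)
    · simpa [hA s hs] using ((hasDerivWithinAt_id s (Icc (0 : ℝ) 1)).smul_const v).prodMk
        (hasDerivWithinAt_const s _ v)
    · exact (hderiv s hs).1.continuousWithinAt.prodMk (hderiv s hs).2.continuousWithinAt
    · filter_upwards [Ico_mem_nhdsGE hs.2] with u hu
      have hu' : u ∈ Icc (0 : ℝ) 1 := ⟨hs.1.trans hu.1, hu.2.le⟩
      exact (hderiv u hu').1.prodMk (hderiv u hu').2
  intro s hs
  obtain ⟨hpos, hvel⟩ := Prod.mk.inj (heq hs)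
  exact ⟨hpos.symm, hvel.symm⟩

theorem exists_lipschitz_flow_of_homogeneous_accel [CompleteSpace E] {A : E → E → E}
    (hA : ∀ (a : ℝ) c w, A c (a • w) = a ^ 2 • A c w)
    (hsmooth : ContDiffAt ℝ 1 (fun y : E × E => (y.2, A y.1 y.2)) 0) :
    ∃ c w : E → ℝ → E, ∃ L : ℝ, (∀ᶠ v in 𝓝 0, (c v 0 = 0 ∧ w v 0 = v) ∧
      ∀ s ∈ Icc (0 : ℝ) 1, HasDerivWithinAt (c v) (w v s) (Icc 0 1) s ∧
        HasDerivWithinAt (w v) (A (c v s) (w v s)) (Icc 0 1) s) ∧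
      ∀ᶠ q in pairFilter E, ‖c q.1.1 q.2 - c q.1.2 q.2‖ ≤ L * ‖q.1.1 - q.1.2‖ ∧
        ‖w q.1.1 q.2 - w q.1.2 q.2‖ ≤ L * ‖q.1.1 - q.1.2‖ := by
  obtain ⟨ε, hε, a, r, M, K, hr, hpl⟩ := IsPicardLindelof.of_contDiffAt_one hsmooth
  obtain ⟨φ, hφ, L, hL⟩ :=
    (hpl 0).exists_forall_mem_closedBall_eq_hasDerivWithinAt_lipschitzOnWith
  simp only [zero_sub, zero_add] at hφ hL
  have hball : ∀ᶠ v in 𝓝 (0 : E), ((0, ε⁻¹ • v) : E × E) ∈ Metric.closedBall 0 (r : ℝ) := by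
    have hcont : Continuous fun v : E => ((0, ε⁻¹ • v) : E × E) := by fun_prop
    exact hcont.continuousAt (Metric.closedBall_mem_nhds_of_mem (by simpa using hr))
  have htime : MapsTo (fun s : ℝ => ε * s) (Icc 0 1) (Icc (-ε) ε) := fun s hs =>
    ⟨by nlinarith [hs.1], by nlinarith [hs.2]⟩
  -- the local flow exists for a time `ε`; by homogeneity, start it at velocity `v / ε` instead
  refine ⟨fun v s => (φ (0, ε⁻¹ • v) (ε * s)).1, fun v s => ε • (φ (0, ε⁻¹ • v) (ε * s)).2,
    max (L * ε⁻¹) L, ?_, ?_⟩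
  · filter_upwards [hball] with v hv
    refine ⟨by simp [(hφ _ hv).1, smul_smul, hε.ne'], fun s hs => ?_⟩
    have hflow := ((hφ _ hv).2 _ (htime hs)).scomp s
      ((hasDerivWithinAt_id s (Icc (0 : ℝ) 1)).const_mul ε) htime
    rw [mul_one] at hflow
    refine ⟨hflow.fst, ?_⟩
    rw [hA, sq, mul_smul]
    exact HasDerivWithinAt.const_smul ε hflow.snd
  · filter_upwards [tendsto_pairFilter_left.eventually hball,
      tendsto_pairFilter_right.eventually hball, eventually_pairFilter_mem] with q hv hv' hs
    have hstart : ‖((0, ε⁻¹ • q.1.1) - (0, ε⁻¹ • q.1.2) : E × E)‖ = ε⁻¹ * ‖q.1.1 - q.1.2‖ := by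
      rw [Prod.mk_sub_mk, sub_zero, ← smul_sub, Prod.norm_mk, norm_zero, norm_smul,
        Real.norm_of_nonneg (inv_nonneg.mpr hε.le), max_eq_right (by positivity)]
    have hlip := (hL _ (htime hs)).norm_sub_le hv hv'
    rw [hstart, ← mul_assoc] at hlip
    constructor
    · exact ((norm_fst_le _).trans hlip).trans (by gcongr; exact le_max_left _ _)
    · rw [← smul_sub, norm_smul, Real.norm_of_nonneg hε.le]
      calc ε * _ ≤ ε * (L * ε⁻¹ * ‖q.1.1 - q.1.2‖) := by gcongr; exact (norm_snd_le _).trans hlip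
        _ = L * ‖q.1.1 - q.1.2‖ := by field_simp
        _ ≤ _ := by gcongr; exact le_max_right _ _

end

theorem VanishOrd.coord_of_lipschitz {E ι : Type*} [NormedAddCommGroup E] [Fintype ι]
    {f : E → ℝ → ι → ℝ} {L : ℝ} (h0 : ∀ s ∈ Icc (0 : ℝ) 1, f 0 s = 0)
    (hf : ∀ᶠ q in pairFilter E, ‖f q.1.1 q.2 - f q.1.2 q.2‖ ≤ L * ‖q.1.1 - q.1.2‖) (i : ι) :
    VanishOrd 0 fun v s => f v s i where
  zero s hs := congrFun (h0 s hs) i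
  isBigO := by
    refine Asymptotics.IsBigO.of_bound L (hf.mono fun q hq => ?_)
    rw [pow_zero, one_mul, norm_norm, ← Pi.sub_apply]
    exact (norm_le_pi_norm _ i).trans hq

/-- The geodesics `c v` of the model metric from the origin with small initial velocity `v`, and
their velocities `w v`. -/
structure IsModelFlow (κ : ℝ) (c w : (Fin 3 → ℝ) → ℝ → Fin 3 → ℝ) : Prop where
  start : ∀ᶠ v in 𝓝 0, c v 0 = 0 ∧ w v 0 = v
  hasDeriv : ∀ᶠ v in 𝓝 0, ∀ s ∈ Icc (0 : ℝ) 1, HasDerivWithinAt (c v) (w v s) (Icc 0 1) s ∧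
    HasDerivWithinAt (w v) (modelAccel κ (c v s) (w v s)) (Icc 0 1) s
  axis : ∀ᶠ v in 𝓝 (0 : Fin 3 → ℝ), v 0 = 0 → v 1 = 0 →
    ∀ s ∈ Icc (0 : ℝ) 1, c v s = s • v ∧ w v s = v
  pos_ord : ∀ i, VanishOrd 0 fun v s => c v s i
  vel_ord : ∀ i, VanishOrd 0 fun v s => w v s i

theorem exists_isModelFlow (κ : ℝ) : ∃ c w, IsModelFlow κ c w := by
  obtain ⟨c, w, L, hflow, hlip⟩ := exists_lipschitz_flow_of_homogeneous_accel (modelAccel_smul κ)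
    (contDiffAt_modelField (by simp) (by simp))
  have haxis : ∀ᶠ v in 𝓝 (0 : Fin 3 → ℝ), v 0 = 0 → v 1 = 0 →
      ∀ s ∈ Icc (0 : ℝ) 1, c v s = s • v ∧ w v s = v := by
    filter_upwards [hflow] with v hv hv0 hv1
    refine eqOn_line_of_accel_eq_zero (A := modelAccel κ) (fun s _ => ?_) (fun s _ => ?_)
      hv.1.1 hv.1.2 hv.2
    · exact contDiffAt_modelField (by simp [hv0]) (by simp [hv0])
    · exact modelAccel_eq_zero (by simp [hv0]) (by simp [hv1]) hv0 hv1
  have hzero : ∀ s ∈ Icc (0 : ℝ) 1, c 0 s = 0 ∧ w 0 s = 0 := fun s hs => by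
    simpa using haxis.self_of_nhds rfl rfl s hs
  exact ⟨c, w, hflow.mono fun _ h => h.1, hflow.mono fun _ h => h.2, haxis,
    VanishOrd.coord_of_lipschitz (fun s hs => (hzero s hs).1) (hlip.mono fun _ h => h.1),
    VanishOrd.coord_of_lipschitz (fun s hs => (hzero s hs).2) (hlip.mono fun _ h => h.2)⟩

/-! ### Third-order expansion of the exponential map -/

/-- The leading part of `modelAccel` at the origin. -/
noncomputable def cubicForm (κ : ℝ) (c w : Fin 3 → ℝ) : Fin 3 → ℝ :=
  ![κ * c 1 * w 0 ^ 2 + 2 * κ * c 0 * w 0 * w 1 - (κ * c 1 + c 0) * w 1 ^ 2 + κ * c 1 * w 2 ^ 2,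
    -κ * c 0 * w 0 ^ 2 + 2 * (κ * c 1 + c 0) * w 0 * w 1 + κ * c 0 * w 1 ^ 2 + κ * c 0 * w 2 ^ 2,
    -2 * κ * (c 1 * w 0 + c 0 * w 1) * w 2]

theorem cubicForm_zero_left (κ : ℝ) (w : Fin 3 → ℝ) : cubicForm κ 0 w = 0 := by
  ext i
  fin_cases i <;> simp [cubicForm]

theorem cubicForm_smul_left (κ a : ℝ) (c w : Fin 3 → ℝ) :
    cubicForm κ (a • c) w = a • cubicForm κ c w := by
  ext i
  fin_cases i <;> simp [cubicForm] <;> ring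

namespace VanishOrd

variable {E : Type*} [NormedAddCommGroup E] {m : ℕ} {f g : E → ℝ → ℝ}

theorem one_add_mul_one_add_sub_one (hf : VanishOrd m f) (hg : VanishOrd m g) :
    VanishOrd m fun v s => (1 + f v s) * (1 + g v s) - 1 :=
  ((hf.add hg).add (hf.mul_le hg (by lia))).congr fun v s => by ring

theorem inv_one_add_sub_one (hf : VanishOrd m f) : VanishOrd m fun v s => (1 + f v s)⁻¹ - 1 := by
  refine (comp (h := fun x => (1 + x)⁻¹ - 1) (j := 0) (by simp) ?_ hf).mono (by lia)
  exact isBigO_sub_of_contDiffAt (((contDiffAt_const.add contDiffAt_id).inv (by simp)).sub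
    contDiffAt_const)

theorem comp_of_hasDerivAt_zero {h : ℝ → ℝ} (h0 : h 0 = 0) (hc : ContDiffAt ℝ 2 h 0)
    (hd : HasDerivAt h 0 0) (hf : VanishOrd 0 f) : VanishOrd 1 fun v s => h (f v s) :=
  (comp h0 (isBigO_sub_of_deriv_eq_zero hc hd.deriv) hf).mono (by lia)

theorem cos_sq_sub_one (hf : VanishOrd 0 f) :
    VanishOrd 1 fun v s => Real.cos (f v s) ^ 2 - 1 := by
  refine comp_of_hasDerivAt_zero (h := fun x => Real.cos x ^ 2 - 1) (by simp) ?_ ?_ hf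
  · exact ((Real.contDiff_cos.pow 2).sub contDiff_const).contDiffAt
  · simpa using ((Real.hasDerivAt_cos 0).pow 2).sub_const 1

theorem cos_mul_sin_sub (hf : VanishOrd 0 f) :
    VanishOrd 1 fun v s => Real.cos (f v s) * Real.sin (f v s) - f v s := by
  refine comp_of_hasDerivAt_zero (h := fun x => Real.cos x * Real.sin x - x) (by simp) ?_ ?_ hf
  · exact ((Real.contDiff_cos.mul Real.contDiff_sin).sub contDiff_id).contDiffAt
  · simpa using ((Real.hasDerivAt_cos 0).fun_mul (Real.hasDerivAt_sin 0)).fun_sub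
      (hasDerivAt_id' 0)

theorem sin_div_cos_sub (hf : VanishOrd 0 f) :
    VanishOrd 1 fun v s => Real.sin (f v s) / Real.cos (f v s) - f v s := by
  refine comp_of_hasDerivAt_zero (h := fun x => Real.sin x / Real.cos x - x) (by simp) ?_ ?_ hf
  · exact (Real.contDiff_sin.contDiffAt.div Real.contDiff_cos.contDiffAt (by simp)).sub
      contDiffAt_id
  · simpa using ((Real.hasDerivAt_sin 0).fun_div (Real.hasDerivAt_cos 0) (by simp)).fun_sub
      (hasDerivAt_id' 0)

theorem inv_cos_sq_sub_one (hf : VanishOrd 0 f) :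
    VanishOrd 1 fun v s => (Real.cos (f v s) ^ 2)⁻¹ - 1 :=
  hf.cos_sq_sub_one.inv_one_add_sub_one.congr fun v s => by ring_nf

variable {κ : ℝ} {c w c' w' : E → ℝ → Fin 3 → ℝ}

theorem cubicForm_sub (h : ∀ i j k, VanishOrd m fun v s =>
      c v s i * w v s j * w v s k - c' v s i * w' v s j * w' v s k) (i : Fin 3) :
    VanishOrd m fun v s => cubicForm κ (c v s) (w v s) i - cubicForm κ (c' v s) (w' v s) i := by
  fin_cases i
  · exact (((((h 1 0 0).const_mul κ).add ((h 0 0 1).const_mul (2 * κ))).sub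
      (((h 1 1 1).const_mul κ).add (h 0 1 1))).add ((h 1 2 2).const_mul κ)).congr fun v s => by
        simp [cubicForm]; ring
  · exact (((((h 0 0 0).const_mul (-κ)).add ((h 1 0 1).const_mul (2 * κ))).add
      ((h 0 0 1).const_mul 2)).add (((h 0 1 1).const_mul κ).add ((h 0 2 2).const_mul κ))).congr
        fun v s => by simp [cubicForm]; ring
  · exact (((h 1 0 2).const_mul (-2 * κ)).add ((h 0 1 2).const_mul (-2 * κ))).congr
      fun v s => by simp [cubicForm]; ring

theorem cubicForm_apply (hc : ∀ i, VanishOrd 0 fun v s => c v s i)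
    (hw : ∀ i, VanishOrd 0 fun v s => w v s i) (i : Fin 3) :
    VanishOrd 2 fun v s => cubicForm κ (c v s) (w v s) i :=
  (cubicForm_sub (κ := κ) (c := c) (w := w) (c' := 0) (w' := w) (fun i j k =>
    (((hc i).mul (hw j)).mul (hw k)).congr fun v s => by simp) i).congr fun v s => by
      simp [cubicForm_zero_left]

theorem modelAccel_sub_cubicForm (hc : ∀ i, VanishOrd 0 fun v s => c v s i)
    (hw : ∀ i, VanishOrd 0 fun v s => w v s i) (i : Fin 3) : VanishOrd 3 fun v s =>
      modelAccel κ (c v s) (w v s) i - cubicForm κ (c v s) (w v s) i := by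
  have warp_sub_one : VanishOrd 1 fun v s => κ * (c v s 0 * c v s 1) :=
    ((hc 0).mul (hc 1)).const_mul κ
  have inv_warp := warp_sub_one.inv_one_add_sub_one
  have warp_pow_four := ((warp_sub_one.one_add_mul_one_add_sub_one
    warp_sub_one).one_add_mul_one_add_sub_one warp_sub_one).one_add_mul_one_add_sub_one warp_sub_one
  have warp_cubed := warp_pow_four.one_add_mul_one_add_sub_one inv_warp
  have cos_sq_div_warp := inv_warp.one_add_mul_one_add_sub_one (hc 0).cos_sq_sub_one
  have inv_warp_mul_cos_sq := inv_warp.one_add_mul_one_add_sub_one (hc 0).inv_cos_sq_sub_one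
  have warp_cubed_div_cos_sq := warp_cubed.one_add_mul_one_add_sub_one (hc 0).inv_cos_sq_sub_one
  have T {e : E → ℝ → ℝ} (he : VanishOrd 1 e) (i j k : Fin 3) :
      VanishOrd 3 fun v s => c v s i * e v s * w v s j * w v s k :=
    ((((hc i).mul he).mul (hw j)).mul (hw k)).mono (by lia)
  have S {e : E → ℝ → ℝ} (he : VanishOrd 1 e) (j k : Fin 3) :
      VanishOrd 3 fun v s => e v s * w v s j * w v s k :=
    (he.mul (hw j)).mul (hw k)
  fin_cases i
  · exact (((((T inv_warp 1 0 0).const_mul κ).add ((T inv_warp 0 0 1).const_mul (2 * κ))).sub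
      (((T cos_sq_div_warp 1 1 1).const_mul κ).add (S (hc 0).cos_mul_sin_sub 1 1))).add
        ((T warp_cubed 1 2 2).const_mul κ)).congr
        fun v s => by simp [cubicForm, modelAccel, warpAccel, div_eq_mul_inv]; ring
  · exact (((((T inv_warp_mul_cos_sq 0 0 0).const_mul (-κ)).add
      ((T inv_warp 1 0 1).const_mul (2 * κ))).add ((S (hc 0).sin_div_cos_sub 0 1).const_mul 2)).add
        (((T inv_warp 0 1 1).const_mul κ).add
          ((T warp_cubed_div_cos_sq 0 2 2).const_mul κ))).congr
        fun v s => by simp [cubicForm, modelAccel, warpAccel, div_eq_mul_inv]; ring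
  · exact (((T inv_warp 1 0 2).const_mul (-2 * κ)).add
      ((T inv_warp 0 1 2).const_mul (-2 * κ))).congr
        fun v s => by simp [cubicForm, modelAccel, warpAccel, div_eq_mul_inv]; ring

end VanishOrd

namespace IsModelFlow

variable {κ : ℝ} {c w : (Fin 3 → ℝ) → ℝ → Fin 3 → ℝ}

theorem apply_zero (h : IsModelFlow κ c w) {s : ℝ} (hs : s ∈ Icc (0 : ℝ) 1) :
    c 0 s = 0 ∧ w 0 s = 0 := by
  simpa using h.axis.self_of_nhds rfl rfl s hs

theorem vel_sub_ord (h : IsModelFlow κ c w) (i : Fin 3) :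
    VanishOrd 2 fun v s => w v s i - v i := by
  have haccel : VanishOrd 2 fun v s => modelAccel κ (c v s) (w v s) i :=
    (((VanishOrd.modelAccel_sub_cubicForm h.pos_ord h.vel_ord i).mono (by lia)).add
      (VanishOrd.cubicForm_apply h.pos_ord h.vel_ord i)).congr fun v s => by ring
  refine VanishOrd.of_hasDerivWithinAt haccel ?_ (fun s hs => ?_) ?_
  · filter_upwards [h.start] with v hv
    rw [hv.2, sub_self]
  · rw [(h.apply_zero hs).2, sub_self]
  · filter_upwards [h.hasDeriv] with v hv s hs
    exact ((hasDerivWithinAt_pi.mp (hv s hs).2) i).sub_const _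

theorem pos_sub_ord (h : IsModelFlow κ c w) (i : Fin 3) :
    VanishOrd 2 fun v s => c v s i - s * v i := by
  refine VanishOrd.of_hasDerivWithinAt (h.vel_sub_ord i) ?_ (fun s hs => ?_) ?_
  · filter_upwards [h.start] with v hv
    simp [hv.1]
  · simp [(h.apply_zero hs).1]
  · filter_upwards [h.hasDeriv] with v hv s hs
    exact (((hasDerivWithinAt_pi.mp (hv s hs).1) i).fun_sub
      ((hasDerivWithinAt_id s (Icc (0 : ℝ) 1)).mul_const (v i))).congr_deriv (by rw [one_mul])

theorem accel_sub_ord (h : IsModelFlow κ c w) (i : Fin 3) :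
    VanishOrd 3 fun v s => modelAccel κ (c v s) (w v s) i - s * cubicForm κ v v i := by
  have triple_sub (i j k : Fin 3) : VanishOrd 3 fun v s =>
      c v s i * w v s j * w v s k - (s • v) i * v j * v k :=
    (VanishOrd.mul_mul_sub_mul_mul (h.vel_ord j) (h.vel_ord k) (VanishOrd.coord i).time_mul
      (VanishOrd.coord j) (h.pos_sub_ord i) (h.vel_sub_ord j) (h.vel_sub_ord k)).mono (by lia)
  exact ((VanishOrd.modelAccel_sub_cubicForm h.pos_ord h.vel_ord i).add
    (VanishOrd.cubicForm_sub triple_sub i)).congr fun v s => by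
      rw [cubicForm_smul_left, Pi.smul_apply, smul_eq_mul]; ring

theorem vel_expansion (h : IsModelFlow κ c w) (i : Fin 3) :
    VanishOrd 3 fun v s => w v s i - v i - s ^ 2 / 2 * cubicForm κ v v i := by
  refine VanishOrd.of_hasDerivWithinAt (h.accel_sub_ord i) ?_ (fun s hs => ?_) ?_
  · filter_upwards [h.start] with v hv
    simp [hv.2]
  · simp [(h.apply_zero hs).2, cubicForm_zero_left]
  · filter_upwards [h.hasDeriv] with v hv s hs
    have hsq := (((hasDerivWithinAt_id s (Icc (0 : ℝ) 1)).pow 2).div_const 2).mul_const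
      (cubicForm κ v v i)
    exact ((((hasDerivWithinAt_pi.mp (hv s hs).2) i).sub_const (v i)).fun_sub hsq).congr_deriv
      (by simp)

theorem pos_expansion (h : IsModelFlow κ c w) (i : Fin 3) :
    VanishOrd 3 fun v s => c v s i - s * v i - s ^ 3 / 6 * cubicForm κ v v i := by
  refine VanishOrd.of_hasDerivWithinAt (h.vel_expansion i) ?_ (fun s hs => ?_) ?_
  · filter_upwards [h.start] with v hv
    simp [hv.1]
  · simp [(h.apply_zero hs).1, cubicForm_zero_left]
  · filter_upwards [h.hasDeriv] with v hv s hs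
    have hlin := (hasDerivWithinAt_id s (Icc (0 : ℝ) 1)).mul_const (v i)
    have hcube := (((hasDerivWithinAt_id s (Icc (0 : ℝ) 1)).pow 3).div_const 6).mul_const
      (cubicForm κ v v i)
    refine ((((hasDerivWithinAt_pi.mp (hv s hs).1) i).fun_sub hlin).fun_sub hcube).congr_deriv ?_
    simp only [id_eq]
    push_cast
    ring

end IsModelFlow

/-! ### Geodesics with initial velocity in the wedge -/

/-- The planar cone `σ r θ > 0`, `β |r| ≤ |θ|`, `β |θ| ≤ |r|`. -/
def planeCone (σ β : ℝ) : Set (Fin 3 → ℝ) :=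
  {x | 0 < σ * (x 0 * x 1) ∧ β * |x 0| ≤ |x 1| ∧ β * |x 1| ≤ |x 0|}

/-- An open region on which all cutoffs equal `1`, so that the warping function is
`1 + k σ r θ`. -/
def unitRegion (σ α k : ℝ) : Set (Fin 3 → ℝ) :=
  {x | 0 < σ * (x 0 * x 1) ∧ |x 0| < rhoStar α k ∧ |x 1| < rhoStar α k ∧
    |x 0| ^ (1 / α) < |x 1| ∧ |x 1| ^ (1 / α) < |x 0|}

section Cones

variable {α σ : ℝ}

theorem isOpen_unitRegion (σ k : ℝ) (hα : 0 < α) : IsOpen (unitRegion σ α k) := by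
  have habs (i : Fin 3) : Continuous fun x : Fin 3 → ℝ => |x i| := by fun_prop
  have hpow (i : Fin 3) : Continuous fun x : Fin 3 → ℝ => |x i| ^ (1 / α) :=
    (habs i).rpow_const fun _ => Or.inr (by positivity)
  have hmul : Continuous fun x : Fin 3 → ℝ => σ * (x 0 * x 1) := by fun_prop
  exact (isOpen_lt continuous_const hmul).inter ((isOpen_lt (habs 0) continuous_const).inter
    ((isOpen_lt (habs 1) continuous_const).inter ((isOpen_lt (hpow 0) (habs 1)).inter
      (isOpen_lt (hpow 1) (habs 0)))))

theorem ne_zero_of_mul_mul_pos {a b : ℝ} (h : 0 < σ * (a * b)) : a ≠ 0 ∧ b ≠ 0 :=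
  mul_ne_zero_iff.mp (right_ne_zero_of_mul h.ne')

theorem eventually_rpow_lt_mul_abs {β : ℝ} (hα0 : 0 < α) (hα1 : α < 1) (hβ : 0 < β) :
    ∀ᶠ a in 𝓝 (0 : ℝ), a ≠ 0 → |a| ^ (1 / α) < β * |a| := by
  have hexp : 0 < 1 / α - 1 := sub_pos.mpr ((one_lt_div hα0).mpr hα1)
  have hcont : Continuous fun a : ℝ => |a| ^ (1 / α - 1) :=
    continuous_abs.rpow_const fun _ => Or.inr hexp.le
  have hlim : Tendsto (fun a : ℝ => |a| ^ (1 / α - 1)) (𝓝 0) (𝓝 0) :=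
    hcont.tendsto' 0 0 (by rw [abs_zero, Real.zero_rpow hexp.ne'])
  filter_upwards [hlim.eventually (gt_mem_nhds hβ)] with a hlt ha
  rwa [Real.rpow_sub_one (abs_pos.mpr ha).ne', div_lt_iff₀ (abs_pos.mpr ha)] at hlt

theorem eventually_mem_unitRegion_of_mem_planeCone {β : ℝ} (σ k : ℝ) (hα0 : 0 < α) (hα1 : α < 1)
    (hβ : 0 < β) :
    ∀ᶠ x in 𝓝 (0 : Fin 3 → ℝ), x ∈ planeCone σ β → x ∈ unitRegion σ α k := by
  have hcoord (i : Fin 3) : Tendsto (fun x : Fin 3 → ℝ => x i) (𝓝 0) (𝓝 0) :=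
    (continuous_apply i).tendsto 0
  have hsmall (i : Fin 3) : ∀ᶠ x in 𝓝 (0 : Fin 3 → ℝ), |x i| < rhoStar α k :=
    (hcoord i).abs.eventually (gt_mem_nhds (by simpa using rhoStar_pos hα0))
  have hpow (i : Fin 3) := (hcoord i).eventually (eventually_rpow_lt_mul_abs hα0 hα1 hβ)
  filter_upwards [hsmall 0, hsmall 1, hpow 0, hpow 1] with x s0 s1 p0 p1 ⟨hx, hx0, hx1⟩
  obtain ⟨n0, n1⟩ := ne_zero_of_mul_mul_pos hx
  exact ⟨hx, s0, s1, (p0 n0).trans_le hx0, (p1 n1).trans_le hx1⟩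

theorem exists_factor_of_abs_sub_le {a s u : ℝ} (hs : 0 < s) (hu : u ≠ 0)
    (h : |a - s * u| ≤ 1 / 3 * (s * |u|)) :
    ∃ e, 2 / 3 ≤ e ∧ e ≤ 4 / 3 ∧ a = e * s * u ∧ |a| = e * s * |u| := by
  have hsu : s * u ≠ 0 := mul_ne_zero hs.ne' hu
  have hratio : |a / (s * u) - 1| ≤ 1 / 3 := by
    rwa [div_sub_one hsu, abs_div, div_le_iff₀ (abs_pos.mpr hsu), abs_mul s, abs_of_pos hs]
  have ha : a = a / (s * u) * s * u := by field_simp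
  obtain ⟨hlow, hup⟩ := abs_le.mp hratio
  have hpos : 0 < a / (s * u) * s := mul_pos (by linarith) hs
  exact ⟨a / (s * u), by linarith, by linarith, ha, by rw [← abs_of_pos hpos, ← abs_mul, ← ha]⟩

theorem mem_planeCone_of_abs_sub_le (hα : 0 ≤ α) {v x : Fin 3 → ℝ} (hv : v ∈ planeCone σ α)
    {s : ℝ} (hs : 0 < s) (h0 : |x 0 - s * v 0| ≤ 1 / 3 * (s * |v 0|))
    (h1 : |x 1 - s * v 1| ≤ 1 / 3 * (s * |v 1|)) : x ∈ planeCone σ (α / 2) := by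
  obtain ⟨hv, hv0, hv1⟩ := hv
  obtain ⟨n0, n1⟩ := ne_zero_of_mul_mul_pos hv
  obtain ⟨e, e_ge, e_le, x0_eq, abs_x0⟩ := exists_factor_of_abs_sub_le hs n0 h0
  obtain ⟨d, d_ge, d_le, x1_eq, abs_x1⟩ := exists_factor_of_abs_sub_le hs n1 h1
  have : 0 < e := by linarith
  have : 0 < d := by linarith
  refine ⟨?_, ?_, ?_⟩
  · calc 0 < e * d * s ^ 2 * (σ * (v 0 * v 1)) := by positivity
      _ = σ * (x 0 * x 1) := by rw [x0_eq, x1_eq]; ring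
  · calc α / 2 * |x 0| = e / 2 * s * (α * |v 0|) := by rw [abs_x0]; ring
      _ ≤ d * s * |v 1| := by gcongr; linarith
      _ = |x 1| := abs_x1.symm
  · calc α / 2 * |x 1| = d / 2 * s * (α * |v 1|) := by rw [abs_x1]; ring
      _ ≤ e * s * |v 0| := by gcongr; linarith
      _ = |x 0| := abs_x0.symm

theorem eventually_mem_planeCone_of_hasDerivWithinAt {c : ℝ → Fin 3 → ℝ} {v : Fin 3 → ℝ}
    (hα : 0 ≤ α) (hc0 : c 0 = 0) (hc : HasDerivWithinAt c v (Ici 0) 0) (hv : v ∈ planeCone σ α) :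
    ∀ᶠ u in 𝓝[>] 0, c u ∈ planeCone σ (α / 2) := by
  have near_line (i : Fin 3) (hi : v i ≠ 0) : ∀ᶠ u in 𝓝[>] (0 : ℝ),
      |c u i - u * v i| ≤ 1 / 3 * (u * |v i|) := by
    have hlittleO := (hasDerivWithinAt_pi.mp hc i).isLittleO.bound (c := 1 / 3 * |v i|)
      (by positivity)
    filter_upwards [nhdsWithin_mono 0 Ioi_subset_Ici_self hlittleO, self_mem_nhdsWithin]
      with u hu hu0
    simp only [hc0, Pi.zero_apply, sub_zero, smul_eq_mul, Real.norm_eq_abs,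
      abs_of_pos (mem_Ioi.mp hu0)] at hu
    linarith
  obtain ⟨n0, n1⟩ := ne_zero_of_mul_mul_pos hv.1
  filter_upwards [near_line 0 n0, near_line 1 n1, self_mem_nhdsWithin] with u u0 u1 hu
  exact mem_planeCone_of_abs_sub_le hα hv hu u0 u1

end Cones

section Christoffel

variable {α k σ : ℝ} {b : ℝ → ℝ} {χ : ℝ × ℝ → ℝ} {x : Fin 3 → ℝ}

theorem warpCoord_of_mem_unitRegion (hα : 0 < α) (hb : IsTransition b) (hχ : IsPlaneCutoff χ)
    (hσ : σ = 1 ∨ σ = -1) (hx : x ∈ unitRegion σ α k) :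
    warpCoord α k b χ (x 0) (x 1) = 1 + k * σ * (x 0 * x 1) := by
  obtain ⟨hx, h0, h1, p0, p1⟩ := hx
  obtain ⟨n0, n1⟩ := ne_zero_of_mul_mul_pos hx
  have hρ := rhoStar_pos (k := k) hα
  have cutoff_eq_one : χ (x 0 / rhoStar α k, x 1 / rhoStar α k) = 1 := by
    refine hχ.eq_one _ ?_ ?_ <;>
      simp only [abs_div, abs_of_pos hρ, div_le_one hρ, h0.le, h1.le]
  have transition_eq_one {r θ : ℝ} (hr : r ≠ 0) (h : |r| ^ (1 / α) < |θ|) :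
      b (|θ| / |r| ^ (1 / α)) = 1 :=
    hb.eq_one _ ((one_le_div (Real.rpow_pos_of_pos (abs_pos.mpr hr) _)).mpr h.le)
  have abs_mul_eq : |x 0 * x 1| = σ * (x 0 * x 1) := by
    rcases hσ with rfl | rfl
    · rw [one_mul] at hx ⊢
      exact abs_of_pos hx
    · rw [neg_one_mul] at hx ⊢
      exact abs_of_neg (neg_pos.mp hx)
  rw [warpCoord, cutoff_eq_one, psi, transition_eq_one n0 p0, transition_eq_one n1 p1, abs_mul_eq]
  ring

theorem abs_lt_quarter_of_mem_unitRegion (hx : x ∈ unitRegion σ α k) :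
    |x 0| < 1 / 4 ∧ |x 1| < 1 / 4 :=
  ⟨hx.2.1.trans_le (rhoStar_le_quarter α k), hx.2.2.1.trans_le (rhoStar_le_quarter α k)⟩

theorem warp_eventuallyEq_of_mem_unitRegion (hα : 0 < α) (hb : IsTransition b)
    (hχ : IsPlaneCutoff χ) (hσ : σ = 1 ∨ σ = -1) (hx : x ∈ unitRegion σ α k) :
    (fun y => warp α k b χ (polarParam y).1) =ᶠ[𝓝 x] fun y => 1 + k * σ * (y 0 * y 1) := by
  obtain ⟨h0, h1⟩ := abs_lt_quarter_of_mem_unitRegion hx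
  have hpi := Real.pi_gt_three
  filter_upwards [warp_polarParam_eventuallyEq hχ hα k b (h0.trans (by linarith))
    ⟨by linarith [(abs_lt.mp h1).1], by linarith [(abs_lt.mp h1).2]⟩,
    (isOpen_unitRegion σ k hα).mem_nhds hx] with y hy hy'
  rw [hy, warpCoord_of_mem_unitRegion hα hb hχ hσ hy']

theorem one_add_ge_of_mem_unitRegion (hα : 0 < α) (hb : IsTransition b) (hχ : IsPlaneCutoff χ)
    (hσ : σ = 1 ∨ σ = -1) (hx : x ∈ unitRegion σ α k) : 3 / 4 ≤ 1 + k * σ * (x 0 * x 1) := by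
  rw [← warpCoord_of_mem_unitRegion hα hb hχ hσ hx]
  exact warpCoord_ge hχ hb hα k _ _

theorem cos_pos_of_mem_unitRegion (hx : x ∈ unitRegion σ α k) : 0 < Real.cos (x 0) := by
  have h := abs_lt.mp (abs_lt_quarter_of_mem_unitRegion hx).1
  exact Real.cos_pos_of_mem_Ioo ⟨by linarith [Real.pi_gt_three], by linarith [Real.pi_gt_three]⟩

theorem warp_eventuallyEq_zero (hχ : IsPlaneCutoff χ) (hα : 0 < α) (k : ℝ) (b : ℝ → ℝ) :
    (fun y => warp α k b χ (polarParam y).1) =ᶠ[𝓝 0] fun y => warpCoord α k b χ (y 0) (y 1) :=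
  warp_polarParam_eventuallyEq hχ hα k b (x := 0) (by simp [Real.pi_pos])
    (by simp [Real.pi_pos, Real.pi_pos.le])

theorem hasFDerivAt_warp_zero (hα : 0 < α) (hb : IsTransition b) (hχ : IsPlaneCutoff χ) :
    HasFDerivAt (fun y => warp α k b χ (polarParam y).1) (0 : (Fin 3 → ℝ) →L[ℝ] ℝ) 0 := by
  have quadratic : (fun y : Fin 3 → ℝ => k * χ (y 0 / rhoStar α k, y 1 / rhoStar α k) *
      psi α b (y 0) (y 1)) =O[𝓝 0] fun y => ‖y - 0‖ ^ 2 := by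
    refine Asymptotics.IsBigO.of_bound |k| (Eventually.of_forall fun y => ?_)
    rw [sub_zero, norm_pow, norm_norm, norm_mul, norm_mul, Real.norm_eq_abs k,
      Real.norm_of_nonneg (hχ.nonneg _), Real.norm_of_nonneg (psi_nonneg hb _ _ _)]
    calc _ ≤ |k| * 1 * (‖y‖ * ‖y‖) := by
          gcongr
          · exact psi_nonneg hb _ _ _
          · exact hχ.le_one _
          · refine (psi_le hb _ _ _).trans ?_
            rw [abs_mul]
            exact mul_le_mul (norm_le_pi_norm y 0) (norm_le_pi_norm y 1) (abs_nonneg _)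
              (norm_nonneg _)
      _ = _ := by ring
  exact ((quadratic.hasFDerivAt (𝕜 := ℝ) one_lt_two).const_add 1).congr_of_eventuallyEq
    (warp_eventuallyEq_zero hχ hα k b)

theorem christoffel_zero (hα : 0 < α) (hb : IsTransition b) (hχ : IsPlaneCutoff χ)
    (m i j : Fin 3) :
    christoffel (metricMatrix α k b χ polarParam) m i j 0 = warpChristoffel m i j 1 0 0 0 := by
  have hd := hasFDerivAt_warp_zero (k := k) hα hb hχ
  have warp_one : warp α k b χ (polarParam 0).1 = 1 := by
    refine (warp_eventuallyEq_zero hχ hα k b).self_of_nhds.trans ?_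
    simp [warpCoord, psi]
  have hpartial (i : Fin 3) : partialDeriv i (fun y => warp α k b χ (polarParam y).1) 0 = 0 := by
    rw [partialDeriv_eq_of_hasFDerivAt hd]
    rfl
  rw [metricMatrix_polarParam_eq, christoffel_warpDiag hd.differentiableAt
    (by rw [warp_one]; exact one_ne_zero) (by simp) (hpartial 2), hpartial, hpartial, warp_one]
  simp only [zero_div, Pi.zero_apply]

theorem christoffel_of_mem_unitRegion (hα : 0 < α) (hb : IsTransition b) (hχ : IsPlaneCutoff χ)
    (hσ : σ = 1 ∨ σ = -1) (hx : x ∈ unitRegion σ α k) (m i j : Fin 3) :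
    christoffel (metricMatrix α k b χ polarParam) m i j x =
      warpChristoffel m i j (1 + k * σ * (x 0 * x 1)) (k * σ * x 1 / (1 + k * σ * (x 0 * x 1)))
        (k * σ * x 0 / (1 + k * σ * (x 0 * x 1))) (x 0) := by
  have heq := warp_eventuallyEq_of_mem_unitRegion hα hb hχ hσ hx
  have hwarp : warp α k b χ (polarParam x).1 = 1 + k * σ * (x 0 * x 1) := heq.self_of_nhds
  have hge := one_add_ge_of_mem_unitRegion hα hb hχ hσ hx
  have hd : HasFDerivAt (fun y : Fin 3 → ℝ => 1 + k * σ * (y 0 * y 1)) _ x :=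
    (((hasFDerivAt_coord 0 x).mul (hasFDerivAt_coord 1 x)).const_mul (k * σ)).const_add 1
  have hpartial (i : Fin 3) : partialDeriv i (fun y => warp α k b χ (polarParam y).1) x =
      k * σ * (x 0 * (Pi.single i 1 : Fin 3 → ℝ) 1 + x 1 * (Pi.single i 1 : Fin 3 → ℝ) 0) := by
    rw [partialDeriv_congr heq, partialDeriv_eq_of_hasFDerivAt hd]
    simp
    ring
  rw [metricMatrix_polarParam_eq,
    christoffel_warpDiag (hd.differentiableAt.congr_of_eventuallyEq heq)
    (by rw [hwarp]; linarith) (cos_pos_of_mem_unitRegion hx).ne' (by simp [hpartial]),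
    hpartial, hpartial, hwarp]
  simp

theorem neg_sum_christoffel_eq_modelAccel (hα : 0 < α) (hb : IsTransition b)
    (hχ : IsPlaneCutoff χ) (hσ : σ = 1 ∨ σ = -1) (hx : x = 0 ∨ x ∈ unitRegion σ α k)
    (w : Fin 3 → ℝ) :
    (fun m => - ∑ i, ∑ j, christoffel (metricMatrix α k b χ polarParam) m i j x * w i * w j) =
      modelAccel (k * σ) x w := by
  rw [modelAccel, ← neg_sum_warpChristoffel]
  rcases hx with rfl | hx
  · simp [christoffel_zero hα hb hχ]
  · simp only [christoffel_of_mem_unitRegion hα hb hχ hσ hx]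

theorem contDiffAt_modelField_of_eq_zero_or_mem_unitRegion (hα : 0 < α) (hb : IsTransition b)
    (hχ : IsPlaneCutoff χ) (hσ : σ = 1 ∨ σ = -1) (hx : x = 0 ∨ x ∈ unitRegion σ α k)
    (w : Fin 3 → ℝ) : ContDiffAt ℝ 1 (modelField (k * σ)) (x, w) := by
  rcases hx with rfl | hx
  · exact contDiffAt_modelField (by simp) (by simp)
  · exact contDiffAt_modelField (by linarith [one_add_ge_of_mem_unitRegion hα hb hχ hσ hx])
      (cos_pos_of_mem_unitRegion hx).ne'

end Christoffel

theorem VanishOrd.eventually_abs_sub_le {E : Type*} [NormedAddCommGroup E] {m : ℕ}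
    {f : E → ℝ → ℝ} (hf : VanishOrd (m + 1) f) {ε : ℝ} (hε : 0 < ε) :
    ∀ᶠ q in pairFilter E, |f q.1.1 q.2 - f q.1.2 q.2| ≤ ε * ‖q.1.1 - q.1.2‖ := by
  have hpow : (fun q : (E × E) × ℝ => (‖q.1.1‖ + ‖q.1.2‖) ^ (m + 1)) =o[pairFilter E]
      fun _ => (1 : ℝ) :=
    (Asymptotics.isLittleO_one_iff ℝ).mpr
      (by simpa using (tendsto_pairFilter_norm_add (E := E)).pow (m + 1))
  filter_upwards [(hf.isBigO.trans_isLittleO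
    (hpow.mul_isBigO (Asymptotics.isBigO_refl _ _))).bound hε] with q hq
  simpa using hq

theorem abs_sub_mul_le_of_hasDerivWithinAt {c w : ℝ → ℝ} {a ε : ℝ} (hc0 : c 0 = 0)
    (hc : ∀ s ∈ Icc (0 : ℝ) 1, HasDerivWithinAt c (w s) (Icc 0 1) s)
    (hw : ∀ s ∈ Icc (0 : ℝ) 1, |w s - a| ≤ ε) {s : ℝ} (hs : s ∈ Icc (0 : ℝ) 1) :
    |c s - s * a| ≤ ε * s := by
  have hderiv : ∀ u ∈ Icc (0 : ℝ) 1,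
      HasDerivWithinAt (fun u => c u - u * a) (w u - a) (Icc 0 1) u := fun u hu =>
    (hc u hu).fun_sub (by simpa using (hasDerivWithinAt_id u (Icc (0 : ℝ) 1)).mul_const a)
  simpa [hc0, abs_of_nonneg hs.1] using
    (convex_Icc (0 : ℝ) 1).norm_image_sub_le_of_norm_hasDerivWithin_le hderiv hw
      (left_mem_Icc.mpr zero_le_one) hs

namespace IsModelFlow

variable {κ σ α k : ℝ} {c w : (Fin 3 → ℝ) → ℝ → Fin 3 → ℝ}

/- Compare with the geodesic whose initial velocity is the projection of `v` to the `ξ`-axis: it is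
a straight line, and the difference of the initial velocities is the planar part of `v`. -/
theorem eventually_abs_vel_sub_le (h : IsModelFlow κ c w) {i : Fin 3} (hi : i ≠ 2) {ε : ℝ}
    (hε : 0 < ε) : ∀ᶠ v in 𝓝 (0 : Fin 3 → ℝ), ∀ s ∈ Icc (0 : ℝ) 1,
      |w v s i - v i| ≤ ε * max |v 0| |v 1| := by
  have hproj : Continuous fun v : Fin 3 → ℝ => (Pi.single 2 (v 2) : Fin 3 → ℝ) :=
    (continuous_single 2).comp (continuous_apply 2)
  have hpair : Tendsto (fun v : Fin 3 → ℝ => (v, (Pi.single 2 (v 2) : Fin 3 → ℝ))) (𝓝 0) (𝓝 0) :=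
    (continuous_id.prodMk hproj).tendsto' _ _ (by simp)
  have hplanar (v : Fin 3 → ℝ) : ‖v - Pi.single 2 (v 2)‖ ≤ max |v 0| |v 1| := by
    refine (pi_norm_le_iff_of_nonneg (by positivity)).mpr fun j => ?_
    fin_cases j <;> simp
  filter_upwards [hpair.eventually (eventually_prod_principal_iff.mp
    ((h.vel_sub_ord i).eventually_abs_sub_le hε)),
    (hproj.tendsto' 0 0 (by simp)).eventually h.axis] with v hlip haxis s hs
  have hline := (haxis (by simp) (by simp) s hs).2
  have := hlip s hs
  simp only [hline, Pi.single_eq_of_ne hi, sub_zero] at this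
  exact this.trans (by gcongr; exact hplanar v)

theorem eventually_mem_planeCone (h : IsModelFlow κ c w) (σ : ℝ) (hα : 0 < α) (hα1 : α ≤ 1) :
    ∀ᶠ v in 𝓝 (0 : Fin 3 → ℝ), v ∈ planeCone σ α → ∀ s ∈ Ioc (0 : ℝ) 1,
      c v s ∈ planeCone σ (α / 2) := by
  filter_upwards [h.eventually_abs_vel_sub_le (i := 0) (by decide) (div_pos hα three_pos),
    h.eventually_abs_vel_sub_le (i := 1) (by decide) (div_pos hα three_pos), h.start,
    h.hasDeriv] with v vel0 vel1 hstart hderiv hv s hs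
  have mul_max_le : α * max |v 0| |v 1| ≤ |v 0| ∧ α * max |v 0| |v 1| ≤ |v 1| := by
    rcases max_cases |v 0| |v 1| with ⟨h, -⟩ | ⟨h, -⟩ <;> rw [h]
    · exact ⟨mul_le_of_le_one_left (abs_nonneg _) hα1, hv.2.1⟩
    · exact ⟨hv.2.2, mul_le_of_le_one_left (abs_nonneg _) hα1⟩
  have pos_near (i : Fin 3) (hi : ∀ s ∈ Icc (0 : ℝ) 1, |w v s i - v i| ≤ 1 / 3 * |v i|) :
      |c v s i - s * v i| ≤ 1 / 3 * (s * |v i|) :=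
    (abs_sub_mul_le_of_hasDerivWithinAt (congrFun hstart.1 i)
      (fun u hu => hasDerivWithinAt_pi.mp (hderiv u hu).1 i) hi
        (Ioc_subset_Icc_self hs)).trans_eq (by ring)
  exact mem_planeCone_of_abs_sub_le hα.le hv hs.1
    (pos_near 0 fun u hu => (vel0 u hu).trans (by linarith [mul_max_le.1]))
    (pos_near 1 fun u hu => (vel1 u hu).trans (by linarith [mul_max_le.2]))

theorem eventually_mem_unitRegion (h : IsModelFlow κ c w) (σ k : ℝ) (hα : 0 < α) (hα1 : α < 1) :
    ∀ᶠ v in 𝓝 (0 : Fin 3 → ℝ), v ∈ planeCone σ α → ∀ s ∈ Ioc (0 : ℝ) 1,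
      c v s ∈ unitRegion σ α k := by
  obtain ⟨ε, hε, hball⟩ := Metric.eventually_nhds_iff.mp
    (eventually_mem_unitRegion_of_mem_planeCone σ k hα hα1 (half_pos hα))
  filter_upwards [h.eventually_mem_planeCone σ hα hα1.le,
    eventually_all.mpr fun i => (h.pos_ord i).eventually_abs_lt hε] with v hcone hsmall hv s hs
  refine hball ?_ (hcone hv s hs)
  rw [dist_zero_right]
  exact (pi_norm_lt_iff hε).mpr fun i => hsmall i s (Ioc_subset_Icc_self hs)

end IsModelFlow

section Uniqueness

variable {α k σ : ℝ} {b : ℝ → ℝ} {χ : ℝ × ℝ → ℝ} {v : Fin 3 → ℝ} {c w c' w' : ℝ → Fin 3 → ℝ}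

theorem isGeodesicFrom_of_modelAccel (hα : 0 < α) (hb : IsTransition b) (hχ : IsPlaneCutoff χ)
    (hσ : σ = 1 ∨ σ = -1) (hc0 : c 0 = 0) (hw0 : w 0 = v)
    (hmem : ∀ s ∈ Ioc (0 : ℝ) 1, c s ∈ unitRegion σ α k)
    (hderiv : ∀ s ∈ Icc (0 : ℝ) 1, HasDerivWithinAt c (w s) (Icc 0 1) s ∧
      HasDerivWithinAt w (modelAccel (k * σ) (c s) (w s)) (Icc 0 1) s) :
    IsGeodesicFrom α k b χ v c w := by
  have hmem0 : ∀ s ∈ Icc (0 : ℝ) 1, c s = 0 ∨ c s ∈ unitRegion σ α k := fun s hs =>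
    hs.1.eq_or_lt.imp (by rintro rfl; exact hc0) fun h => hmem s ⟨h, hs.2⟩
  refine ⟨hc0, hw0, fun s hs => ?_, fun s hs => (hderiv s hs).1, fun s hs => ?_⟩
  · rcases hmem0 s hs with h | h
    · simp [h, Real.pi_pos]
    · exact (abs_lt_quarter_of_mem_unitRegion h).1.trans (by linarith [Real.pi_gt_three])
  · rw [neg_sum_christoffel_eq_modelAccel hα hb hχ hσ (hmem0 s hs)]
    exact (hderiv s hs).2

theorem IsGeodesicFrom.continuousOn (h : IsGeodesicFrom α k b χ v c w) :
    ContinuousOn c (Icc 0 1) ∧ ContinuousOn w (Icc 0 1) :=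
  ⟨fun s hs => (h.hasDeriv_pos s hs).continuousWithinAt,
    fun s hs => (h.hasDeriv_vel s hs).continuousWithinAt⟩

theorem IsGeodesicFrom.eventually_mem_unitRegion_zero (h : IsGeodesicFrom α k b χ v c w)
    (hα : 0 < α) (hα1 : α < 1) (hv : v ∈ planeCone σ α) :
    ∀ᶠ u in 𝓝[≥] 0, c u = 0 ∨ c u ∈ unitRegion σ α k := by
  have hderiv : HasDerivWithinAt c v (Ici 0) 0 := by
    have := (h.hasDeriv_pos 0 (by simp)).mono_of_mem_nhdsWithin (Icc_mem_nhdsGE one_pos)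
    rwa [h.start_vel] at this
  have hlim : Tendsto c (𝓝[>] 0) (𝓝 0) := by
    simpa only [h.start_pos] using hderiv.continuousWithinAt.mono_left
      (nhdsWithin_mono 0 Ioi_subset_Ici_self)
  rw [← Ioi_insert, nhdsWithin_insert, eventually_sup]
  refine ⟨by simp [h.start_pos], ?_⟩
  filter_upwards [eventually_mem_planeCone_of_hasDerivWithinAt hα.le h.start_pos hderiv hv,
    hlim.eventually (eventually_mem_unitRegion_of_mem_planeCone σ k hα hα1 (half_pos hα))]
    with u hcone hregion using Or.inr (hregion hcone)

theorem IsGeodesicFrom.eqOn_of_mem_unitRegion (hα : 0 < α) (hα1 : α < 1) (hb : IsTransition b)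
    (hχ : IsPlaneCutoff χ) (hσ : σ = 1 ∨ σ = -1) (hv : v ∈ planeCone σ α)
    (h : IsGeodesicFrom α k b χ v c w) (hmem : ∀ s ∈ Ioc (0 : ℝ) 1, c s ∈ unitRegion σ α k)
    (h' : IsGeodesicFrom α k b χ v c' w') : EqOn c c' (Icc 0 1) := by
  have hmem0 : ∀ s ∈ Icc (0 : ℝ) 1, c s = 0 ∨ c s ∈ unitRegion σ α k := fun s hs =>
    hs.1.eq_or_lt.imp (by rintro rfl; exact h.start_pos) fun h0 => hmem s ⟨h0, hs.2⟩
  have model_deriv {c w} (h : IsGeodesicFrom α k b χ v c w) {s : ℝ} (hs : s ∈ Icc (0 : ℝ) 1)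
      (hcs : c s = 0 ∨ c s ∈ unitRegion σ α k) :
      HasDerivWithinAt (fun s => (c s, w s)) (modelField (k * σ) (c s, w s)) (Icc 0 1) s := by
    have hvel := h.hasDeriv_vel s hs
    rw [neg_sum_christoffel_eq_modelAccel hα hb hχ hσ hcs] at hvel
    exact (h.hasDeriv_pos s hs).prodMk hvel
  have hsol := eqOn_of_locally_solution (β := fun s => (c s, w s)) (γ := fun s => (c' s, w' s))
    (fun s hs => model_deriv h hs (hmem0 s hs))
    (fun s hs => contDiffAt_modelField_of_eq_zero_or_mem_unitRegion hα hb hχ hσ (hmem0 s hs) _)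
    (by rw [h.start_pos, h.start_vel, h'.start_pos, h'.start_vel])
    (h'.continuousOn.1.prodMk h'.continuousOn.2) fun s hs heq => ?_
  · exact fun s hs => congrArg Prod.fst (hsol hs)
  · have hIcc : Icc (0 : ℝ) 1 ∈ 𝓝[≥] s :=
      mem_of_superset (Icc_mem_nhdsGE hs.2) (Icc_subset_Icc_left hs.1)
    have hregion : ∀ᶠ u in 𝓝[≥] s, c' u = 0 ∨ c' u ∈ unitRegion σ α k := by
      rcases hs.1.eq_or_lt with rfl | hs0
      · exact h'.eventually_mem_unitRegion_zero hα hα1 hv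
      · have hs' : c' s ∈ unitRegion σ α k :=
          (Prod.mk.inj heq).1 ▸ hmem s ⟨hs0, hs.2.le⟩
        have hcont := (h'.continuousOn.1 s (Ico_subset_Icc_self hs)).mono_of_mem_nhdsWithin hIcc
        exact (hcont.eventually ((isOpen_unitRegion σ k hα).mem_nhds hs')).mono fun _ => Or.inr
    filter_upwards [hregion, hIcc] with u hu hu' using model_deriv h' hu' hu

end Uniqueness

theorem IsModelFlow.eventually_isGeodesicFrom {α k σ : ℝ} {b : ℝ → ℝ} {χ : ℝ × ℝ → ℝ}
    {c w : (Fin 3 → ℝ) → ℝ → Fin 3 → ℝ} (h : IsModelFlow (k * σ) c w) (hα : 0 < α) (hα1 : α < 1)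
    (hb : IsTransition b) (hχ : IsPlaneCutoff χ) (hσ : σ = 1 ∨ σ = -1) :
    ∀ᶠ v in 𝓝 (0 : Fin 3 → ℝ), v ∈ planeCone σ α → c v 1 ∈ unitRegion σ α k ∧
      IsGeodesicFrom α k b χ v (c v) (w v) ∧
      ∀ c' w', IsGeodesicFrom α k b χ v c' w' → EqOn (c v) c' (Icc 0 1) := by
  filter_upwards [h.eventually_mem_unitRegion σ k hα hα1, h.start, h.hasDeriv]
    with v hregion hstart hderiv hv
  have hgeod := isGeodesicFrom_of_modelAccel hα hb hχ hσ hstart.1 hstart.2 (hregion hv) hderiv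
  exact ⟨hregion hv 1 (by simp), hgeod, fun c' w' =>
    hgeod.eqOn_of_mem_unitRegion hα hα1 hb hχ hσ hv (hregion hv)⟩

/-! ### Volumes of images of small dilated sets -/

section Volume

open MeasureTheory Asymptotics
open scoped Pointwise
open Bornology (IsBounded)

theorem volume_image_le_of_norm_sub_le {X ι : Type*} [Fintype ι] {f g : X → ι → ℝ} {S : Set X}
    {K : ℝ} (hK : 0 ≤ K) (h : ∀ x ∈ S, ∀ y ∈ S, ‖f x - f y‖ ≤ K * ‖g x - g y‖) :
    volume (f '' S) ≤ ENNReal.ofReal K ^ Fintype.card ι * volume (g '' S) := by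
  obtain rfl | ⟨x₀, -⟩ := S.eq_empty_or_nonempty
  · simp
  have : Nonempty X := ⟨x₀⟩
  set r : (ι → ℝ) → X := Function.invFunOn g S
  have hr : ∀ p ∈ g '' S, r p ∈ S ∧ g (r p) = p :=
    fun p hp => ⟨Function.invFunOn_mem hp, Function.invFunOn_eq hp⟩
  have hLip : LipschitzOnWith K.toNNReal (f ∘ r) (g '' S) :=
    LipschitzOnWith.of_dist_le_mul fun p hp q hq => by
      simpa [dist_eq_norm, Real.coe_toNNReal K hK, (hr p hp).2, (hr q hq).2] using
        h _ (hr p hp).1 _ (hr q hq).1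
  have hsub : f '' S ⊆ (f ∘ r) '' (g '' S) := by
    rintro _ ⟨x, hx, rfl⟩
    obtain ⟨hrS, hgr⟩ := hr (g x) (mem_image_of_mem g hx)
    have hfr : ‖f (r (g x)) - f x‖ ≤ 0 := by simpa [hgr] using h _ hrS x hx
    exact ⟨g x, mem_image_of_mem g hx, sub_eq_zero.mp (norm_le_zero_iff.mp hfr)⟩
  have hHausdorff := hLip.hausdorffMeasure_image_le (d := Fintype.card ι) (by positivity)
  rw [hausdorffMeasure_pi_real, ENNReal.rpow_natCast] at hHausdorff
  exact (measure_mono hsub).trans hHausdorff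

theorem volume_real_image_le_of_norm_sub_le {X ι : Type*} [Fintype ι] {f g : X → ι → ℝ}
    {S : Set X} {K : ℝ} (hK : 0 ≤ K) (h : ∀ x ∈ S, ∀ y ∈ S, ‖f x - f y‖ ≤ K * ‖g x - g y‖)
    (hg : volume (g '' S) ≠ ⊤) :
    volume.real (f '' S) ≤ K ^ Fintype.card ι * volume.real (g '' S) := by
  have hle := ENNReal.toReal_mono (by finiteness) (volume_image_le_of_norm_sub_le hK h)
  rwa [ENNReal.toReal_mul, ENNReal.toReal_pow, ENNReal.toReal_ofReal hK] at hle

theorem eventually_forall_dilate {P : (Fin 3 → ℝ) → Prop} (hP : ∀ᶠ v in 𝓝 0, P v)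
    {Ω : Set (Fin 3 → ℝ)} (hΩ : IsBounded Ω) :
    ∀ᶠ t : ℝ in 𝓝[>] 0, ∀ v ∈ dilate t Ω, P v :=
  ((absorbs_iff_eventually_nhdsNE_zero.mp ((NormedSpace.isVonNBounded_iff ℝ).mpr hΩ hP)).filter_mono
    (nhdsWithin_mono 0 fun _ ht => ne_of_gt ht)).mono fun _ ht => forall_mem_image.mpr ht

theorem eventually_forall_dilate_pair {P : (Fin 3 → ℝ) × (Fin 3 → ℝ) → Prop}
    (hP : ∀ᶠ p in 𝓝 0, P p) {Ω : Set (Fin 3 → ℝ)} (hΩ : IsBounded Ω) :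
    ∀ᶠ t : ℝ in 𝓝[>] 0, ∀ v ∈ dilate t Ω, ∀ v' ∈ dilate t Ω, P (v, v') := by
  rw [← Prod.mk_zero_zero, nhds_prod_eq] at hP
  obtain ⟨U, hU, V, hV, h⟩ := mem_prod_iff.mp hP
  filter_upwards [eventually_forall_dilate (hP := hU) hΩ, eventually_forall_dilate (hP := hV) hΩ]
    with t htU htV v hv v' hv' using h ⟨htU v hv, htV v' hv'⟩

theorem VanishOrd.isBigO_pi {E ι : Type*} [NormedAddCommGroup E] [Fintype ι] {m : ℕ}
    {F G : E → ι → ℝ} (h : ∀ i, VanishOrd m fun v _ => F v i - G v i) :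
    (fun p : E × E => (F p.1 - F p.2) - (G p.1 - G p.2))
      =O[𝓝 0] fun p => (‖p.1‖ + ‖p.2‖) ^ m * ‖p.1 - p.2‖ := by
  have hpair : Tendsto (fun p : E × E => (p, (0 : ℝ))) (𝓝 0) (pairFilter E) :=
    tendsto_id.prodMk (tendsto_principal.mpr (Eventually.of_forall fun _ => by simp))
  exact Asymptotics.isBigO_pi.mpr fun i => ((h i).isBigO.comp_tendsto hpair).congr_left fun p => by
    simp only [Function.comp_apply, Pi.sub_apply]
    ring

theorem VanishOrd.eventually_norm_sub_sub_le {E : Type*} [NormedAddCommGroup E]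
    {ι : Type*} [Fintype ι] {F G : E → ι → ℝ} (h : ∀ i, VanishOrd 1 fun v _ => F v i - G v i)
    {ε : ℝ} (hε : 0 < ε) :
    ∀ᶠ p : E × E in 𝓝 0, ‖(F p.1 - F p.2) - (G p.1 - G p.2)‖ ≤ ε * ‖p.1 - p.2‖ := by
  have hnorm : Tendsto (fun p : E × E => (‖p.1‖ + ‖p.2‖) ^ 1) (𝓝 0) (𝓝 0) :=
    (by fun_prop : Continuous fun p : E × E => (‖p.1‖ + ‖p.2‖) ^ 1).tendsto' _ _ (by simp)
  have hlittleO := ((isLittleO_one_iff ℝ).mpr hnorm).mul_isBigO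
    (isBigO_refl (fun p : E × E => ‖p.1 - p.2‖) (𝓝 0))
  simpa only [one_mul, norm_norm] using ((VanishOrd.isBigO_pi h).trans_isLittleO hlittleO).def hε

theorem norm_le_and_le_of_norm_sub_le {E : Type*} [SeminormedAddCommGroup E] {a b : E}
    (h : ‖a - b‖ ≤ 1 / 2 * ‖b‖) : ‖a‖ ≤ 3 / 2 * ‖b‖ ∧ ‖b‖ ≤ 2 * ‖a‖ := by
  have ha : ‖a‖ ≤ ‖a - b‖ + ‖b‖ := norm_le_norm_sub_add a b
  have hb : ‖b‖ ≤ ‖a - b‖ + ‖a‖ := norm_sub_rev a b ▸ norm_le_norm_sub_add b a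
  constructor <;> linarith

theorem eventually_norm_sub_le_dilate {G : (Fin 3 → ℝ) → Fin 3 → ℝ}
    (hG : ∀ i, VanishOrd 1 fun v _ => G v i - v i) {Ω : Set (Fin 3 → ℝ)} (hΩ : IsBounded Ω) :
    ∀ᶠ t : ℝ in 𝓝[>] 0, ∀ v ∈ dilate t Ω, ∀ v' ∈ dilate t Ω,
      ‖G v - G v'‖ ≤ 3 / 2 * ‖v - v'‖ ∧ ‖v - v'‖ ≤ 2 * ‖G v - G v'‖ := by
  filter_upwards [eventually_forall_dilate_pair
    (VanishOrd.eventually_norm_sub_sub_le (G := id) hG one_half_pos) hΩ]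
    with t ht v hv v' hv' using norm_le_and_le_of_norm_sub_le (ht v hv v' hv')

theorem injOn_of_norm_sub_le {E F : Type*} [NormedAddCommGroup E] [SeminormedAddCommGroup F]
    {f : E → F} {S : Set E} {C : ℝ} (h : ∀ x ∈ S, ∀ y ∈ S, ‖x - y‖ ≤ C * ‖f x - f y‖) :
    InjOn f S := fun x hx y hy hxy => by
  simpa [hxy, sub_eq_zero] using h x hx y hy

theorem volume_real_dilate (Ω : Set (Fin 3 → ℝ)) {t : ℝ} (ht : 0 ≤ t) :
    volume.real (dilate t Ω) = t ^ 3 * volume.real Ω := by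
  have hsmul := Measure.addHaar_smul (volume : Measure (Fin 3 → ℝ)) t Ω
  rw [Module.finrank_fin_fun, abs_of_nonneg (by positivity)] at hsmul
  rw [measureReal_def, dilate, image_smul, hsmul, ENNReal.toReal_mul,
    ENNReal.toReal_ofReal (by positivity), measureReal_def]

theorem isBounded_dilate {Ω : Set (Fin 3 → ℝ)} (hΩ : IsBounded Ω) (t : ℝ) :
    IsBounded (dilate t Ω) :=
  hΩ.smul₀ t

theorem norm_le_of_mem_dilate {Ω : Set (Fin 3 → ℝ)} {R t : ℝ} (hR : ∀ v ∈ Ω, ‖v‖ ≤ R)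
    (ht : 0 ≤ t) : ∀ v ∈ dilate t Ω, ‖v‖ ≤ t * R := by
  rintro _ ⟨v, hv, rfl⟩
  rw [norm_smul, Real.norm_of_nonneg ht]
  exact mul_le_mul_of_nonneg_left (hR v hv) ht

theorem abs_sub_le_of_le_cube_mul {a g δ : ℝ} (hδ0 : 0 ≤ δ) (hδ : δ ≤ 1 / 2) (ha0 : 0 ≤ a)
    (hg0 : 0 ≤ g) (ha : a ≤ (1 + δ) ^ 3 * g) (hg : g ≤ (1 + 2 * δ) ^ 3 * a) :
    |a - g| ≤ 56 * δ * g := by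
  have hsq : δ ^ 2 ≤ δ / 2 := by nlinarith
  have hcube : δ ^ 3 ≤ δ / 4 := by nlinarith
  have ha' : a ≤ (1 + 5 * δ) * g := ha.trans (by gcongr; linarith)
  have hg' : g ≤ (1 + 14 * δ) * a := hg.trans (by gcongr; linarith)
  have hfour : a ≤ 4 * g := ha'.trans (by gcongr; linarith)
  rw [abs_le]
  constructor <;> nlinarith [mul_nonneg hδ0 hg0, mul_le_mul_of_nonneg_left hfour hδ0]

theorem abs_volume_real_image_sub_le {X : Type*} {f g : X → Fin 3 → ℝ} {S : Set X} {δ : ℝ}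
    (hδ0 : 0 ≤ δ) (hδ : δ ≤ 1 / 2)
    (h : ∀ x ∈ S, ∀ y ∈ S, ‖(f x - f y) - (g x - g y)‖ ≤ δ * ‖g x - g y‖)
    (hg : volume (g '' S) ≠ ⊤) :
    |volume.real (f '' S) - volume.real (g '' S)| ≤ 56 * δ * volume.real (g '' S) := by
  have hfg : ∀ x ∈ S, ∀ y ∈ S, ‖f x - f y‖ ≤ (1 + δ) * ‖g x - g y‖ := fun x hx y hy => by
    linarith [h x hx y hy, norm_le_norm_sub_add (f x - f y) (g x - g y)]
  have hgf : ∀ x ∈ S, ∀ y ∈ S, ‖g x - g y‖ ≤ (1 + 2 * δ) * ‖f x - f y‖ := fun x hx y hy => by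
    have hlower : (1 - δ) * ‖g x - g y‖ ≤ ‖f x - f y‖ := by
      have htri := norm_le_norm_sub_add (g x - g y) (f x - f y)
      rw [norm_sub_rev (g x - g y)] at htri
      linarith [h x hx y hy]
    calc ‖g x - g y‖ ≤ (1 + 2 * δ) * ((1 - δ) * ‖g x - g y‖) := by
          nlinarith [mul_nonneg (mul_nonneg hδ0 (by linarith : 0 ≤ 1 - 2 * δ))
            (norm_nonneg (g x - g y))]
      _ ≤ (1 + 2 * δ) * ‖f x - f y‖ := by gcongr
  have hf : volume (f '' S) ≠ ⊤ := ne_top_of_le_ne_top (by finiteness)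
    (volume_image_le_of_norm_sub_le (by positivity) hfg)
  exact abs_sub_le_of_le_cube_mul hδ0 hδ measureReal_nonneg measureReal_nonneg
    (volume_real_image_le_of_norm_sub_le (by positivity) hfg hg)
    (volume_real_image_le_of_norm_sub_le (by positivity) hgf hf)

theorem volume_real_image_sub_isBigO {m : ℕ} {F G : (Fin 3 → ℝ) → Fin 3 → ℝ}
    (hFG : ∀ i, VanishOrd (m + 1) fun v _ => F v i - G v i)
    (hG : ∀ i, VanishOrd 1 fun v _ => G v i - v i) {Ω : Set (Fin 3 → ℝ)} (hΩ : IsBounded Ω) :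
    (fun t : ℝ => volume.real (F '' dilate t Ω) - volume.real (G '' dilate t Ω))
      =O[𝓝[>] 0] fun t : ℝ => t ^ (m + 4) := by
  obtain ⟨C, hC0, hC⟩ := (VanishOrd.isBigO_pi hFG).exists_nonneg
  obtain ⟨R, hR0, hR⟩ := hΩ.exists_pos_norm_le
  set δ : ℝ → ℝ := fun t => 2 * C * (2 * R) ^ (m + 1) * t ^ (m + 1)
  have hδ : ∀ᶠ t : ℝ in 𝓝[>] 0, δ t < 1 / 2 := by
    have hcont : Continuous δ := by fun_prop
    exact ((hcont.tendsto' 0 0 (by simp [δ])).mono_left nhdsWithin_le_nhds).eventually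
      (gt_mem_nhds one_half_pos)
  refine IsBigO.of_bound (56 * (2 * C * (2 * R) ^ (m + 1)) * ((3 / 2) ^ 3 * volume.real Ω)) ?_
  filter_upwards [eventually_norm_sub_le_dilate hG hΩ, eventually_forall_dilate_pair hC.bound hΩ,
    hδ, self_mem_nhdsWithin] with t hGt hFGt hδt ht
  have ht0 : (0 : ℝ) < t := ht
  have near : ∀ v ∈ dilate t Ω, ∀ v' ∈ dilate t Ω,
      ‖(F v - F v') - (G v - G v')‖ ≤ δ t * ‖G v - G v'‖ := fun v hv v' hv' => by
    have hsum : ‖v‖ + ‖v'‖ ≤ 2 * R * t := by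
      linarith [norm_le_of_mem_dilate hR ht0.le v hv, norm_le_of_mem_dilate hR ht0.le v' hv']
    have hbound := hFGt v hv v' hv'
    rw [Real.norm_of_nonneg (by positivity)] at hbound
    calc _ ≤ C * ((‖v‖ + ‖v'‖) ^ (m + 1) * ‖v - v'‖) := hbound
      _ ≤ C * ((2 * R * t) ^ (m + 1) * (2 * ‖G v - G v'‖)) := by
          gcongr
          exact (hGt v hv v' hv').2
      _ = δ t * ‖G v - G v'‖ := by simp only [δ]; ring
  have hGlip : ∀ v ∈ dilate t Ω, ∀ v' ∈ dilate t Ω, ‖G v - G v'‖ ≤ 3 / 2 * ‖id v - id v'‖ :=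
    fun v hv v' hv' => (hGt v hv v' hv').1
  have hfin : volume (id '' dilate t Ω) ≠ ⊤ := by
    simpa only [image_id] using (isBounded_dilate hΩ t).measure_lt_top.ne
  have hGfin : volume (G '' dilate t Ω) ≠ ⊤ := ne_top_of_le_ne_top (by finiteness)
    (volume_image_le_of_norm_sub_le (by positivity) hGlip)
  have hGvol := volume_real_image_le_of_norm_sub_le (by positivity) hGlip hfin
  rw [image_id, volume_real_dilate Ω ht0.le, Fintype.card_fin] at hGvol
  rw [Real.norm_eq_abs, Real.norm_of_nonneg (by positivity)]
  calc _ ≤ 56 * δ t * volume.real (G '' dilate t Ω) :=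
        abs_volume_real_image_sub_le (by positivity) hδt.le near hGfin
    _ ≤ 56 * δ t * ((3 / 2) ^ 3 * (t ^ 3 * volume.real Ω)) := by gcongr
    _ = _ := by simp only [δ]; ring

section Homogeneous

variable {E : Type*} [NormedAddCommGroup E] [NormedSpace ℝ E] {f : E → ℝ} {n : ℕ}

theorem isBigO_norm_pow_of_homogeneous [ProperSpace E] (hf : Continuous f)
    (hhom : ∀ (t : ℝ) v, f (t • v) = t ^ n * f v) (l : Filter E) : f =O[l] fun v => ‖v‖ ^ n := by
  obtain ⟨C, hC⟩ := (isCompact_closedBall (0 : E) 1).exists_bound_of_continuousOn hf.continuousOn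
  refine IsBigO.of_bound C (Eventually.of_forall fun v => ?_)
  have hunit : ‖v‖⁻¹ • v ∈ Metric.closedBall (0 : E) 1 := by
    simpa [norm_smul] using inv_mul_le_one (a := ‖v‖)
  have hscale : ‖v‖ • ‖v‖⁻¹ • v = v := by
    obtain rfl | hv := eq_or_ne v 0
    · simp
    · exact smul_inv_smul₀ (norm_ne_zero_iff.mpr hv) v
  rw [← congrArg f hscale, hhom, norm_mul, mul_comm C]
  gcongr
  exact hC _ hunit

theorem setIntegral_dilate_of_homogeneous {f : (Fin 3 → ℝ) → ℝ}
    (hhom : ∀ (t : ℝ) v, f (t • v) = t ^ n * f v) (Ω : Set (Fin 3 → ℝ)) {t : ℝ} (ht : 0 < t) :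
    ∫ v in dilate t Ω, f v = t ^ (n + 3) * ∫ v in Ω, f v := by
  have hcomp := Measure.setIntegral_comp_smul_of_pos (volume : Measure (Fin 3 → ℝ)) f Ω ht
  simp only [hhom, integral_const_mul, Module.finrank_fin_fun, smul_eq_mul] at hcomp
  rw [dilate, image_smul, pow_add, mul_right_comm, hcomp]
  field_simp

end Homogeneous

theorem abs_measureReal_image_sub_le {E : Type*} [NormedAddCommGroup E] [NormedSpace ℝ E]
    [FiniteDimensional ℝ E] [MeasurableSpace E] [BorelSpace E] {μ : Measure E}
    [μ.IsAddHaarMeasure] {S : Set E} (hS : MeasurableSet S) (hfin : μ S ≠ ⊤) {G : E → E}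
    {G' : E → E →L[ℝ] E} {T : E → ℝ} {C : ℝ} (hG : ∀ x ∈ S, HasFDerivWithinAt G (G' x) S x)
    (hinj : InjOn G S) (hpos : ∀ x ∈ S, 0 < (G' x).det)
    (hdet : IntegrableOn (fun x => (G' x).det) S μ) (hT : IntegrableOn T S μ)
    (hbound : ∀ x ∈ S, |(G' x).det - 1 - T x| ≤ C) :
    |μ.real (G '' S) - μ.real S - ∫ x in S, T x ∂μ| ≤ C * μ.real S := by
  have hvol : μ.real (G '' S) = ∫ x in S, (G' x).det ∂μ := by
    have hchange := integral_image_eq_integral_abs_det_fderiv_smul μ hS hG hinj fun _ => (1 : ℝ)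
    simp only [setIntegral_const, smul_eq_mul, mul_one] at hchange
    rw [hchange]
    exact setIntegral_congr_fun hS fun x hx => abs_of_pos (hpos x hx)
  have hone : IntegrableOn (fun _ => (1 : ℝ)) S μ := integrableOn_const hfin
  have hsub : ∫ x in S, ((G' x).det - 1 - T x) ∂μ =
      μ.real (G '' S) - μ.real S - ∫ x in S, T x ∂μ := by
    have hdet1 : IntegrableOn (fun x => (G' x).det - 1) S μ := hdet.sub hone
    rw [integral_sub hdet1 hT, integral_sub hdet hone, hvol, setIntegral_const, smul_eq_mul,
      mul_one]
  rw [← hsub]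
  exact norm_setIntegral_le_of_norm_le_const (f := fun x => (G' x).det - 1 - T x) hfin.lt_top hbound

theorem integrableOn_of_isBounded {E : Type*} [NormedAddCommGroup E] [ProperSpace E]
    [MeasurableSpace E] [OpensMeasurableSpace E] {μ : Measure E} [IsFiniteMeasureOnCompacts μ]
    {f : E → ℝ} (hf : Continuous f) {S : Set E} (hS : IsBounded S) : IntegrableOn f S μ :=
  (hf.continuousOn.integrableOn_compact hS.isCompact_closure).mono_set subset_closure

theorem volume_real_image_dilate_isBigO {Ω : Set (Fin 3 → ℝ)} (hm : MeasurableSet Ω)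
    (hΩ : IsBounded Ω) {G : (Fin 3 → ℝ) → Fin 3 → ℝ}
    {G' : (Fin 3 → ℝ) → (Fin 3 → ℝ) →L[ℝ] Fin 3 → ℝ}
    {T : (Fin 3 → ℝ) → ℝ} (hG : ∀ i, VanishOrd 1 fun v _ => G v i - v i)
    (hG' : ∀ x, HasFDerivAt G (G' x) x) (hdet : Continuous fun x => (G' x).det)
    (hT : Continuous T) (hhom : ∀ (t : ℝ) v, T (t • v) = t ^ 2 * T v)
    (hO : (fun v => (G' v).det - 1 - T v) =O[𝓝 0] fun v => ‖v‖ ^ 4) :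
    (fun t : ℝ => volume.real (G '' dilate t Ω) - t ^ 3 * volume.real Ω
      - t ^ 5 * ∫ v in Ω, T v) =O[𝓝[>] 0] fun t : ℝ => t ^ 7 := by
  obtain ⟨C, hC0, hC⟩ := hO.exists_nonneg
  obtain ⟨R, -, hR⟩ := hΩ.exists_pos_norm_le
  have hdet_pos : ∀ᶠ v in 𝓝 0, 0 < (G' v).det := by
    have hT0 : T 0 = 0 := by simpa using hhom 0 0
    have hdet0 := hC.bound.self_of_nhds
    simp only [hT0, norm_zero, sub_zero, ne_eq, OfNat.ofNat_ne_zero, not_false_eq_true, zero_pow,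
      mul_zero, norm_le_zero_iff, sub_eq_zero] at hdet0
    exact hdet.continuousAt.eventually (lt_mem_nhds (one_pos.trans_eq hdet0.symm))
  refine IsBigO.of_bound (C * R ^ 4 * volume.real Ω) ?_
  filter_upwards [eventually_norm_sub_le_dilate hG hΩ, eventually_forall_dilate hC.bound hΩ,
    eventually_forall_dilate hdet_pos hΩ, self_mem_nhdsWithin] with t hGt hbound hpos ht
  have ht0 : 0 < t := ht
  have hSb := isBounded_dilate hΩ t
  have hinj : InjOn G (dilate t Ω) :=
    injOn_of_norm_sub_le fun v hv v' hv' => (hGt v hv v' hv').2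
  have hexpansion : ∀ v ∈ dilate t Ω, |(G' v).det - 1 - T v| ≤ C * (t * R) ^ 4 := fun v hv => by
    refine (hbound v hv).trans ?_
    rw [norm_pow, norm_norm]
    gcongr
    exact norm_le_of_mem_dilate hR ht0.le v hv
  have himage := abs_measureReal_image_sub_le (μ := volume) (S := dilate t Ω)
    (hm.const_smul₀ t) hSb.measure_lt_top.ne (fun x _ => (hG' x).hasFDerivWithinAt) hinj hpos
    (integrableOn_of_isBounded hdet hSb) (integrableOn_of_isBounded hT hSb) hexpansion
  rw [setIntegral_dilate_of_homogeneous hhom Ω ht0, volume_real_dilate Ω ht0.le] at himage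
  rw [Real.norm_eq_abs, Real.norm_of_nonneg (by positivity)]
  exact himage.trans_eq (by ring)

end Volume

/-! ### Volume expansion of the flattened exponential map -/

/-- A map that carries the volume of the metric with warping function `1 + κ r θ`, whose density is
`cos r / (1 + κ r θ)`, to Lebesgue measure. -/
noncomputable def flatten (κ : ℝ) (x : Fin 3 → ℝ) : Fin 3 → ℝ :=
  ![x 0, x 1, x 2 * (Real.cos (x 0) * (1 + κ * (x 0 * x 1))⁻¹)]

/-- The third-order Taylor polynomial of `flatten κ` composed with the exponential map. -/
noncomputable def flatTaylor (κ : ℝ) (v : Fin 3 → ℝ) : Fin 3 → ℝ :=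
  ![v 0 + cubicForm κ v v 0 / 6, v 1 + cubicForm κ v v 1 / 6,
    v 2 + cubicForm κ v v 2 / 6 - κ * (v 2 * v 0 * v 1) - v 2 * v 0 * v 0 / 2]

theorem flatTaylor_sub_ord (κ : ℝ) (i : Fin 3) :
    VanishOrd 2 fun v _ => flatTaylor κ v i - v i := by
  have hC := VanishOrd.cubicForm_apply (κ := κ) (c := fun v _ => v) (w := fun v _ => v)
    VanishOrd.coord VanishOrd.coord i
  have triple (i j k : Fin 3) : VanishOrd 2 fun (v : Fin 3 → ℝ) (_ : ℝ) => v i * v j * v k :=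
    ((VanishOrd.coord i).mul (VanishOrd.coord j)).mul (VanishOrd.coord k)
  fin_cases i
  · exact (hC.const_mul (1 / 6)).congr fun v _ => by simp [flatTaylor]; ring
  · exact (hC.const_mul (1 / 6)).congr fun v _ => by simp [flatTaylor]; ring
  · exact (((hC.const_mul (1 / 6)).sub ((triple 2 0 1).const_mul κ)).sub
      ((triple 2 0 0).const_mul (1 / 2))).congr fun v _ => by simp [flatTaylor]; ring

namespace VanishOrd

variable {E : Type*} [NormedAddCommGroup E] {f : E → ℝ → ℝ}

theorem cos_sub_one_add_sq (hf : VanishOrd 0 f) :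
    VanishOrd 2 fun v s => Real.cos (f v s) - 1 + f v s ^ 2 / 2 := by
  have hderiv (x : ℝ) :
      HasDerivAt (fun x => Real.cos x - 1 + x ^ 2 / 2) (-Real.sin x + x) x :=
    (((Real.hasDerivAt_cos x).sub_const 1).fun_add
      ((hasDerivAt_pow 2 x).div_const 2)).congr_deriv (by simp)
  have hderivO : (fun x => -Real.sin x + x) =O[𝓝 0] fun x => |x| ^ 2 := by
    have hpair : Tendsto (fun x : ℝ => (x, (0 : ℝ))) (𝓝 0) (𝓝 0) :=
      (continuous_id.prodMk continuous_const).tendsto' _ _ rfl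
    have hsin := isBigO_sub_of_deriv_eq_zero (h := fun x => -Real.sin x + x)
      (Real.contDiff_sin.neg.add contDiff_id).contDiffAt (by simp)
    exact (hsin.comp_tendsto hpair).congr (fun x => by simp) fun x => by simp [pow_two]
  exact (comp (h := fun x => Real.cos x - 1 + x ^ 2 / 2) (by simp)
    (isBigO_sub_of_deriv (Eventually.of_forall hderiv) hderivO) hf).mono (by lia)

theorem inv_one_add_sub_one_add (hf : VanishOrd 1 f) :
    VanishOrd 3 fun v s => (1 + f v s)⁻¹ - 1 + f v s := by
  have hsmooth : ContDiffAt ℝ 2 (fun x : ℝ => (1 + x)⁻¹ - 1 + x) 0 :=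
    (((contDiffAt_const.add contDiffAt_id).inv (by simp)).sub contDiffAt_const).add contDiffAt_id
  have hderiv : HasDerivAt (fun x : ℝ => (1 + x)⁻¹ - 1 + x) 0 0 := by
    simpa using ((((hasDerivAt_id' (0 : ℝ)).const_add 1).fun_inv (by simp)).sub_const 1).fun_add
      (hasDerivAt_id' 0)
  exact (comp (h := fun x => (1 + x)⁻¹ - 1 + x) (by simp)
    (isBigO_sub_of_deriv_eq_zero hsmooth hderiv.deriv) hf).mono (by lia)

end VanishOrd

theorem IsModelFlow.flatten_sub_ord {κ : ℝ} {c w : (Fin 3 → ℝ) → ℝ → Fin 3 → ℝ}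
    (h : IsModelFlow κ c w) (i : Fin 3) :
    VanishOrd 3 fun v _ => flatten κ (c v 1) i - flatTaylor κ v i := by
  have expansion := (h.pos_expansion i).eval_one
  have pos (i : Fin 3) := (h.pos_ord i).eval_one
  have pos_sub (i : Fin 3) : VanishOrd 2 fun v _ => c v 1 i - v i :=
    (h.pos_sub_ord i).eval_one.congr fun v _ => by ring
  have triple_sub (i j k : Fin 3) : VanishOrd 3 fun v (_ : ℝ) =>
      c v 1 i * c v 1 j * c v 1 k - v i * v j * v k :=
    (VanishOrd.mul_mul_sub_mul_mul (pos j) (pos k) (VanishOrd.coord i) (VanishOrd.coord j)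
      (pos_sub i) (pos_sub j) (pos_sub k)).mono (by lia)
  have warp_sub_one := ((pos 0).mul (pos 1)).const_mul κ
  have cos_taylor := (pos 0).cos_sub_one_add_sq
  have cos_sub_one := (((pos 0).mul (pos 0)).const_mul (-1 / 2)).add (cos_taylor.mono (m := 1)
    (by lia))
  fin_cases i
  · exact expansion.congr fun v _ => by simp [flatten, flatTaylor]; ring
  · exact expansion.congr fun v _ => by simp [flatten, flatTaylor]; ring
  · refine (((((expansion.sub ((triple_sub 2 0 0).const_mul (1 / 2))).sub
      ((triple_sub 2 0 1).const_mul κ)).add ((pos 2).mul_le cos_taylor (by lia))).add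
      ((pos 2).mul_le warp_sub_one.inv_one_add_sub_one_add (by lia))).add
      (((pos 2).mul cos_sub_one).mul_le warp_sub_one.inv_one_add_sub_one (by lia))).congr
      fun v _ => ?_
    simp [flatten, flatTaylor]
    ring

section

open MeasureTheory Asymptotics
open Bornology (IsBounded)

/-- The derivative of `flatTaylor κ` is `1 + flatMatrix κ v`. -/
noncomputable def flatMatrix (κ : ℝ) (v : Fin 3 → ℝ) : Matrix (Fin 3) (Fin 3) ℝ :=
  !![κ * (v 0 * v 1) - v 1 * v 1 / 6,
      (3 * κ * (v 0 * v 0) - 3 * κ * (v 1 * v 1) - 2 * (v 0 * v 1) + κ * (v 2 * v 2)) / 6,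
      κ * (v 1 * v 2) / 3;
    (-3 * κ * (v 0 * v 0) + 3 * κ * (v 1 * v 1) + 4 * (v 0 * v 1) + κ * (v 2 * v 2)) / 6,
      κ * (v 0 * v 1) + v 0 * v 0 / 3,
      κ * (v 0 * v 2) / 3;
    -(5 / 3) * κ * (v 1 * v 2) - v 0 * v 2,
      -(5 / 3) * κ * (v 0 * v 2),
      -(5 / 3) * κ * (v 0 * v 1) - v 0 * v 0 / 2]

theorem continuous_flatMatrix (κ : ℝ) : Continuous (flatMatrix κ) := by
  refine continuous_matrix fun i j => ?_
  fin_cases i <;> fin_cases j <;>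
    simp only [flatMatrix, Matrix.of_apply, Matrix.cons_val, Fin.zero_eta, Fin.mk_one,
      Fin.reduceFinMk, Fin.isValue] <;> fun_prop

theorem flatMatrix_smul (κ t : ℝ) (v : Fin 3 → ℝ) :
    flatMatrix κ (t • v) = t ^ 2 • flatMatrix κ v := by
  ext i j
  fin_cases i <;> fin_cases j <;> simp [flatMatrix] <;> ring

/-- The trace of `flatMatrix κ v`. -/
noncomputable def flatTrace (κ : ℝ) (v : Fin 3 → ℝ) : ℝ :=
  κ / 3 * (v 0 * v 1) - (v 0 ^ 2 + v 1 ^ 2) / 6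

theorem trace_flatMatrix (κ : ℝ) (v : Fin 3 → ℝ) : (flatMatrix κ v).trace = flatTrace κ v := by
  simp [flatTrace, flatMatrix, Matrix.trace_fin_three]
  ring

theorem continuous_flatTrace (κ : ℝ) : Continuous (flatTrace κ) := by
  unfold flatTrace
  fun_prop

theorem flatTrace_smul (κ t : ℝ) (v : Fin 3 → ℝ) :
    flatTrace κ (t • v) = t ^ 2 * flatTrace κ v := by
  simp [← trace_flatMatrix, flatMatrix_smul]

theorem hasFDerivAt_of_rows {ι ι' : Type*} [Fintype ι] [DecidableEq ι] [Finite ι']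
    {f : (ι → ℝ) → ι' → ℝ} {M : Matrix ι' ι ℝ} {x : ι → ℝ}
    (h : ∀ i, ∃ L : (ι → ℝ) →L[ℝ] ℝ, HasFDerivAt (fun y => f y i) L x ∧
      ∀ v, L v = ∑ j, M i j * v j) :
    HasFDerivAt f M.toLin'.toContinuousLinearMap x := by
  have := Fintype.ofFinite ι'
  refine hasFDerivAt_pi'.mpr fun i => ?_
  obtain ⟨L, hL, hv⟩ := h i
  refine hL.congr_fderiv ?_
  ext1 v
  simp [hv, Matrix.toLin'_apply, Matrix.mulVec, dotProduct]

theorem hasFDerivAt_flatTaylor (κ : ℝ) (x : Fin 3 → ℝ) :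
    HasFDerivAt (flatTaylor κ) (1 + flatMatrix κ x).toLin'.toContinuousLinearMap x := by
  have hx := fun i => hasFDerivAt_coord i x
  have triple (i j k : Fin 3) := ((hx i).fun_mul (hx j)).fun_mul (hx k)
  refine hasFDerivAt_of_rows fun i => ?_
  simp only [Fin.sum_univ_three]
  fin_cases i
  · have e := (hx 0).fun_add ((((((triple 0 0 1).const_mul (3 * κ)).fun_sub
      ((triple 1 1 1).const_mul κ)).fun_sub (triple 0 1 1)).fun_add
      ((triple 1 2 2).const_mul κ)).const_mul (1 / 6))
    refine ⟨_, e.congr_of_eventuallyEq (Eventually.of_forall fun v => ?_), fun v => ?_⟩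
    · simp [flatTaylor, cubicForm]; ring
    · simp [flatMatrix]; ring
  · have e := (hx 1).fun_add ((((((triple 0 1 1).const_mul (3 * κ)).fun_sub
      ((triple 0 0 0).const_mul κ)).fun_add ((triple 0 0 1).const_mul 2)).fun_add
      ((triple 0 2 2).const_mul κ)).const_mul (1 / 6))
    refine ⟨_, e.congr_of_eventuallyEq (Eventually.of_forall fun v => ?_), fun v => ?_⟩
    · simp [flatTaylor, cubicForm]; ring
    · simp [flatMatrix]; ring
  · have e := ((hx 2).fun_sub ((triple 2 0 1).const_mul (5 / 3 * κ))).fun_sub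
      ((triple 2 0 0).const_mul (1 / 2))
    refine ⟨_, e.congr_of_eventuallyEq (Eventually.of_forall fun v => ?_), fun v => ?_⟩
    · simp [flatTaylor, cubicForm]; ring
    · simp [flatMatrix]; ring

theorem det_one_add_sub_one_sub_trace_isBigO {X : Type*} {l : Filter X}
    {M : X → Matrix (Fin 3) (Fin 3) ℝ} {g : X → ℝ} (hM : ∀ i j, (fun x => M x i j) =O[l] g)
    (hg : g =O[l] fun _ => (1 : ℝ)) :
    (fun x => (1 + M x).det - 1 - (M x).trace) =O[l] fun x => g x ^ 2 := by
  have quad (i j k m : Fin 3) : (fun x => M x i j * M x k m) =O[l] fun x => g x ^ 2 :=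
    ((hM i j).mul (hM k m)).congr_right fun x => by ring
  have cubic (i j k m n p : Fin 3) :
      (fun x => M x i j * M x k m * M x n p) =O[l] fun x => g x ^ 2 :=
    ((quad i j k m).mul ((hM n p).trans hg)).congr_right fun x => by ring
  have quads := ((((quad 0 0 1 1).add (quad 0 0 2 2)).add (quad 1 1 2 2)).sub
    (quad 0 1 1 0)).sub ((quad 0 2 2 0).add (quad 1 2 2 1))
  have cubics := (((((cubic 0 0 1 1 2 2).sub (cubic 0 0 1 2 2 1)).sub (cubic 0 1 1 0 2 2)).add
    (cubic 0 1 1 2 2 0)).add (cubic 0 2 1 0 2 1)).sub (cubic 0 2 1 1 2 0)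
  refine (quads.add cubics).congr_left fun x => ?_
  simp [Matrix.det_fin_three, Matrix.trace_fin_three]
  ring

theorem det_one_add_flatMatrix_sub_isBigO (κ : ℝ) :
    (fun v => (1 + flatMatrix κ v).det - 1 - flatTrace κ v) =O[𝓝 0] fun v => ‖v‖ ^ 4 := by
  have entry (i j : Fin 3) : (fun v => flatMatrix κ v i j) =O[𝓝 0] fun v => ‖v‖ ^ 2 :=
    isBigO_norm_pow_of_homogeneous ((continuous_flatMatrix κ).matrix_elem i j)
      (fun t v => by simp [flatMatrix_smul]) _
  have hbounded : (fun v : Fin 3 → ℝ => ‖v‖ ^ 2) =O[𝓝 0] fun _ => (1 : ℝ) :=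
    (by fun_prop : Continuous fun v : Fin 3 → ℝ => ‖v‖ ^ 2).continuousAt.isBigO_one ℝ
  exact (det_one_add_sub_one_sub_trace_isBigO entry hbounded).congr
    (fun v => by rw [trace_flatMatrix]) fun v => by ring

theorem IsModelFlow.volume_real_flatten_image {κ : ℝ} {c w : (Fin 3 → ℝ) → ℝ → Fin 3 → ℝ}
    (h : IsModelFlow κ c w) {Ω : Set (Fin 3 → ℝ)} (hm : MeasurableSet Ω) (hΩ : IsBounded Ω) :
    (fun t : ℝ => volume.real ((fun v => flatten κ (c v 1)) '' dilate t Ω)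
      - t ^ 3 * volume.real Ω - t ^ 5 * ∫ v in Ω, flatTrace κ v)
      =O[𝓝[>] 0] fun t : ℝ => t ^ 6 := by
  have near_id (i : Fin 3) : VanishOrd 1 fun v _ => flatTaylor κ v i - v i :=
    (flatTaylor_sub_ord κ i).mono (by lia)
  have hdet (x : Fin 3 → ℝ) : (1 + flatMatrix κ x).toLin'.toContinuousLinearMap.det
      = (1 + flatMatrix κ x).det := by
    rw [LinearMap.det_toContinuousLinearMap, LinearMap.det_toLin']
  have hcont : Continuous fun x => (1 + flatMatrix κ x).det :=
    (continuous_const.add (continuous_flatMatrix κ)).matrix_det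
  have htaylor := volume_real_image_dilate_isBigO hm hΩ near_id (hasFDerivAt_flatTaylor κ)
    (by simpa only [hdet] using hcont) (continuous_flatTrace κ) (flatTrace_smul κ)
    (by simpa only [hdet] using det_one_add_flatMatrix_sub_isBigO κ)
  have hpow : (fun t : ℝ => t ^ 7) =O[𝓝[>] 0] fun t => t ^ 6 :=
    (isLittleO_pow_pow (by norm_num)).isBigO.mono nhdsWithin_le_nhds
  exact ((volume_real_image_sub_isBigO h.flatten_sub_ord near_id hΩ).add
    (htaylor.trans hpow)).congr_left fun t => by ring

end

/-! ### The Riemannian volume of the image of the exponential map -/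

section

open MeasureTheory
open scoped Pointwise
open Bornology (IsBounded)

theorem injOn_expI : InjOn (fun θ : ℝ => Complex.exp (θ * Complex.I)) (Ioc (-Real.pi) Real.pi) := by
  intro x hx y hy h
  simp only [Complex.exp_mul_I] at h
  rw [← Complex.arg_cos_add_sin_mul_I hx, ← Complex.arg_cos_add_sin_mul_I hy, h]

theorem injOn_polarParam : InjOn polarParam polarBox := by
  rintro x ⟨hx0, hx1, hx2⟩ y ⟨hy0, hy1, hy2⟩ h
  obtain ⟨hsphere, hcircle⟩ := Prod.mk.inj h
  have hcoord (i : Fin 3) := congrArg (fun p : EuclideanSpace ℝ (Fin 3) => p i) hsphere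
  have h0 : x 0 = y 0 := Real.injOn_sin ⟨hx0.1.le, hx0.2.le⟩ ⟨hy0.1.le, hy0.2.le⟩ (hcoord 2)
  have hc := (Real.cos_pos_of_mem_Ioo hy0).ne'
  have hcos : Real.cos (x 1) = Real.cos (y 1) := mul_left_cancel₀ hc (h0 ▸ hcoord 0)
  have hsin : Real.sin (x 1) = Real.sin (y 1) := mul_left_cancel₀ hc (h0 ▸ hcoord 1)
  have h1 : x 1 = y 1 := injOn_expI hx1 hy1 (by
    simp only [Complex.exp_mul_I, ← Complex.ofReal_cos, ← Complex.ofReal_sin, hcos, hsin])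
  have h2 : x 2 = y 2 := injOn_expI hx2 hy2 hcircle
  ext i
  fin_cases i <;> assumption

theorem riemVol_image_polarParam (α k : ℝ) (b : ℝ → ℝ) (χ : ℝ × ℝ → ℝ) {B : Set (Fin 3 → ℝ)}
    (hB : B ⊆ polarBox) : riemVol α k b χ (polarParam '' B) =
      ∫⁻ x in B, ENNReal.ofReal (√ (metricMatrix α k b χ polarParam x).det) := by
  rw [riemVol, inter_comm, injOn_polarParam.preimage_image_inter hB]

theorem sqrt_det_metricMatrix_polarParam {α k : ℝ} {b : ℝ → ℝ} {χ : ℝ × ℝ → ℝ} {x : Fin 3 → ℝ}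
    (hc : 0 ≤ Real.cos (x 0)) (hwarp : 0 < warp α k b χ (polarParam x).1) :
    √ (metricMatrix α k b χ polarParam x).det =
      Real.cos (x 0) * (warp α k b χ (polarParam x).1)⁻¹ := by
  rw [metricMatrix_polarParam, Matrix.det_diagonal, Fin.prod_univ_three, ← Real.sqrt_sq
    (by positivity : 0 ≤ Real.cos (x 0) * (warp α k b χ (polarParam x).1)⁻¹)]
  congr 1
  simp only [Matrix.cons_val]
  field_simp

section Flatten

variable {κ : ℝ}

theorem exists_hasFDerivAt_flatten {x : Fin 3 → ℝ} (h : 1 + κ * (x 0 * x 1) ≠ 0) :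
    ∃ F' : (Fin 3 → ℝ) →L[ℝ] Fin 3 → ℝ, HasFDerivAt (flatten κ) F' x ∧
      F'.det = Real.cos (x 0) * (1 + κ * (x 0 * x 1))⁻¹ := by
  have hx := fun i => hasFDerivAt_coord i x
  have hwarp := (((hx 0).fun_mul (hx 1)).const_mul κ).const_add 1
  have hheight := (hx 2).fun_mul ((hx 0).cos.fun_mul ((hasDerivAt_inv h).comp_hasFDerivAt x hwarp))
  set p := -x 2 * (Real.sin (x 0) * (1 + κ * (x 0 * x 1))⁻¹
    + Real.cos (x 0) * ((1 + κ * (x 0 * x 1)) ^ 2)⁻¹ * (κ * x 1))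
  set q := -x 2 * Real.cos (x 0) * ((1 + κ * (x 0 * x 1)) ^ 2)⁻¹ * (κ * x 0)
  refine ⟨_, hasFDerivAt_of_rows
    (M := !![1, 0, 0; 0, 1, 0; p, q, Real.cos (x 0) * (1 + κ * (x 0 * x 1))⁻¹]) fun i => ?_, ?_⟩
  · simp only [Fin.sum_univ_three]
    fin_cases i
    · exact ⟨_, hx 0, fun v => by simp⟩
    · exact ⟨_, hx 1, fun v => by simp⟩
    · exact ⟨_, hheight, fun v => by simp [p, q]; ring⟩
  · rw [LinearMap.det_toContinuousLinearMap, LinearMap.det_toLin', Matrix.det_fin_three]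
    simp

theorem injOn_flatten :
    InjOn (flatten κ) {x | Real.cos (x 0) ≠ 0 ∧ 1 + κ * (x 0 * x 1) ≠ 0} := by
  rintro x - y ⟨hc, hwarp⟩ h
  have h0 : x 0 = y 0 := congrFun h 0
  have h1 : x 1 = y 1 := congrFun h 1
  have h2 : x 2 * (Real.cos (x 0) * (1 + κ * (x 0 * x 1))⁻¹) =
      y 2 * (Real.cos (y 0) * (1 + κ * (y 0 * y 1))⁻¹) := congrFun h 2
  rw [h0, h1] at h2
  have h2' := mul_right_cancel₀ (mul_ne_zero hc (inv_ne_zero hwarp)) h2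
  ext i
  fin_cases i <;> assumption

theorem volume_flatten_image {B : Set (Fin 3 → ℝ)} (hm : MeasurableSet B)
    (hcos : ∀ x ∈ B, 0 < Real.cos (x 0)) (hwarp : ∀ x ∈ B, 0 < 1 + κ * (x 0 * x 1)) :
    volume (flatten κ '' B) =
      ∫⁻ x in B, ENNReal.ofReal (Real.cos (x 0) * (1 + κ * (x 0 * x 1))⁻¹) := by
  choose! F' hF' hdet using fun x hx => exists_hasFDerivAt_flatten (κ := κ) (hwarp x hx).ne'
  have hB : B ⊆ {x | Real.cos (x 0) ≠ 0 ∧ 1 + κ * (x 0 * x 1) ≠ 0} :=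
    fun x hx => ⟨(hcos x hx).ne', (hwarp x hx).ne'⟩
  rw [← lintegral_abs_det_fderiv_eq_addHaar_image volume hm
    (fun x hx => (hF' x hx).hasFDerivWithinAt) (injOn_flatten.mono hB)]
  refine setLIntegral_congr_fun hm fun x hx => ?_
  have := hcos x hx
  have := hwarp x hx
  rw [hdet x hx, abs_of_nonneg (by positivity)]

end Flatten

variable {α k σ : ℝ} {b : ℝ → ℝ} {χ : ℝ × ℝ → ℝ}

theorem mem_polarBox_of_mem_unitRegion {x : Fin 3 → ℝ} (hx : x ∈ unitRegion σ α k)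
    (h2 : |x 2| < Real.pi) : x ∈ polarBox := by
  obtain ⟨h0, h1⟩ := abs_lt_quarter_of_mem_unitRegion hx
  have hpi := Real.pi_gt_three
  have h0 := abs_lt.mp h0
  have h1 := abs_lt.mp h1
  have h2 := abs_lt.mp h2
  refine ⟨⟨?_, ?_⟩, ⟨?_, ?_⟩, h2.1, h2.2.le⟩ <;> linarith

theorem lintegral_sqrt_det_eq_volume_flatten_image (hα : 0 < α) (hb : IsTransition b)
    (hχ : IsPlaneCutoff χ) (hσ : σ = 1 ∨ σ = -1) {B : Set (Fin 3 → ℝ)} (hm : MeasurableSet B)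
    (hB : B ⊆ unitRegion σ α k) :
    ∫⁻ x in B, ENNReal.ofReal (√ (metricMatrix α k b χ polarParam x).det) =
      volume (flatten (k * σ) '' B) := by
  have hwarp : ∀ x ∈ B, 0 < 1 + k * σ * (x 0 * x 1) := fun x hx => by
    linarith [one_add_ge_of_mem_unitRegion hα hb hχ hσ (hB hx)]
  rw [volume_flatten_image hm (fun x hx => cos_pos_of_mem_unitRegion (hB hx)) hwarp]
  refine setLIntegral_congr_fun hm fun x hx => ?_
  have heq : warp α k b χ (polarParam x).1 = 1 + k * σ * (x 0 * x 1) :=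
    (warp_eventuallyEq_of_mem_unitRegion hα hb hχ hσ (hB hx)).self_of_nhds
  rw [sqrt_det_metricMatrix_polarParam (cos_pos_of_mem_unitRegion (hB hx)).le
    (heq ▸ hwarp x hx), heq]

theorem riemVol_polarParam_image_union (hα : 0 < α) (hb : IsTransition b) (hχ : IsPlaneCutoff χ)
    {B B' : Set (Fin 3 → ℝ)} (hm : MeasurableSet B) (hm' : MeasurableSet B')
    (hB : B ⊆ unitRegion 1 α k ∩ polarBox) (hB' : B' ⊆ unitRegion (-1) α k ∩ polarBox) :
    riemVol α k b χ (polarParam '' (B ∪ B')) =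
      volume (flatten (k * 1) '' B) + volume (flatten (k * (-1)) '' B') := by
  obtain ⟨hregion, hbox⟩ := subset_inter_iff.mp hB
  obtain ⟨hregion', hbox'⟩ := subset_inter_iff.mp hB'
  have hdisj : Disjoint B B' := Set.disjoint_left.mpr fun x hx hx' => by
    linarith [(hregion hx).1, (hregion' hx').1]
  rw [riemVol_image_polarParam α k b χ (union_subset hbox hbox'), lintegral_union hm' hdisj,
    lintegral_sqrt_det_eq_volume_flatten_image hα hb hχ (Or.inl rfl) hm hregion,
    lintegral_sqrt_det_eq_volume_flatten_image hα hb hχ (Or.inr rfl) hm' hregion']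

theorem expAt_eq {v : Fin 3 → ℝ} {c w : ℝ → Fin 3 → ℝ} (h : IsGeodesicFrom α k b χ v c w)
    (hunique : ∀ c' w', IsGeodesicFrom α k b χ v c' w' → EqOn c c' (Icc 0 1)) :
    expAt α k b χ v = polarParam (c 1) := by
  have hex : ∃ c : ℝ → Fin 3 → ℝ, ∃ w, IsGeodesicFrom α k b χ v c w := ⟨c, w, h⟩
  rw [expAt, dif_pos hex]
  obtain ⟨w', hw'⟩ := hex.choose_spec
  rw [hunique _ w' hw' (by simp)]

section Endpoints

variable {G : (Fin 3 → ℝ) → Fin 3 → ℝ} {Ω : Set (Fin 3 → ℝ)}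

theorem eventually_measurableSet_image_dilate (hG : ∀ i, VanishOrd 1 fun v _ => G v i - v i)
    (hm : MeasurableSet Ω) (hΩ : IsBounded Ω) :
    ∀ᶠ t : ℝ in 𝓝[>] 0, MeasurableSet (G '' dilate t Ω) := by
  filter_upwards [eventually_norm_sub_le_dilate hG hΩ] with t ht
  have hLip : LipschitzOnWith (3 / 2) G (dilate t Ω) :=
    LipschitzOnWith.of_dist_le_mul fun v hv v' hv' => by
      simpa [dist_eq_norm] using (ht v hv v' hv').1
  exact (hm.const_smul₀ t).image_of_continuousOn_injOn hLip.continuousOn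
    (injOn_of_norm_sub_le fun v hv v' hv' => (ht v hv v' hv').2)

theorem eventually_volume_image_dilate_ne_top (hG : ∀ i, VanishOrd 1 fun v _ => G v i - v i)
    (hΩ : IsBounded Ω) : ∀ᶠ t : ℝ in 𝓝[>] 0, volume (G '' dilate t Ω) ≠ ⊤ := by
  filter_upwards [eventually_norm_sub_le_dilate hG hΩ] with t ht
  have hle := volume_image_le_of_norm_sub_le (f := G) (g := id) (K := 3 / 2) (by positivity)
    fun v hv v' hv' => (ht v hv v' hv').1
  rw [image_id] at hle
  exact ne_top_of_le_ne_top
    (ENNReal.mul_ne_top (by finiteness) (isBounded_dilate hΩ t).measure_lt_top.ne) hle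

end Endpoints

end

/-! ### The wedge -/

section

open MeasureTheory
open Bornology (IsBounded)

variable {α σ ρ₀ : ℝ}

theorem isBounded_wedgePart (σ α ρ₀ : ℝ) : IsBounded (wedgePart σ α ρ₀) := by
  refine isBounded_iff_forall_norm_le.mpr ⟨ρ₀, fun v ⟨hr, _, _, _, hz⟩ => ?_⟩
  have hρ : 0 ≤ ρ₀ := (Real.sqrt_nonneg _).trans hr
  have hsqrt : √3 ≤ 2 := Real.sqrt_le_iff.mpr (by norm_num)
  refine (pi_norm_le_iff_of_nonneg hρ).mpr fun i => ?_
  rw [Real.norm_eq_abs]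
  fin_cases i
  · exact (Real.abs_le_sqrt (le_add_of_nonneg_right (sq_nonneg _))).trans hr
  · exact (Real.abs_le_sqrt (le_add_of_nonneg_left (sq_nonneg _))).trans hr
  · exact (abs_lt.mpr hz).le.trans (mul_le_of_le_one_left hρ (by linarith))

theorem measurableSet_wedgePart (σ α ρ₀ : ℝ) : MeasurableSet (wedgePart σ α ρ₀) := by
  have hcoord (i : Fin 3) : Measurable fun v : Fin 3 → ℝ => v i := measurable_pi_apply i
  have habs (i : Fin 3) : Measurable fun v : Fin 3 → ℝ => |v i| := (hcoord i).abs
  have hnorm : Measurable fun v : Fin 3 → ℝ => √(v 0 ^ 2 + v 1 ^ 2) := by fun_prop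
  have hprod : Measurable fun v : Fin 3 → ℝ => σ * (v 0 * v 1) := by fun_prop
  exact (measurableSet_le hnorm measurable_const).inter
    ((measurableSet_lt measurable_const hprod).inter
      ((measurableSet_le ((habs 0).const_mul α) (habs 1)).inter
        ((measurableSet_le (habs 1) ((habs 0).const_mul (1 / α))).inter
          (hcoord 2 measurableSet_Ioo))))

theorem disjoint_wedgePart (α ρ₀ : ℝ) : Disjoint (wedgePart 1 α ρ₀) (wedgePart (-1) α ρ₀) :=
  Set.disjoint_left.mpr fun _ hv hv' => by linarith [hv.2.1, hv'.2.1]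

theorem volume_real_wedge (α ρ₀ : ℝ) : volume.real (wedge α ρ₀) =
    volume.real (wedgePart 1 α ρ₀) + volume.real (wedgePart (-1) α ρ₀) :=
  measureReal_union (disjoint_wedgePart α ρ₀) (measurableSet_wedgePart _ _ _)
    (isBounded_wedgePart _ _ _).measure_lt_top.ne (isBounded_wedgePart _ _ _).measure_lt_top.ne

theorem dilate_wedgePart_subset_planeCone (hα : 0 < α) {t : ℝ} (ht : 0 < t) :
    dilate t (wedgePart σ α ρ₀) ⊆ planeCone σ α := by
  rintro _ ⟨v, ⟨-, hpos, hlower, hupper, -⟩, rfl⟩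
  rw [one_div_mul_eq_div, le_div_iff₀' hα] at hupper
  have hscale : σ * ((t • v) 0 * (t • v) 1) = t ^ 2 * (σ * (v 0 * v 1)) := by
    simp only [Pi.smul_apply, smul_eq_mul]
    ring
  refine ⟨hscale ▸ by positivity, ?_, ?_⟩ <;>
    simp only [Pi.smul_apply, smul_eq_mul, abs_mul, abs_of_pos ht, mul_left_comm α t] <;>
    gcongr

variable {k : ℝ} {b : ℝ → ℝ} {χ : ℝ × ℝ → ℝ} {c w c' w' : (Fin 3 → ℝ) → ℝ → Fin 3 → ℝ}

namespace IsModelFlow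

theorem eventually_isGeodesicFrom_wedgePart (h : IsModelFlow (k * σ) c w) (hα : 0 < α)
    (hα1 : α < 1) (hb : IsTransition b) (hχ : IsPlaneCutoff χ) (hσ : σ = 1 ∨ σ = -1) (ρ₀ : ℝ) :
    ∀ᶠ t : ℝ in 𝓝[>] 0, ∀ v ∈ dilate t (wedgePart σ α ρ₀), c v 1 ∈ unitRegion σ α k ∧
      IsGeodesicFrom α k b χ v (c v) (w v) ∧
      ∀ c' w', IsGeodesicFrom α k b χ v c' w' → EqOn (c v) c' (Icc 0 1) := by
  filter_upwards [eventually_forall_dilate (h.eventually_isGeodesicFrom hα hα1 hb hχ hσ)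
    (isBounded_wedgePart σ α ρ₀), self_mem_nhdsWithin]
    with t hgeod ht v hv using hgeod v hv (dilate_wedgePart_subset_planeCone hα ht hv)

theorem eventually_existsUnique_geodesic (h : IsModelFlow (k * σ) c w) (hα : 0 < α)
    (hα1 : α < 1) (hb : IsTransition b) (hχ : IsPlaneCutoff χ) (hσ : σ = 1 ∨ σ = -1) (ρ₀ : ℝ) :
    ∀ᶠ t : ℝ in 𝓝[>] 0, ∀ v ∈ dilate t (wedgePart σ α ρ₀),
      (∃ c w, IsGeodesicFrom α k b χ v c w) ∧
      ∀ c w c' w', IsGeodesicFrom α k b χ v c w → IsGeodesicFrom α k b χ v c' w' →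
        EqOn c c' (Icc 0 1) :=
  (h.eventually_isGeodesicFrom_wedgePart hα hα1 hb hχ hσ ρ₀).mono fun _ ht v hv =>
    have ⟨_, hgeod, hunique⟩ := ht v hv
    ⟨⟨_, _, hgeod⟩, fun c w c' w' hcw hcw' => (hunique c w hcw).symm.trans (hunique c' w' hcw')⟩

theorem endpoint_sub_ord {κ : ℝ} (h : IsModelFlow κ c w) (i : Fin 3) :
    VanishOrd 1 fun v _ => c v 1 i - v i :=
  ((h.pos_sub_ord i).eval_one.mono (by lia)).congr fun v _ => by ring

theorem flatten_endpoint_sub_ord {κ : ℝ} (h : IsModelFlow κ c w) (i : Fin 3) :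
    VanishOrd 1 fun v _ => flatten κ (c v 1) i - v i :=
  (((h.flatten_sub_ord i).mono (by lia)).add ((flatTaylor_sub_ord κ i).mono (by lia))).congr
    fun v _ => by ring

theorem eventually_expAt_image_wedgePart (h : IsModelFlow (k * σ) c w) (hα : 0 < α)
    (hα1 : α < 1) (hb : IsTransition b) (hχ : IsPlaneCutoff χ) (hσ : σ = 1 ∨ σ = -1) (ρ₀ : ℝ) :
    ∀ᶠ t : ℝ in 𝓝[>] 0, expAt α k b χ '' dilate t (wedgePart σ α ρ₀) =
        polarParam '' ((fun v => c v 1) '' dilate t (wedgePart σ α ρ₀)) ∧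
      MeasurableSet ((fun v => c v 1) '' dilate t (wedgePart σ α ρ₀)) ∧
      (fun v => c v 1) '' dilate t (wedgePart σ α ρ₀) ⊆ unitRegion σ α k ∩ polarBox := by
  have hbounded := isBounded_wedgePart σ α ρ₀
  filter_upwards [h.eventually_isGeodesicFrom_wedgePart hα hα1 hb hχ hσ ρ₀,
    eventually_measurableSet_image_dilate h.endpoint_sub_ord (measurableSet_wedgePart _ _ _)
      hbounded,
    eventually_forall_dilate ((h.pos_ord 2).eventually_abs_lt Real.pi_pos) hbounded]
    with t hgeod hm hheight
  refine ⟨?_, hm, image_subset_iff.mpr fun v hv => ⟨(hgeod v hv).1,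
    mem_polarBox_of_mem_unitRegion (hgeod v hv).1 (hheight v hv 1 (by simp))⟩⟩
  rw [image_image]
  exact image_congr fun v hv => expAt_eq (hgeod v hv).2.1 (hgeod v hv).2.2

end IsModelFlow

theorem eventually_riemVol_exp_wedge (h : IsModelFlow (k * 1) c w)
    (h' : IsModelFlow (k * (-1)) c' w') (hα : 0 < α) (hα1 : α < 1) (hb : IsTransition b)
    (hχ : IsPlaneCutoff χ) (ρ₀ : ℝ) :
    ∀ᶠ t : ℝ in 𝓝[>] 0, (riemVol α k b χ (expAt α k b χ '' dilate t (wedge α ρ₀))).toReal =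
      volume.real ((fun v => flatten (k * 1) (c v 1)) '' dilate t (wedgePart 1 α ρ₀)) +
      volume.real ((fun v => flatten (k * (-1)) (c' v 1)) '' dilate t (wedgePart (-1) α ρ₀)) := by
  filter_upwards [h.eventually_expAt_image_wedgePart hα hα1 hb hχ (Or.inl rfl) ρ₀,
    h'.eventually_expAt_image_wedgePart hα hα1 hb hχ (Or.inr rfl) ρ₀,
    eventually_volume_image_dilate_ne_top h.flatten_endpoint_sub_ord (isBounded_wedgePart 1 α ρ₀),
    eventually_volume_image_dilate_ne_top h'.flatten_endpoint_sub_ord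
      (isBounded_wedgePart (-1) α ρ₀)]
    with t ⟨hexp, hm, hsub⟩ ⟨hexp', hm', hsub'⟩ hfin hfin'
  rw [wedge, dilate, image_union, image_union, ← dilate, ← dilate, hexp, hexp', ← image_union,
    riemVol_polarParam_image_union hα hb hχ hm hm' hsub hsub', image_image, image_image,
    ENNReal.toReal_add hfin hfin', measureReal_def, measureReal_def]

end

/-! ### The fifth-order coefficient -/

section

open MeasureTheory

theorem mem_pi_cons {A B C : Set ℝ} {x : Fin 3 → ℝ} :
    x ∈ pi univ ![A, B, C] ↔ x 0 ∈ A ∧ x 1 ∈ B ∧ x 2 ∈ C := by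
  simp [Set.mem_pi, Fin.forall_fin_succ]

theorem integral_pi_cons (f g h : ℝ → ℝ) (A B C : Set ℝ) :
    ∫ x in pi univ ![A, B, C], f (x 0) * g (x 1) * h (x 2) =
      (∫ x in A, f x) * (∫ x in B, g x) * ∫ x in C, h x := by
  rw [volume_pi, Measure.restrict_pi_pi]
  simpa [Fin.prod_univ_three] using integral_fintype_prod_eq_prod
    (μ := fun i => volume.restrict ((![A, B, C] : Fin 3 → Set ℝ) i))
    (fun i => (![f, g, h] : Fin 3 → ℝ → ℝ) i)

theorem sin_sq_arctan (x : ℝ) : Real.sin (Real.arctan x) ^ 2 = x ^ 2 / (1 + x ^ 2) := by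
  rw [Real.sin_arctan, div_pow, Real.sq_sqrt (by positivity)]

variable {α σ ρ₀ : ℝ}

/-- Cylindrical coordinates `(r, φ, z)` with a signed radius, so that `φ ∈ (0, π / 2)` already
covers both quadrants on which `σ x y > 0`. -/
noncomputable def wedgeParam (σ : ℝ) (x : Fin 3 → ℝ) : Fin 3 → ℝ :=
  ![x 0 * Real.cos (x 1), σ * (x 0 * Real.sin (x 1)), x 2]

/-- The set of cylindrical coordinates of points of `wedgePart σ α ρ₀`. -/
noncomputable def wedgeBox (α ρ₀ : ℝ) : Set (Fin 3 → ℝ) :=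
  pi univ ![Icc (-ρ₀) ρ₀ \ {0}, Icc (Real.arctan α) (Real.arctan (1 / α)),
    Ioo (-(√3 / 2 * ρ₀)) (√3 / 2 * ρ₀)]

theorem measurableSet_wedgeBox (α ρ₀ : ℝ) : MeasurableSet (wedgeBox α ρ₀) := by
  refine MeasurableSet.univ_pi fun i => ?_
  fin_cases i
  · exact measurableSet_Icc.diff (measurableSet_singleton 0)
  · exact measurableSet_Icc
  · exact measurableSet_Ioo

theorem exists_hasFDerivAt_wedgeParam (σ : ℝ) (x : Fin 3 → ℝ) :
    ∃ F' : (Fin 3 → ℝ) →L[ℝ] Fin 3 → ℝ, HasFDerivAt (wedgeParam σ) F' x ∧ F'.det = σ * x 0 := by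
  have hx := fun i => hasFDerivAt_coord i x
  refine ⟨_, hasFDerivAt_of_rows (M := !![Real.cos (x 1), -(x 0 * Real.sin (x 1)), 0;
    σ * Real.sin (x 1), σ * (x 0 * Real.cos (x 1)), 0; 0, 0, 1]) fun i => ?_, ?_⟩
  · simp only [Fin.sum_univ_three]
    fin_cases i
    · exact ⟨_, (hx 0).fun_mul (hx 1).cos, fun v => by simp; ring⟩
    · exact ⟨_, ((hx 0).fun_mul (hx 1).sin).const_mul σ, fun v => by simp; ring⟩
    · exact ⟨_, hx 2, fun v => by simp⟩
  · rw [LinearMap.det_toContinuousLinearMap, LinearMap.det_toLin', Matrix.det_fin_three]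
    simp only [Matrix.of_apply, Matrix.cons_val]
    linear_combination σ * x 0 * Real.sin_sq_add_cos_sq (x 1)

theorem mem_Ioo_of_mem_wedgeBox (hα : 0 < α) {x : Fin 3 → ℝ} (hx : x ∈ wedgeBox α ρ₀) :
    x 1 ∈ Ioo 0 (Real.pi / 2) :=
  have ⟨_, hφ, _⟩ := mem_pi_cons.mp hx
  ⟨(Real.arctan_pos.mpr hα).trans_le hφ.1, hφ.2.trans_lt (Real.arctan_lt_pi_div_two _)⟩

theorem wedgeParam_injOn (hσ : σ ≠ 0) :
    InjOn (wedgeParam σ) {x | x 0 ≠ 0 ∧ x 1 ∈ Ioo 0 (Real.pi / 2)} := by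
  have hIoo {φ : ℝ} (hφ : φ ∈ Ioo 0 (Real.pi / 2)) : φ ∈ Ioo (-(Real.pi / 2)) (Real.pi / 2) :=
    ⟨by linarith [hφ.1, hφ.2], hφ.2⟩
  rintro x ⟨hr, hφ⟩ y ⟨-, hφ'⟩ h
  have hcos : x 0 * Real.cos (x 1) = y 0 * Real.cos (y 1) := congrFun h 0
  have hsin : x 0 * Real.sin (x 1) = y 0 * Real.sin (y 1) := mul_left_cancel₀ hσ (congrFun h 1)
  have hc := (Real.cos_pos_of_mem_Ioo (hIoo hφ)).ne'
  have hc' := (Real.cos_pos_of_mem_Ioo (hIoo hφ')).ne'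
  have htan : Real.tan (x 1) = Real.tan (y 1) := by
    rw [← Real.tan_mul_cos hc, ← Real.tan_mul_cos hc', mul_left_comm, mul_left_comm (y 0),
      ← hcos] at hsin
    exact mul_right_cancel₀ (mul_ne_zero hr hc) hsin
  have h1 : x 1 = y 1 := Real.injOn_tan (hIoo hφ) (hIoo hφ') htan
  have h0 : x 0 = y 0 := mul_right_cancel₀ hc' (h1 ▸ hcos)
  have h2 : x 2 = y 2 := congrFun h 2
  ext i
  fin_cases i <;> assumption

theorem wedgeParam_mem_wedgePart_iff (hσ : σ = 1 ∨ σ = -1) {x : Fin 3 → ℝ}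
    (hφ : x 1 ∈ Ioo 0 (Real.pi / 2)) :
    wedgeParam σ x ∈ wedgePart σ α ρ₀ ↔ x ∈ wedgeBox α ρ₀ := by
  have hc : 0 < Real.cos (x 1) := Real.cos_pos_of_mem_Ioo ⟨by linarith [hφ.1, hφ.2], hφ.2⟩
  have hs : 0 < Real.sin (x 1) := Real.sin_pos_of_pos_of_lt_pi hφ.1 (by linarith [hφ.1, hφ.2])
  have hσ2 : σ ^ 2 = 1 := sq_eq_one_iff.mpr hσ
  have hσabs : |σ| = 1 := by rcases hσ with rfl | rfl <;> simp
  have harctan : Real.arctan (Real.sin (x 1) / Real.cos (x 1)) = x 1 := by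
    rw [← Real.tan_eq_sin_div_cos, Real.arctan_tan (by linarith [hφ.1, hφ.2]) hφ.2]
  have hradius : √((x 0 * Real.cos (x 1)) ^ 2 + (σ * (x 0 * Real.sin (x 1))) ^ 2) = |x 0| := by
    rw [← Real.sqrt_sq_eq_abs]
    congr 1
    linear_combination (x 0 * Real.sin (x 1)) ^ 2 * hσ2 + x 0 ^ 2 * Real.sin_sq_add_cos_sq (x 1)
  have hsign : 0 < σ * (x 0 * Real.cos (x 1) * (σ * (x 0 * Real.sin (x 1)))) ↔ x 0 ≠ 0 := by
    rw [show σ * (x 0 * Real.cos (x 1) * (σ * (x 0 * Real.sin (x 1)))) =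
      x 0 ^ 2 * (Real.cos (x 1) * Real.sin (x 1)) by
        linear_combination x 0 ^ 2 * Real.cos (x 1) * Real.sin (x 1) * hσ2,
      mul_pos_iff_of_pos_right (by positivity), sq_pos_iff]
  have hlower (h0 : x 0 ≠ 0) : α * |x 0 * Real.cos (x 1)| ≤ |σ * (x 0 * Real.sin (x 1))| ↔
      Real.arctan α ≤ x 1 := by
    have hr := abs_pos.mpr h0
    rw [abs_mul, abs_mul, abs_mul, hσabs, one_mul, abs_of_pos hc, abs_of_pos hs, mul_left_comm,
      mul_le_mul_iff_right₀ hr, ← le_div_iff₀ hc, ← Real.arctan_le_arctan_iff, harctan]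
  have hupper (h0 : x 0 ≠ 0) : |σ * (x 0 * Real.sin (x 1))| ≤ 1 / α * |x 0 * Real.cos (x 1)| ↔
      x 1 ≤ Real.arctan (1 / α) := by
    have hr := abs_pos.mpr h0
    rw [abs_mul, abs_mul, abs_mul, hσabs, one_mul, abs_of_pos hc, abs_of_pos hs, mul_left_comm,
      mul_le_mul_iff_right₀ hr, ← div_le_iff₀ hc, ← Real.arctan_le_arctan_iff, harctan]
  change (√((x 0 * Real.cos (x 1)) ^ 2 + (σ * (x 0 * Real.sin (x 1))) ^ 2) ≤ ρ₀ ∧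
    0 < σ * (x 0 * Real.cos (x 1) * (σ * (x 0 * Real.sin (x 1)))) ∧
    α * |x 0 * Real.cos (x 1)| ≤ |σ * (x 0 * Real.sin (x 1))| ∧
    |σ * (x 0 * Real.sin (x 1))| ≤ 1 / α * |x 0 * Real.cos (x 1)| ∧
    x 2 ∈ Ioo (-(√3 / 2 * ρ₀)) (√3 / 2 * ρ₀)) ↔ _
  rw [wedgeBox, mem_pi_cons, hradius, hsign, abs_le, Set.mem_sdiff, mem_Icc, mem_Icc]
  grind

theorem exists_wedgeParam_eq (hσ : σ = 1 ∨ σ = -1) {v : Fin 3 → ℝ} (hv : 0 < σ * (v 0 * v 1)) :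
    ∃ x, x 1 ∈ Ioo 0 (Real.pi / 2) ∧ wedgeParam σ x = v := by
  have hσ2 : σ ^ 2 = 1 := sq_eq_one_iff.mpr hσ
  have h0 : v 0 ≠ 0 := fun h => by simp [h] at hv
  set t := σ * v 1 / v 0
  have ht : 0 < t := by
    rw [show t = σ * (v 0 * v 1) / v 0 ^ 2 by simp only [t]; field_simp]
    positivity
  have hsqrt : √(1 + t ^ 2) ≠ 0 := by positivity
  refine ⟨![v 0 * √(1 + t ^ 2), Real.arctan t, v 2],
    ⟨Real.arctan_pos.mpr ht, Real.arctan_lt_pi_div_two t⟩, ?_⟩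
  have hcos : v 0 * √(1 + t ^ 2) * Real.cos (Real.arctan t) = v 0 := by
    rw [Real.cos_arctan]
    field_simp
  have hsin : σ * (v 0 * √(1 + t ^ 2) * Real.sin (Real.arctan t)) = v 1 := by
    rw [Real.sin_arctan]
    calc σ * (v 0 * √(1 + t ^ 2) * (t / √(1 + t ^ 2))) = σ * (v 0 * t) := by field_simp
      _ = σ ^ 2 * v 1 := by rw [mul_div_cancel₀ _ h0]; ring
      _ = v 1 := by rw [hσ2, one_mul]
  ext i
  fin_cases i
  exacts [hcos, hsin, rfl]

theorem wedgeParam_image (hα : 0 < α) (hσ : σ = 1 ∨ σ = -1) :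
    wedgeParam σ '' wedgeBox α ρ₀ = wedgePart σ α ρ₀ := by
  refine Subset.antisymm (image_subset_iff.mpr fun x hx =>
    (wedgeParam_mem_wedgePart_iff hσ (mem_Ioo_of_mem_wedgeBox hα hx)).mpr hx) fun v hv => ?_
  obtain ⟨x, hφ, rfl⟩ := exists_wedgeParam_eq hσ hv.2.1
  exact mem_image_of_mem _ ((wedgeParam_mem_wedgePart_iff hσ hφ).mp hv)

theorem integral_wedgePart_flatTrace (hα : 0 < α) (hσ : σ = 1 ∨ σ = -1) (ρ₀ k : ℝ) :
    ∫ v in wedgePart σ α ρ₀, flatTrace (k * σ) v = ∫ x in wedgeBox α ρ₀,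
      |x 0| ^ 3 * (k / 3 * (Real.sin (x 1) * Real.cos (x 1)) - 1 / 6) := by
  have hσ2 : σ ^ 2 = 1 := sq_eq_one_iff.mpr hσ
  have hσabs : |σ| = 1 := by rcases hσ with rfl | rfl <;> simp
  have hσ0 : σ ≠ 0 := fun h => by simp [h] at hσ2
  have hbox : wedgeBox α ρ₀ ⊆ {x | x 0 ≠ 0 ∧ x 1 ∈ Ioo 0 (Real.pi / 2)} := fun x hx =>
    ⟨(mem_pi_cons.mp hx).1.2, mem_Ioo_of_mem_wedgeBox hα hx⟩
  choose F' hF' hdet using exists_hasFDerivAt_wedgeParam σ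
  rw [← wedgeParam_image hα hσ, integral_image_eq_integral_abs_det_fderiv_smul volume
    (measurableSet_wedgeBox α ρ₀) (fun x _ => (hF' x).hasFDerivWithinAt)
    ((wedgeParam_injOn hσ0).mono hbox)]
  refine setIntegral_congr_fun (measurableSet_wedgeBox α ρ₀) fun x _ => ?_
  have htrace : flatTrace (k * σ) (wedgeParam σ x) =
      x 0 ^ 2 * (k / 3 * (Real.sin (x 1) * Real.cos (x 1)) - 1 / 6) := by
    simp only [flatTrace, wedgeParam, Matrix.cons_val_zero, Matrix.cons_val_one]
    linear_combination (k / 3 * x 0 ^ 2 * Real.sin (x 1) * Real.cos (x 1)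
      - x 0 ^ 2 / 6 * Real.sin (x 1) ^ 2) * hσ2 - x 0 ^ 2 / 6 * Real.sin_sq_add_cos_sq (x 1)
  rw [hdet, abs_mul, hσabs, one_mul, smul_eq_mul, htrace, ← sq_abs]
  ring

theorem integral_abs_pow_three (hρ : 0 ≤ ρ₀) :
    ∫ r in Icc (-ρ₀) ρ₀ \ {0}, |r| ^ 3 = ρ₀ ^ 4 / 2 := by
  have hcont : Continuous fun r : ℝ => |r| ^ 3 := by fun_prop
  have hhalf : ∫ r in (0)..ρ₀, |r| ^ 3 = ρ₀ ^ 4 / 4 := by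
    rw [intervalIntegral.integral_congr (g := fun r => r ^ 3) fun r hr => by
      simp only [abs_of_nonneg (uIcc_of_le hρ ▸ hr).1], integral_pow]
    norm_num
  have hneg : ∫ r in (-ρ₀)..0, |r| ^ 3 = ρ₀ ^ 4 / 4 := by
    rw [← hhalf]
    simpa using
      (intervalIntegral.integral_comp_neg (fun r : ℝ => |r| ^ 3) (a := 0) (b := ρ₀)).symm
  rw [setIntegral_congr_set (sdiff_null_ae_eq_self (measure_singleton 0)),
    integral_Icc_eq_integral_Ioc, ← intervalIntegral.integral_of_le (by linarith),
    ← intervalIntegral.integral_add_adjacent_intervals (hcont.intervalIntegrable _ 0)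
      (hcont.intervalIntegrable 0 _), hneg, hhalf]
  ring

theorem integral_sin_mul_cos_sub_const (hα : 0 < α) (hα1 : α ≤ 1) (k : ℝ) :
    ∫ φ in Icc (Real.arctan α) (Real.arctan (1 / α)),
        (k / 3 * (Real.sin φ * Real.cos φ) - 1 / 6) =
      1 / 6 * (k * ((1 - α ^ 2) / (1 + α ^ 2)) - (Real.arctan (1 / α) - Real.arctan α)) := by
  have hle : Real.arctan α ≤ Real.arctan (1 / α) :=
    Real.arctan_mono (hα1.trans ((one_le_div hα).mpr hα1))
  rw [integral_Icc_eq_integral_Ioc, ← intervalIntegral.integral_of_le hle,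
    intervalIntegral.integral_sub (Continuous.intervalIntegrable (by fun_prop) _ _)
      (Continuous.intervalIntegrable (by fun_prop) _ _),
    intervalIntegral.integral_const_mul, integral_sin_mul_cos₁, sin_sq_arctan, sin_sq_arctan,
    intervalIntegral.integral_const, smul_eq_mul]
  field_simp
  ring

theorem two_mul_integral_wedgePart_flatTrace (hσ : σ = 1 ∨ σ = -1) (hα : 0 < α) (hα1 : α ≤ 1)
    (hρ : 0 ≤ ρ₀) (k : ℝ) :
    2 * ∫ v in wedgePart σ α ρ₀, flatTrace (k * σ) v = fifthCoeff α k ρ₀ := by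
  have hheight : ∫ _ in Ioo (-(√3 / 2 * ρ₀)) (√3 / 2 * ρ₀), (1 : ℝ) = √3 * ρ₀ := by
    have : 0 ≤ √3 / 2 * ρ₀ := by positivity
    rw [setIntegral_const, Real.volume_real_Ioo_of_le (by linarith), smul_eq_mul]
    ring
  have hprod := integral_pi_cons (fun r => |r| ^ 3)
    (fun φ => k / 3 * (Real.sin φ * Real.cos φ) - 1 / 6) (fun _ => 1) (Icc (-ρ₀) ρ₀ \ {0})
    (Icc (Real.arctan α) (Real.arctan (1 / α))) (Ioo (-(√3 / 2 * ρ₀)) (√3 / 2 * ρ₀))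
  simp only [mul_one] at hprod
  rw [integral_wedgePart_flatTrace hα hσ, wedgeBox, hprod, integral_abs_pow_three hρ,
    integral_sin_mul_cos_sub_const hα hα1, hheight, fifthCoeff]
  ring

theorem fifthCoeff_pos_iff (hα : 0 < α) (hα1 : α < 1) (hρ : 0 < ρ₀) (k : ℝ) :
    0 < fifthCoeff α k ρ₀ ↔ kStar α < k := by
  have hsub : 0 < 1 - α ^ 2 := by nlinarith
  have hadd : 0 < 1 + α ^ 2 := by positivity
  have hscale : 0 < √3 * ρ₀ ^ 5 / 6 := by positivity
  rw [fifthCoeff, mul_pos_iff_of_pos_left hscale, sub_pos, kStar, div_mul_eq_mul_div,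
    div_lt_iff₀ hsub, mul_div_assoc', lt_div_iff₀ hadd, mul_comm (1 + α ^ 2)]

end

section

open MeasureTheory

variable {α k ρ₀ : ℝ} {b : ℝ → ℝ} {χ : ℝ × ℝ → ℝ}

theorem eventually_existsUnique_geodesic_wedge (hα : 0 < α) (hα1 : α < 1) (hb : IsTransition b)
    (hχ : IsPlaneCutoff χ) (k ρ₀ : ℝ) :
    ∀ᶠ t : ℝ in 𝓝[>] 0, ∀ v ∈ dilate t (wedge α ρ₀),
      (∃ c w, IsGeodesicFrom α k b χ v c w) ∧
      ∀ c w c' w', IsGeodesicFrom α k b χ v c w → IsGeodesicFrom α k b χ v c' w' →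
        EqOn c c' (Icc 0 1) := by
  obtain ⟨c, w, h⟩ := exists_isModelFlow (k * 1)
  obtain ⟨c', w', h'⟩ := exists_isModelFlow (k * (-1))
  filter_upwards [h.eventually_existsUnique_geodesic hα hα1 hb hχ (Or.inl rfl) ρ₀,
    h'.eventually_existsUnique_geodesic hα hα1 hb hχ (Or.inr rfl) ρ₀] with t hpos hneg v hv
  rw [wedge, dilate, image_union] at hv
  exact hv.elim (hpos v) (hneg v)

theorem riemVol_exp_wedge_isBigO (hα : 0 < α) (hα1 : α < 1) (hb : IsTransition b)
    (hχ : IsPlaneCutoff χ) (k : ℝ) (hρ : 0 ≤ ρ₀) :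
    (fun t : ℝ => (riemVol α k b χ (expAt α k b χ '' dilate t (wedge α ρ₀))).toReal
      - t ^ 3 * volume.real (wedge α ρ₀) - fifthCoeff α k ρ₀ * t ^ 5)
      =O[𝓝[>] 0] fun t : ℝ => t ^ 6 := by
  obtain ⟨c, w, h⟩ := exists_isModelFlow (k * 1)
  obtain ⟨c', w', h'⟩ := exists_isModelFlow (k * (-1))
  have hpos := h.volume_real_flatten_image (measurableSet_wedgePart 1 α ρ₀)
    (isBounded_wedgePart 1 α ρ₀)
  have hneg := h'.volume_real_flatten_image (measurableSet_wedgePart (-1) α ρ₀)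
    (isBounded_wedgePart (-1) α ρ₀)
  have hcoeff := two_mul_integral_wedgePart_flatTrace (Or.inl rfl) hα hα1.le hρ k
  have hcoeff' := two_mul_integral_wedgePart_flatTrace (Or.inr rfl) hα hα1.le hρ k
  refine (hpos.add hneg).congr' ?_ EventuallyEq.rfl
  filter_upwards [eventually_riemVol_exp_wedge h h' hα hα1 hb hχ ρ₀] with t hvol
  rw [hvol, volume_real_wedge]
  linear_combination -(t ^ 5 / 2) * hcoeff - t ^ 5 / 2 * hcoeff'

end

theorem mainTheorem6_general (α k ρ₀ : ℝ) (hα0 : 0 < α) (hα1 : α < 1)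
    (b : ℝ → ℝ) (hb : IsTransition b) (χ : ℝ × ℝ → ℝ) (hχ : IsPlaneCutoff χ)
    (hρ0 : 0 < ρ₀) :
    (∀ᶠ t : ℝ in 𝓝[>] 0, ∀ v ∈ dilate t (wedge α ρ₀),
      (∃ c w, IsGeodesicFrom α k b χ v c w) ∧
      ∀ c w c' w', IsGeodesicFrom α k b χ v c w → IsGeodesicFrom α k b χ v c' w' →
        EqOn c c' (Icc 0 1)) ∧
    (fun t : ℝ =>
        (riemVol α k b χ (expAt α k b χ '' dilate t (wedge α ρ₀))).toReal
          - t ^ 3 * (MeasureTheory.volume (wedge α ρ₀)).toReal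
          - fifthCoeff α k ρ₀ * t ^ 5)
      =O[𝓝[>] 0] (fun t : ℝ => t ^ 6) ∧
    (0 < fifthCoeff α k ρ₀ ↔ kStar α < k) ∧
    (∀ p ∈ sphereCircle \ singularCircle, SmoothMetricAt α k b χ p) ∧
    ((∀ x, fderiv ℝ χ x (1, 0) ^ 2 + fderiv ℝ χ x (0, 1) ^ 2 ≤ 4) →
      ∀ p ∈ sphereCircle \ singularCircle, 5 / 8 ≤ scalarCurvature α k b χ p) :=
  ⟨eventually_existsUnique_geodesic_wedge hα0 hα1 hb hχ k ρ₀,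
    riemVol_exp_wedge_isBigO hα0 hα1 hb hχ k hρ0.le,
    fifthCoeff_pos_iff hα0 hα1 hρ0 k,
    fun _ hp => smoothMetricAt hχ hb hα0 k hp,
    fun hgrad _ hp => scalarCurvature_ge hχ hb hα0 k hgrad hp⟩

theorem mainTheorem6 (α k ρ₀ : ℝ) (hα0 : 0 < α) (hα1 : α < 1)
    (b : ℝ → ℝ) (hb : IsTransition b) (χ : ℝ × ℝ → ℝ) (hχ : IsPlaneCutoff χ)
    (hρ0 : 0 < ρ₀)
    (hρ : ρ₀ ≤ min (rhoStar α k / 2) (√(1 + α ^ 2) * α ^ (α / (1 - α)))) :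
    -- for small `t`, the exponential map is well defined on `tΩ`
    (∀ᶠ t : ℝ in 𝓝[>] 0, ∀ v ∈ dilate t (wedge α ρ₀),
      (∃ c w, IsGeodesicFrom α k b χ v c w) ∧
      ∀ c w c' w', IsGeodesicFrom α k b χ v c w → IsGeodesicFrom α k b χ v c' w' →
        EqOn c c' (Icc 0 1)) ∧
    -- the volume expansion
    (fun t : ℝ =>
        (riemVol α k b χ (expAt α k b χ '' dilate t (wedge α ρ₀))).toReal
          - t ^ 3 * (MeasureTheory.volume (wedge α ρ₀)).toReal
          - fifthCoeff α k ρ₀ * t ^ 5)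
      =O[𝓝[>] 0] (fun t : ℝ => t ^ 6) ∧
    -- the sign of the fifth-order coefficient
    (0 < fifthCoeff α k ρ₀ ↔ kStar α < k) ∧
    -- away from the singular circle the metric is smooth, with positive scalar curvature
    (∀ p ∈ sphereCircle \ singularCircle, SmoothMetricAt α k b χ p) ∧
    ((∀ x, fderiv ℝ χ x (1, 0) ^ 2 + fderiv ℝ χ x (0, 1) ^ 2 ≤ 4) →
      ∀ p ∈ sphereCircle \ singularCircle, 5 / 8 ≤ scalarCurvature α k b χ p) :=
  mainTheorem6_general α k ρ₀ hα0 hα1 b hb χ hχ hρ0
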